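/- **Setting.** Let $s,\delta\ge 1$ be integers, $\mathcal S=\{1,\dots,s\}$, $\mathbb F_q$ the finite field with $q$ elements, and $\gamma=(\gamma_u)_{u\subseteq\mathcal S}$ non-negative reals. *Variation.* For a finite set $\kappa$ and $g:[0,1)^{\kappa}\to\mathbb R$, $0<\lambda\le 1$, $p\ge 1$, let $$V^{(|\kappa|)}_{\lambda,p}(g)=\sup_{\mathcal P}\Big(\sum_{J\in\mathcal P}\mathrm{Vol}(J)\Big|\frac{\Delta(g,J)}{\mathrm{Vol}(J)^{\lambda}}\Big|^{p}\Big)^{1/p},$$ where $\mathcal P$ runs over the finite families of pairwise disjoint boxes $J=\prod_{i\in\kappa}[a_i,b_i)$ with $0\le a_i<b_i<1$, and $\Delta(g,J)$ is the alternating sum of $g$ over the vertices of $J$; for $\kappa=\emptyset$ this is $|g|$. For integrable $g:[0,1)^{u}\to\mathbb R$ and $\mathfrak q\ge 1$ put $V_{\lambda,p,\mathfrak q}(g)=\big(\sum_{w\subseteq u}V^{(|w|)}_{\lambda,p}(g_w)^{\mathfrak q}\big)^{1/\mathfrak q}$ with $g_w(x_w)=\int_{[0,1)^{u\setminus w}}g\,dx_{u\setminus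 w}$; for non-integrable $g$ put $V_{\lambda,p,\mathfrak q}(g)=\infty$. *Smoothness.* Let $f:[0,1)^s\to\mathbb R$ be such that all partial mixed derivatives $f^{(\tau)}$, $\tau\in\{0,\dots,\delta\}^s$, exist and are continuous on $[0,1)^s$. With $u(\tau)=\{j:\tau_j=\delta\}$, $v(\tau)=\{j:\tau_j>0\}$ and $p,\mathfrak q,r\ge 1$ let $$N_{\delta,\lambda,\gamma}(f)=\Big(\sum_{\tau\in\{0,\dots,\delta\}^s}\gamma_{v(\tau)}^{-1}\,V_{\lambda,p,\mathfrak q}\big(f^{(\tau)}(\cdot,0_{\mathcal S\setminus u(\tau)})\big)^{r}\Big)^{1/r}\in[0,\infty],$$ where $0/0=0$ and $a/0=\infty$ for $a>0$. *Digital nets.* Fix a bijection $\varphi:\{0,\dots,q-1\}\to\mathbb F_q$. Matrices $C_1,\dots,C_s\in\mathbb F_q^{n\times m}$ ($n,m\ge1$) define points $x_0,\dots,x_{q^m-1}\in[0,1)^s$: if $h=\sum_i h_iq^i$ and $C_j(\varphi(h_0),\dots,\varphi(h_{m-1}))^{\top}=(y_{j,1},\dots,y_{j,n})^{\top}$, then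 $x_{h,j}=\sum_{l=1}^n\varphi^{-1}(y_{j,l})q^{-l}$. For integers $\alpha\ge1$, $t\ge 0$ and real $0<\beta\le\alpha m/n$ with $t\le\beta n$ they form a digital $(t,\alpha,\beta,n\times m,s)$-net if for all $0\le\nu_j\le m$ and $n\ge i_{j,1}>\dots>i_{j,\nu_j}\ge1$ with $\sum_{j=1}^s\sum_{l=1}^{\min(\nu_j,\alpha)}i_{j,l}\le\beta n-t$, the rows numbered $i_{j,1},\dots,i_{j,\nu_j}$ of $C_j$, $j=1,\dots,s$, are together linearly independent. A digital $(t,m,s)$-net is a digital $(t,1,1,m\times m,s)$-net. Let $I_s(f)=\int_{[0,1)^s}f$ and $Q_{q^m,s}(f)=q^{-m}\sum_{h=0}^{q^m-1}f(x_h)$. **Theorem.** (1) There is a constant $C_{\delta,s,q,\gamma}>0$, depending only on $\delta,s,q,\gamma$, such that for all $0<\lambda\le1$, all $p,\mathfrak q,r\ge1$ and all $f$ as above with $N_{\delta,\lambda,\gamma}(f)<\infty$, the function $f$ is integrable, and for every digital $(t,\delta+1,\beta,n\times m,s)$-net over $\mathbb F_q$ with $0<\beta\le1$: if $\lambda<1$,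 then $$|I_s(f)-Q_{q^m,s}(f)|\le q^{-(\delta+\lambda)\lfloor(\beta n-t)/(\delta+1)\rfloor}\,C_{\delta,s,q,\gamma}\,N_{\delta,\lambda,\gamma}(f)\sum_{\emptyset\ne u\subseteq\mathcal S}\gamma_u\,C_{|u|,q,\delta+\lambda}\,(\beta n-t+\delta+1)^{|u|(\delta+1)-1},$$ and if $\lambda=1$, then $$|I_s(f)-Q_{q^m,s}(f)|\le q^{-(\beta n-t)}\,C_{\delta,s,q,\gamma}\,N_{\delta,1,\gamma}(f)\sum_{\emptyset\ne u\subseteq\mathcal S}\gamma_u\,C'_{|u|,q,\delta+1}\,(\beta n-t+\delta+1)^{|u|(\delta+1)},$$ where $$C_{k,q,\vartheta}=q^{k\lceil\vartheta\rceil}\big((q-q^{\vartheta-\lfloor\vartheta\rfloor})^{-1}+(1-q^{(1-\vartheta)/\lceil\vartheta\rceil})^{-k\lceil\vartheta\rceil}\big),\qquad C'_{k,q,\vartheta}=q^{k\vartheta}\big(q^{-1}+(1-q^{1/\vartheta-1})^{-k\vartheta}\big).$$ (2) Let $0<\lambda\le1$, $\vartheta=\delta+\lambda$, let $d$ be an integer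 with $\vartheta\le d$ and $t'\ge0$ an integer. Given generating matrices $C_1,\dots,C_{sd}\in\mathbb F_q^{m\times m}$ of a digital $(t',m,sd)$-net over $\mathbb F_q$, let $C^{(d)}_j$ be the $dm\times m$ matrix made of the first rows of $C_{(j-1)d+1},\dots,C_{jd}$, then their second rows, and so on. There is a constant $K$, depending only on $\delta,\lambda,s,q,\gamma,d,t'$, such that for all $m$, all such matrices, all $p,\mathfrak q,r\ge 1$ and all $f$ as above with $N_{\delta,\lambda,\gamma}(f)<\infty$, the rule $Q_{N,s}$ with the $N=q^m$ points generated by $C^{(d)}_1,\dots,C^{(d)}_s$ satisfies $$|I_s(f)-Q_{N,s}(f)|\le K\,N_{\delta,\lambda,\gamma}(f)\,N^{-\vartheta}(\log N)^{s\vartheta}.$$ (3) For every $d\ge1$ there is $t'$ such that for every $m\ge\max(1,t')$ there exists a digital $(t',m,sd)$-net over $\mathbb F_q$; so the rate in (2) is attained for arbitrarily large $N$. -/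

import Mathlib

open MeasureTheory Finset
open scoped ENNReal NNReal

noncomputable section

namespace HigherOrderQMC

/-- The half-open unit cube `[0,1)^ι`. -/
def cube (ι : Type*) : Set (ι → ℝ) := Set.pi Set.univ fun _ => Set.Ico (0 : ℝ) 1

/-- The point `(x_u, y_{ι ∖ u})`. -/
def glue {ι : Type*} [DecidableEq ι] (u : Finset ι) (x : u → ℝ) (y : ι → ℝ) : ι → ℝ :=
  fun i => if h : i ∈ u then x ⟨i, h⟩ else y i

/-! ### Variation -/

/-- Alternating sum of `g` over the vertices of the box `∏ i, [a i, b i)`. -/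
def boxDelta {κ : Type*} [Fintype κ] [DecidableEq κ]
    (g : (κ → ℝ) → ℝ) (a b : κ → ℝ) : ℝ :=
  ∑ v : Finset κ, (-1 : ℝ) ^ v.card * g (fun i => if i ∈ v then a i else b i)

/-- Volume of the box `∏ i, [a i, b i)`. -/
def boxVol {κ : Type*} [Fintype κ] (a b : κ → ℝ) : ℝ := ∏ i, (b i - a i)

/-- Finite families of pairwise disjoint nonempty boxes `∏ i, [a i, b i)` all of whose vertices lie
in `[0,1)^κ`, the domain of the functions considered. -/
def IsBoxFamily {κ : Type*} (P : Finset ((κ → ℝ) × (κ → ℝ))) : Prop :=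
  (∀ J ∈ P, ∀ i, 0 ≤ J.1 i ∧ J.1 i < J.2 i ∧ J.2 i < 1) ∧
  (P : Set ((κ → ℝ) × (κ → ℝ))).PairwiseDisjoint
    fun J => Set.pi Set.univ fun i => Set.Ico (J.1 i) (J.2 i)

/-- Generalized Vitali variation `V_{lam,p}^{(|κ|)}(g)`.  Every finite disjoint family of boxes
extends to a partition and all summands are nonnegative, so the supremum over such families is the
supremum over partitions.  For empty `κ` the value is `|g|` at the only point. -/
def vitaliVariation {κ : Type*} [Fintype κ] [DecidableEq κ]
    (lam p : ℝ) (g : (κ → ℝ) → ℝ) : ℝ≥0∞ :=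
  ⨆ (P : Finset ((κ → ℝ) × (κ → ℝ))) (_ : IsBoxFamily P),
    (∑ J ∈ P, ENNReal.ofReal
      (boxVol J.1 J.2 * (|boxDelta g J.1 J.2| / boxVol J.1 J.2 ^ lam) ^ p)) ^ (1 / p)

/-- The projection `g_w(x_w) = ∫ g(x) dx_{ι ∖ w}`: as the unit cube has measure one, the integral may
be taken over all coordinates of the dummy variable `y`. -/
def proj {ι : Type*} [Fintype ι] [DecidableEq ι]
    (g : (ι → ℝ) → ℝ) (w : Finset ι) (x : w → ℝ) : ℝ :=
  ∫ y in cube ι, g (glue w x y)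

open Classical in
/-- Generalized (unweighted) Hardy and Krause variation `V_{lam,p,q}(g)`.  It is built from integrals
of `g`, and is infinite for functions that are not integrable. -/
def hkVariation {ι : Type*} [Fintype ι] [DecidableEq ι]
    (lam p q : ℝ) (g : (ι → ℝ) → ℝ) : ℝ≥0∞ :=
  if IntegrableOn g (cube ι) then
    (∑ w : Finset ι, vitaliVariation lam p (proj g w) ^ q) ^ (1 / q)
  else ⊤

/-! ### Mixed partial derivatives and the functional `N` -/

/-- Partial derivative in coordinate `j` on `[0,1)^s` (one-sided at the boundary). -/
def partialD {s : ℕ} (j : Fin s) (g : (Fin s → ℝ) → ℝ) (x : Fin s → ℝ) : ℝ :=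
  derivWithin (fun y => g (Function.update x j y)) (Set.Ico (0 : ℝ) 1) (x j)

/-- `f^{(τ)} = ∂^{τ_1 + ⋯ + τ_s} f / ∂x_1^{τ_1} ⋯ ∂x_s^{τ_s}`. -/
def mixedPartial {s : ℕ} (τ : Fin s → ℕ) (f : (Fin s → ℝ) → ℝ) : (Fin s → ℝ) → ℝ :=
  (List.finRange s).foldr (fun j g => (partialD j)^[τ j] g) f

/-- The partial mixed derivatives of `f` up to order `δ` in each variable exist and are continuous
on `[0,1)^s`. -/
def HasMixedPartials {s : ℕ} (δ : ℕ) (f : (Fin s → ℝ) → ℝ) : Prop :=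
  ∀ τ : Fin s → ℕ, (∀ j, τ j ≤ δ) →
    ContinuousOn (mixedPartial τ f) (cube (Fin s)) ∧
    ∀ j, τ j < δ → ∀ x ∈ cube (Fin s),
      HasDerivWithinAt (fun y => mixedPartial τ f (Function.update x j y))
        (mixedPartial (τ + Pi.single j 1) f x) (Set.Ico (0 : ℝ) 1) (x j)

/-- `u(τ)`, the coordinates in which the order of differentiation is `δ`. -/
def topSet {s : ℕ} (δ : ℕ) (τ : Fin s → ℕ) : Finset (Fin s) := univ.filter fun j => τ j = δ

/-- `v(τ)`, the coordinates in which the order of differentiation is positive. -/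
def posSet {s : ℕ} (τ : Fin s → ℕ) : Finset (Fin s) := univ.filter fun j => 0 < τ j

/-- The `|u(τ)|`-dimensional function `f^{(τ)}(·, 0)`, with the coordinates outside `u(τ)` set to
zero. -/
def anchored {s : ℕ} (δ : ℕ) (τ : Fin s → ℕ) (f : (Fin s → ℝ) → ℝ)
    (x : topSet δ τ → ℝ) : ℝ :=
  mixedPartial τ f (glue (topSet δ τ) x 0)

/-- `N_{δ,lam,γ}(f)`, with the parameters `p, q, r`.  In `ℝ≥0∞` one has `0 / 0 = 0` and `a / 0 = ∞`
for `a ≠ 0`, which is the convention for vanishing weights. -/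
def smoothNorm {s : ℕ} (δ : ℕ) (lam p q r : ℝ) (γ : Finset (Fin s) → ℝ≥0)
    (f : (Fin s → ℝ) → ℝ) : ℝ≥0∞ :=
  (∑ τ : Fin s → Fin (δ + 1),
    hkVariation lam p q (anchored δ (fun j => (τ j : ℕ)) f) ^ r /
      (γ (posSet fun j => (τ j : ℕ)) : ℝ≥0∞)) ^ (1 / r)

/-! ### Digital nets -/

section Nets

variable {F : Type*} [Field F] [Fintype F]

/-- The vector over `F` of the `m` lowest base `q` digits of `h`, where `q = |F|`. -/
def digitVec (φ : Fin (Fintype.card F) ≃ F) (m h : ℕ) : Fin m → F :=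
  fun i => φ ⟨h / Fintype.card F ^ (i : ℕ) % Fintype.card F, Nat.mod_lt _ Fintype.card_pos⟩

/-- The `h`-th point of the digital net generated by the matrices `C j`. -/
def netPoint {s n m : ℕ} (φ : Fin (Fintype.card F) ≃ F)
    (C : Fin s → Matrix (Fin n) (Fin m) F) (h : ℕ) : Fin s → ℝ :=
  fun j => ∑ l : Fin n,
    ((φ.symm ((C j).mulVec (digitVec φ m h) l) : ℕ) : ℝ) / (Fintype.card F : ℝ) ^ ((l : ℕ) + 1)

/-- The matrices `C j` generate a digital `(t, α, β, n × m, s)`-net over `F`.  Row indices are counted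
from zero, so that row `i` has number `i + 1`. -/
def IsDigitalNet {s n m : ℕ} (t α : ℕ) (β : ℝ)
    (C : Fin s → Matrix (Fin n) (Fin m) F) : Prop :=
  1 ≤ n ∧ 1 ≤ m ∧ 1 ≤ α ∧ 0 < β ∧ β ≤ (α : ℝ) * m / n ∧ (t : ℝ) ≤ β * n ∧
  ∀ (ν : Fin s → ℕ) (i : ∀ j, Fin (ν j) → Fin n),
    (∀ j, ν j ≤ m) → (∀ j, StrictAnti (i j)) →
    ((∑ j, ∑ l : Fin (ν j), if (l : ℕ) < α then ((i j l : ℕ) + 1) else 0 : ℕ) : ℝ) ≤ β * n - t →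
    LinearIndependent F (fun x : (j : Fin s) × Fin (ν j) => C x.1 (i x.1 x.2))

/-- The `m d × m` matrix number `j` consists of the first rows of the `d` matrices
`C_{jd}, …, C_{jd+d-1}`, then of their second rows, and so on. -/
def interlace {s d m : ℕ} (C : Fin (s * d) → Matrix (Fin m) (Fin m) F) :
    Fin s → Matrix (Fin (m * d)) (Fin m) F :=
  fun j l => C (finProdFinEquiv (j, (finProdFinEquiv.symm l).2)) (finProdFinEquiv.symm l).1

/-- `I_s(f) - Q_{q^m,s}(f)` for the digital net generated by the matrices `C j`. -/
def integrationError {s n m : ℕ} (φ : Fin (Fintype.card F) ≃ F)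
    (C : Fin s → Matrix (Fin n) (Fin m) F) (f : (Fin s → ℝ) → ℝ) : ℝ :=
  (∫ x in cube (Fin s), f x) -
    (∑ h ∈ range (Fintype.card F ^ m), f (netPoint φ C h)) / (Fintype.card F : ℝ) ^ m

end Nets

/-! ### Constants -/

/-- The constant `C_{k,q,θ}` for non-integers `θ > 1`. -/
def constFrac (k q : ℕ) (θ : ℝ) : ℝ :=
  (q : ℝ) ^ (k * ⌈θ⌉₊) *
    (((q : ℝ) - (q : ℝ) ^ (θ - (⌊θ⌋₊ : ℝ)))⁻¹ +
      ((1 - (q : ℝ) ^ ((1 - θ) / (⌈θ⌉₊ : ℝ))) ^ (k * ⌈θ⌉₊))⁻¹)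

/-- The constant `C'_{k,q,θ}` for integers `θ > 1`. -/
def constInt (k q θ : ℕ) : ℝ :=
  (q : ℝ) ^ (k * θ) *
    ((q : ℝ)⁻¹ + ((1 - (q : ℝ) ^ (1 / (θ : ℝ) - 1)) ^ (k * θ))⁻¹)

end HigherOrderQMC

end

open HigherOrderQMC

namespace HigherOrderQMC

/-! ### The largest positions of a finite set -/

/-- The largest element of `S`, counted from one; zero for the empty set. -/
def lead (S : Finset ℕ) : ℕ := S.sup (· + 1)

/-- `S` without its largest element. -/
def strip (S : Finset ℕ) : Finset ℕ := S.erase (lead S - 1)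

/-- The `i`-th largest element of `S`, counted from one, or zero if there is none. -/
def top (S : Finset ℕ) (i : ℕ) : ℕ := lead (strip^[i] S)

lemma succ_le_lead {S : Finset ℕ} {l : ℕ} (h : l ∈ S) : l + 1 ≤ lead S :=
  Finset.le_sup (f := (· + 1)) h

@[simp] lemma lead_empty : lead ∅ = 0 := rfl

@[simp] lemma strip_empty : strip ∅ = ∅ := rfl

lemma lead_sub_one_mem {S : Finset ℕ} (h : S.Nonempty) : lead S - 1 ∈ S := by
  obtain ⟨l, hl, e⟩ := Finset.exists_mem_eq_sup S h (· + 1)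
  have : lead S - 1 = l := by unfold lead; omega
  rwa [this]

lemma lead_pos {S : Finset ℕ} : 0 < lead S ↔ S.Nonempty := by
  constructor
  · intro h
    by_contra hne
    rw [Finset.not_nonempty_iff_eq_empty] at hne
    subst hne
    simp at h
  · rintro ⟨l, hl⟩
    have := succ_le_lead hl
    omega

lemma lead_le {S : Finset ℕ} {c : ℕ} : lead S ≤ c ↔ ∀ l ∈ S, l < c := by
  unfold lead
  simp [Finset.sup_le_iff]

lemma lead_strip_lt {S : Finset ℕ} (h : S.Nonempty) : lead (strip S) < lead S := by
  have h0 := lead_pos.2 h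
  have : lead (strip S) ≤ lead S - 1 := by
    rw [lead_le]
    intro l hl
    have h1 := Finset.mem_erase.1 hl
    have := succ_le_lead h1.2
    omega
  omega

lemma card_strip (S : Finset ℕ) : (strip S).card = S.card - 1 := by
  rcases S.eq_empty_or_nonempty with rfl | h
  · simp
  · exact Finset.card_erase_of_mem (lead_sub_one_mem h)

lemma strip_subset (S : Finset ℕ) : strip S ⊆ S := Finset.erase_subset _ _

lemma iterate_strip_subset (i : ℕ) (S : Finset ℕ) : strip^[i] S ⊆ S := by
  induction i generalizing S with
  | zero => simp
  | succ i ih => exact (ih _).trans (strip_subset S)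

@[simp] lemma top_zero (S : Finset ℕ) : top S 0 = lead S := rfl

lemma top_succ (S : Finset ℕ) (i : ℕ) : top S (i + 1) = top (strip S) i := rfl

lemma top_succ' (S : Finset ℕ) (i : ℕ) : top S (i + 1) = lead (strip (strip^[i] S)) := by
  rw [top, Function.iterate_succ_apply']

@[simp] lemma top_empty (i : ℕ) : top ∅ i = 0 := by
  induction i with
  | zero => rfl
  | succ i ih => rw [top_succ, strip_empty, ih]

lemma top_succ_lt {S : Finset ℕ} {i : ℕ} (h : 0 < top S i) : top S (i + 1) < top S i := by
  rw [top_succ']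
  exact lead_strip_lt (lead_pos.1 h)

lemma top_antitone (S : Finset ℕ) : Antitone (top S) := by
  apply antitone_nat_of_succ_le
  intro i
  rcases Nat.eq_zero_or_pos (top S i) with h | h
  · have : strip^[i] S = ∅ := by
      by_contra hne
      exact absurd (lead_pos.2 (Finset.nonempty_iff_ne_empty.2 hne)) (by unfold top at h; omega)
    rw [top_succ', this]
    simp
  · exact (top_succ_lt h).le

lemma card_iterate_strip (i : ℕ) (S : Finset ℕ) : (strip^[i] S).card = S.card - i := by
  induction i generalizing S with
  | zero => simp
  | succ i ih => rw [Function.iterate_succ_apply, ih, card_strip]; omega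

lemma top_pos {S : Finset ℕ} {i : ℕ} : 0 < top S i ↔ i < S.card := by
  unfold top
  rw [lead_pos, ← Finset.card_pos, card_iterate_strip]
  omega

lemma top_sub_one_mem {S : Finset ℕ} {i : ℕ} (h : 0 < top S i) : top S i - 1 ∈ S :=
  iterate_strip_subset i S (lead_sub_one_mem (lead_pos.1 h))

lemma top_strictAnti {S : Finset ℕ} {i i' : ℕ} (hi : i < i') (h : 0 < top S i) :
    top S i' < top S i :=
  (top_antitone S hi).trans_lt (top_succ_lt h)

lemma card_le_top_add (S : Finset ℕ) (i : ℕ) : S.card ≤ top S i + i := by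
  induction i generalizing S with
  | zero =>
    have : S ⊆ range (lead S) := fun l hl => mem_range.2 (succ_le_lead hl)
    simpa using Finset.card_le_card this
  | succ i ih =>
    have := ih (strip S)
    rw [card_strip] at this
    rw [top_succ]
    omega

lemma sum_top_card {M : Type*} [AddCommMonoid M] (S : Finset ℕ) (f : ℕ → M) :
    ∑ i ∈ range S.card, f (top S i - 1) = ∑ l ∈ S, f l := by
  induction hn : S.card generalizing S with
  | zero => rw [Finset.card_eq_zero.1 hn]; simp
  | succ n ih =>
    have hne : S.Nonempty := by rw [← Finset.card_pos]; omega
    rw [Finset.sum_range_succ', ← Finset.add_sum_erase S f (lead_sub_one_mem hne), add_comm]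
    congr 1
    exact ih (strip S) (by rw [card_strip]; omega)

lemma sum_succ_le_sum_top {S S' : Finset ℕ} {p : ℕ} (h : S' ⊆ S) (hp : S'.card ≤ p) :
    ∑ l ∈ S', (l + 1) ≤ ∑ i ∈ range p, top S i := by
  induction p generalizing S S' with
  | zero => rw [Finset.card_eq_zero.1 (Nat.le_zero.1 hp)]; simp
  | succ p ih =>
    rcases S'.eq_empty_or_nonempty with rfl | hne
    · simp
    have key : ∃ l ∈ S', S'.erase l ⊆ strip S := by
      by_cases hl : lead S - 1 ∈ S'
      · exact ⟨_, hl, Finset.erase_subset_erase _ h⟩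
      · obtain ⟨l, hl'⟩ := hne
        refine ⟨l, hl', fun x hx => Finset.mem_erase.2 ⟨?_, h (Finset.mem_of_mem_erase hx)⟩⟩
        rintro rfl
        exact hl (Finset.mem_of_mem_erase hx)
    obtain ⟨l, hl, hsub⟩ := key
    rw [Finset.sum_range_succ', ← Finset.add_sum_erase S' _ hl, add_comm]
    exact add_le_add (ih hsub (by rw [Finset.card_erase_of_mem hl]; omega)) (succ_le_lead (h hl))

lemma mem_top_or_lt {S : Finset ℕ} {l : ℕ} (hl : l ∈ S) (d : ℕ) :
    (∃ i ≤ d, top S i = l + 1) ∨ l + 1 < top S d := by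
  induction d generalizing S with
  | zero =>
    have := succ_le_lead hl
    rcases this.eq_or_lt with h | h
    · exact Or.inl ⟨0, le_rfl, h.symm⟩
    · exact Or.inr h
  | succ d ih =>
    by_cases h : l = lead S - 1
    · have := succ_le_lead hl
      exact Or.inl ⟨0, by omega, by rw [top_zero]; omega⟩
    · rcases ih (Finset.mem_erase.2 ⟨h, hl⟩ : l ∈ strip S) with ⟨i, hi, e⟩ | h'
      · exact Or.inl ⟨i + 1, by omega, by rw [top_succ]; exact e⟩
      · exact Or.inr (by rwa [top_succ])

/-- Averaging over the first terms of a decreasing sequence. -/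
lemma mul_sum_range_le_of_antitone {a : ℕ → ℕ} (ha : Antitone a) {p d : ℕ} (hpd : p ≤ d) :
    p * ∑ i ∈ range d, a i ≤ d * ∑ i ∈ range p, a i := by
  obtain ⟨e, rfl⟩ := Nat.exists_eq_add_of_le hpd
  rw [Finset.sum_range_add]
  have h1 : ∑ i ∈ range e, a (p + i) ≤ e * a p := by
    simpa using Finset.sum_le_card_nsmul (range e) (fun i => a (p + i)) (a p)
      (fun i _ => ha (Nat.le_add_right p i))
  have h2 : p * a p ≤ ∑ i ∈ range p, a i := by
    simpa using Finset.card_nsmul_le_sum (range p) a (a p)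
      (fun i hi => ha (Finset.mem_range.1 hi).le)
  nlinarith [Nat.mul_le_mul_left p h1, Nat.mul_le_mul_left e h2]

/-! ### Digits and Walsh functions -/

section Walsh

variable {F : Type*} [Field F] [Fintype F]

/-- The element of `F` that belongs to digit number `l + 1` of the fractional part of `x` in base
`|F|`. -/
noncomputable def symb (φ : Fin (Fintype.card F) ≃ F) (l : ℕ) (x : ℝ) : F :=
  φ ⟨(⌊x * (Fintype.card F : ℝ) ^ (l + 1)⌋ % (Fintype.card F : ℤ)).toNat, by
    have h0 : (0 : ℤ) < Fintype.card F := by exact_mod_cast Fintype.card_pos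
    have h1 := Int.emod_lt_of_pos ⌊x * (Fintype.card F : ℝ) ^ (l + 1)⌋ h0
    have h2 := Int.emod_nonneg ⌊x * (Fintype.card F : ℝ) ^ (l + 1)⌋ h0.ne'
    omega⟩

/-- The Walsh function with digits `K` supported on `S`. -/
noncomputable def walsh (ψ : AddChar F ℂ) (φ : Fin (Fintype.card F) ≃ F) (K : ℕ → F)
    (S : Finset ℕ) (x : ℝ) : ℂ :=
  ∏ l ∈ S, ψ (symb φ l x * K l)

lemma card_pos_real : (0 : ℝ) < Fintype.card F := by exact_mod_cast Fintype.card_pos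

lemma one_le_card_real : (1 : ℝ) ≤ Fintype.card F := by exact_mod_cast Fintype.card_pos

lemma card_pow_pos (e : ℕ) : (0 : ℝ) < (Fintype.card F : ℝ) ^ e := pow_pos card_pos_real e

lemma floor_mul_pow_eq (x : ℝ) {l e : ℕ} (h : l ≤ e) :
    ⌊x * (Fintype.card F : ℝ) ^ l⌋ =
      ⌊x * (Fintype.card F : ℝ) ^ e⌋ / ((Fintype.card F ^ (e - l) : ℕ) : ℤ) := by
  rw [← Int.floor_div_natCast]
  congr 1
  obtain ⟨d, rfl⟩ := Nat.exists_eq_add_of_le h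
  have := (card_pow_pos (F := F) d).ne'
  rw [Nat.add_sub_cancel_left, pow_add]
  push_cast
  field_simp

lemma symb_congr (φ : Fin (Fintype.card F) ≃ F) {l e : ℕ} (h : l < e) {x y : ℝ}
    (hxy : ⌊x * (Fintype.card F : ℝ) ^ e⌋ = ⌊y * (Fintype.card F : ℝ) ^ e⌋) :
    symb φ l x = symb φ l y := by
  unfold symb
  have : ⌊x * (Fintype.card F : ℝ) ^ (l + 1)⌋ = ⌊y * (Fintype.card F : ℝ) ^ (l + 1)⌋ := by
    rw [floor_mul_pow_eq x (Nat.succ_le_of_lt h), floor_mul_pow_eq y (Nat.succ_le_of_lt h), hxy]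
  simp only [this]

lemma symb_eq_iff (φ : Fin (Fintype.card F) ≃ F) {l : ℕ} {x y : ℝ} :
    symb φ l x = symb φ l y ↔
      ⌊x * (Fintype.card F : ℝ) ^ (l + 1)⌋ % (Fintype.card F : ℤ) =
        ⌊y * (Fintype.card F : ℝ) ^ (l + 1)⌋ % (Fintype.card F : ℤ) := by
  have h0 : (0 : ℤ) < Fintype.card F := by exact_mod_cast Fintype.card_pos
  have h1 := Int.emod_nonneg ⌊x * (Fintype.card F : ℝ) ^ (l + 1)⌋ h0.ne'
  have h2 := Int.emod_nonneg ⌊y * (Fintype.card F : ℝ) ^ (l + 1)⌋ h0.ne'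
  unfold symb
  rw [φ.apply_eq_iff_eq, Fin.mk.injEq]
  omega

lemma floor_eq_iff_symb (φ : Fin (Fintype.card F) ≃ F) {x y : ℝ} (hxy : ⌊x⌋ = ⌊y⌋) (G : ℕ) :
    ⌊x * (Fintype.card F : ℝ) ^ G⌋ = ⌊y * (Fintype.card F : ℝ) ^ G⌋ ↔
      ∀ l < G, symb φ l x = symb φ l y := by
  refine ⟨fun h l hl => symb_congr φ hl h, ?_⟩
  induction G with
  | zero => intro _; simpa using hxy
  | succ G ih =>
    intro h
    have h1 := ih fun l hl => h l (by omega)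
    have h2 := (symb_eq_iff φ).1 (h G (by omega))
    have h3 := floor_mul_pow_eq (F := F) x (Nat.le_succ G)
    have h4 := floor_mul_pow_eq (F := F) y (Nat.le_succ G)
    simp only [Nat.succ_eq_add_one, Nat.add_sub_cancel_left, pow_one] at h3 h4
    rw [← Int.mul_ediv_add_emod ⌊x * (Fintype.card F : ℝ) ^ (G + 1)⌋ (Fintype.card F : ℤ),
      ← h3, h1, h4, h2, Int.mul_ediv_add_emod]

lemma symb_periodic (φ : Fin (Fintype.card F) ≃ F) (l : ℕ) :
    Function.Periodic (symb φ l) (1 / (Fintype.card F : ℝ) ^ l) := by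
  intro x
  rw [symb_eq_iff]
  have h : (x + 1 / (Fintype.card F : ℝ) ^ l) * (Fintype.card F : ℝ) ^ (l + 1) =
      x * (Fintype.card F : ℝ) ^ (l + 1) + (Fintype.card F : ℤ) := by
    have := (card_pow_pos (F := F) l).ne'
    rw [pow_succ]
    push_cast
    field_simp
  rw [h, Int.floor_add_intCast, Int.add_emod_right]

lemma symb_eq_of_digit (φ : Fin (Fintype.card F) ≃ F) {l : ℕ} {x : ℝ}
    (i : Fin (Fintype.card F)) (h : ⌊x * (Fintype.card F : ℝ) ^ (l + 1)⌋ % (Fintype.card F : ℤ) = i) :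
    symb φ l x = φ i := by
  unfold symb
  congr 1
  ext
  simp [h]

lemma measurable_comp_symb (φ : Fin (Fintype.card F) ≃ F) (l : ℕ) (g : F → ℂ) :
    Measurable fun x => g (symb φ l x) := by
  have : (fun x => g (symb φ l x)) = (fun z : ℤ => g (φ ⟨(z % (Fintype.card F : ℤ)).toNat, by
    have h0 : (0 : ℤ) < Fintype.card F := by exact_mod_cast Fintype.card_pos
    have h1 := Int.emod_lt_of_pos z h0
    have h2 := Int.emod_nonneg z h0.ne'
    omega⟩)) ∘ fun x : ℝ => ⌊x * (Fintype.card F : ℝ) ^ (l + 1)⌋ := rfl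
  rw [this]
  exact (measurable_of_countable _).comp (measurable_id.mul_const _).floor

variable (ψ : AddChar F ℂ) (φ : Fin (Fintype.card F) ≃ F) (K : ℕ → F)

lemma measurable_walsh (S : Finset ℕ) : Measurable (walsh ψ φ K S) :=
  Finset.measurable_prod _ fun l _ => measurable_comp_symb φ l fun y => ψ (y * K l)

lemma norm_walsh (S : Finset ℕ) (x : ℝ) : ‖walsh ψ φ K S x‖ = 1 := by
  unfold walsh
  rw [norm_prod]
  exact Finset.prod_eq_one fun l _ => AddChar.norm_apply ψ _

lemma walsh_congr {S : Finset ℕ} {e : ℕ} (hS : lead S ≤ e) {x y : ℝ}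
    (hxy : ⌊x * (Fintype.card F : ℝ) ^ e⌋ = ⌊y * (Fintype.card F : ℝ) ^ e⌋) :
    walsh ψ φ K S x = walsh ψ φ K S y :=
  Finset.prod_congr rfl fun l hl => by rw [symb_congr φ (lead_le.1 hS l hl) hxy]

lemma walsh_eq_mul_strip {S : Finset ℕ} (hS : S.Nonempty) (x : ℝ) :
    walsh ψ φ K S x =
      ψ (symb φ (lead S - 1) x * K (lead S - 1)) * walsh ψ φ K (strip S) x :=
  (Finset.mul_prod_erase S _ (lead_sub_one_mem hS)).symm

/-! ### Functions with vanishing means on blocks, and iterated integrals -/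

/-- Measurable functions that are integrable on every bounded interval. -/
def LocInt (Φ : ℝ → ℂ) : Prop := Measurable Φ ∧ ∀ a b, IntervalIntegrable Φ volume a b

/-- `Φ` has mean zero on the `N` intervals of length `1 / N` of `[0,1)`. -/
def BlockMeanZero (N : ℕ) (Φ : ℝ → ℂ) : Prop :=
  ∀ c < N, ∫ x in ((c : ℝ) / N)..((c + 1 : ℝ) / N), Φ x = 0

/-- The integral of `Φ` from `t` to one. -/
noncomputable def tailInt (Φ : ℝ → ℂ) (t : ℝ) : ℂ := ∫ x in t..1, Φ x

lemma LocInt.of_bounded {Φ : ℝ → ℂ} (h : Measurable Φ) {M : ℝ} (hM : ∀ x, ‖Φ x‖ ≤ M) :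
    LocInt Φ := by
  refine ⟨h, fun a b => ?_⟩
  refine IntervalIntegrable.mono_fun (g := Φ) (f := fun _ => M) intervalIntegrable_const
    h.aestronglyMeasurable (Filter.Eventually.of_forall fun x => ?_)
  exact (hM x).trans (le_abs_self M)

lemma LocInt.of_continuous {Φ : ℝ → ℂ} (h : Continuous Φ) : LocInt Φ :=
  ⟨h.measurable, fun a b => h.intervalIntegrable a b⟩

lemma LocInt.mul_bounded {P Φ : ℝ → ℂ} (hP : LocInt P) (h : Measurable Φ) (hM : ∀ x, ‖Φ x‖ ≤ 1) :
    LocInt fun x => P x * Φ x := by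
  refine ⟨hP.1.mul h, fun a b => ?_⟩
  refine (hP.2 a b).mono_fun (hP.1.mul h).aestronglyMeasurable
    (Filter.Eventually.of_forall fun x => ?_)
  simp only [norm_mul]
  exact mul_le_of_le_one_right (norm_nonneg _) (hM x)

lemma LocInt.continuous_tailInt {Φ : ℝ → ℂ} (h : LocInt Φ) : Continuous (tailInt Φ) := by
  have : tailInt Φ = fun t => -∫ x in (1 : ℝ)..t, Φ x := by
    funext t
    rw [tailInt, intervalIntegral.integral_symm]
  rw [this]
  exact (intervalIntegral.continuous_primitive h.2 1).neg

lemma LocInt.tailInt {Φ : ℝ → ℂ} (h : LocInt Φ) : LocInt (tailInt Φ) :=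
  LocInt.of_continuous h.continuous_tailInt

lemma LocInt.iterate_tailInt {Φ : ℝ → ℂ} (h : LocInt Φ) (i : ℕ) :
    LocInt (HigherOrderQMC.tailInt^[i] Φ) := by
  induction i with
  | zero => exact h
  | succ i ih => rw [Function.iterate_succ_apply']; exact ih.tailInt

lemma locInt_walsh (S : Finset ℕ) : LocInt (walsh ψ φ K S) :=
  LocInt.of_bounded (measurable_walsh ψ φ K S) fun x => (norm_walsh ψ φ K S x).le

lemma BlockMeanZero.tail_eq {N : ℕ} (hN : 0 < N) {Φ : ℝ → ℂ} (hΦ : LocInt Φ)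
    (hz : BlockMeanZero N Φ) {c : ℕ} (hc : c < N) (t : ℝ) :
    tailInt Φ t = ∫ x in t..((c + 1 : ℝ) / N), Φ x := by
  have hN' : (N : ℝ) ≠ 0 := by positivity
  have key : ∀ d : ℕ, c + 1 + d ≤ N →
      ∫ x in ((c + 1 : ℝ) / N)..((c + 1 + d : ℕ) : ℝ) / N, Φ x = 0 := by
    intro d
    induction d with
    | zero => intro _; simp
    | succ d ih =>
      intro hd
      rw [← intervalIntegral.integral_add_adjacent_intervals (hΦ.2 _ (((c + 1 + d : ℕ) : ℝ) / N))
        (hΦ.2 _ _), ih (by omega), zero_add]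
      have := hz (c + 1 + d) (by omega)
      rw [← this]
      push_cast
      ring_nf
  have h1 := key (N - (c + 1)) (by omega)
  rw [show c + 1 + (N - (c + 1)) = N by omega, div_self hN'] at h1
  rw [tailInt, ← intervalIntegral.integral_add_adjacent_intervals (hΦ.2 t ((c + 1 : ℝ) / N))
    (hΦ.2 _ _), h1, add_zero]

lemma exists_block {N : ℕ} (hN : 0 < N) {t : ℝ} (ht : t ∈ Set.Ico (0 : ℝ) 1) :
    ∃ c < N, (c : ℝ) / N ≤ t ∧ t < (c + 1 : ℝ) / N := by
  have hN' : (0 : ℝ) < N := by positivity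
  have h0 : 0 ≤ t * N := mul_nonneg ht.1 hN'.le
  refine ⟨⌊t * N⌋₊, ?_, ?_, ?_⟩
  · rw [Nat.floor_lt h0]
    nlinarith [ht.2]
  · rw [div_le_iff₀ hN']
    exact Nat.floor_le h0
  · rw [lt_div_iff₀ hN']
    exact Nat.lt_floor_add_one _

lemma BlockMeanZero.norm_tailInt_le {N : ℕ} (hN : 0 < N) {Φ : ℝ → ℂ} (hΦ : LocInt Φ)
    (hz : BlockMeanZero N Φ) {M : ℝ} (hM : ∀ x ∈ Set.Ico (0 : ℝ) 1, ‖Φ x‖ ≤ M)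
    {t : ℝ} (ht : t ∈ Set.Ico (0 : ℝ) 1) : ‖tailInt Φ t‖ ≤ M / N := by
  obtain ⟨c, hc, h1, h2⟩ := exists_block hN ht
  have hN' : (0 : ℝ) < N := by positivity
  have hM0 : 0 ≤ M := (norm_nonneg _).trans (hM t ht)
  have hc1 : (c + 1 : ℝ) / N ≤ 1 := by
    rw [div_le_one hN']
    exact_mod_cast hc
  rw [hz.tail_eq hN hΦ hc t, intervalIntegral.integral_of_le h2.le, integral_Ioc_eq_integral_Ioo]
  have := norm_setIntegral_le_of_norm_le_const (μ := volume) (s := Set.Ioo t ((c + 1 : ℝ) / N))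
    (f := Φ) (C := M) (by simp) (fun x hx => hM x ⟨ht.1.trans hx.1.le, hx.2.trans_le hc1⟩)
  refine this.trans ?_
  rw [Measure.real, Real.volume_Ioo, ENNReal.toReal_ofReal (by linarith), div_eq_mul_one_div M]
  refine mul_le_mul_of_nonneg_left ?_ hM0
  have : (c + 1 : ℝ) / N = c / N + 1 / N := by ring
  linarith

lemma norm_tailInt_le {Φ : ℝ → ℂ} {M : ℝ} (hM : ∀ x ∈ Set.Ico (0 : ℝ) 1, ‖Φ x‖ ≤ M)
    {t : ℝ} (ht : t ∈ Set.Ico (0 : ℝ) 1) : ‖tailInt Φ t‖ ≤ M := by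
  have hM0 : 0 ≤ M := (norm_nonneg _).trans (hM t ht)
  rw [tailInt, intervalIntegral.integral_of_le ht.2.le, integral_Ioc_eq_integral_Ioo]
  have := norm_setIntegral_le_of_norm_le_const (μ := volume) (s := Set.Ioo t 1)
    (f := Φ) (C := M) (by simp) (fun x hx => hM x ⟨ht.1.trans hx.1.le, hx.2⟩)
  refine this.trans ?_
  rw [Measure.real, Real.volume_Ioo, ENNReal.toReal_ofReal (by linarith [ht.2])]
  exact mul_le_of_le_one_right hM0 (by linarith [ht.1])

lemma BlockMeanZero.tailInt_zero {N : ℕ} (hN : 0 < N) {Φ : ℝ → ℂ} (hΦ : LocInt Φ)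
    (hz : BlockMeanZero N Φ) : tailInt Φ 0 = 0 := by
  have h := hz 0 hN
  have h2 := hz.tail_eq hN hΦ hN 0
  rw [h2]
  simpa using h

/-! ### The iterated integrals of Walsh functions -/

lemma periodic_of_le {P : ℝ → ℂ} {e e' : ℕ} (he : e' ≤ e)
    (hP : Function.Periodic P (1 / (Fintype.card F : ℝ) ^ e)) :
    Function.Periodic P (1 / (Fintype.card F : ℝ) ^ e') := by
  obtain ⟨d, rfl⟩ := Nat.exists_eq_add_of_le he
  have h := hP.nat_mul (Fintype.card F ^ d)
  have h1 := (card_pow_pos (F := F) d).ne'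
  have h2 := (card_pow_pos (F := F) e').ne'
  convert! h using 1
  rw [pow_add]
  push_cast
  field_simp

lemma floor_eq_of_mem_block {N : ℕ} (hN : 0 < N) {c : ℤ} {x : ℝ}
    (h1 : (c : ℝ) / N ≤ x) (h2 : x < (c + 1 : ℝ) / N) : ⌊x * N⌋ = c := by
  have hN' : (0 : ℝ) < N := by positivity
  rw [Int.floor_eq_iff]
  rw [div_le_iff₀ hN'] at h1
  rw [lt_div_iff₀ hN'] at h2
  exact ⟨h1, h2⟩

variable {ψ φ K}

lemma periodic_mul_char {P : ℝ → ℂ} {e : ℕ}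
    (hP : Function.Periodic P (1 / (Fintype.card F : ℝ) ^ (e + 1))) :
    Function.Periodic (fun x => P x * ψ (symb φ e x * K e)) (1 / (Fintype.card F : ℝ) ^ e) := by
  intro x
  have h1 := periodic_of_le (F := F) (Nat.le_succ e) hP
  simp only
  rw [h1 x, symb_periodic φ e x]

lemma locInt_mul_char {P : ℝ → ℂ} (hP : LocInt P) (e : ℕ) :
    LocInt fun x => P x * ψ (symb φ e x * K e) :=
  hP.mul_bounded (measurable_comp_symb φ e fun y => ψ (y * K e))
    fun _ => (AddChar.norm_apply ψ _).le

lemma integral_period_mul_char (hψ : ψ.IsPrimitive) {P : ℝ → ℂ} (hPi : LocInt P) {e : ℕ}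
    (hP : Function.Periodic P (1 / (Fintype.card F : ℝ) ^ (e + 1))) (hK : K e ≠ 0) :
    ∫ x in (0 : ℝ)..(1 / (Fintype.card F : ℝ) ^ e), P x * ψ (symb φ e x * K e) = 0 := by
  classical
  have hθ := locInt_mul_char (ψ := ψ) (φ := φ) (K := K) hPi e
  have hN : 0 < Fintype.card F ^ (e + 1) := pow_pos Fintype.card_pos _
  have hq0 : (0 : ℝ) < Fintype.card F := card_pos_real
  have h1 := intervalIntegral.sum_integral_adjacent_intervals (μ := volume) (n := Fintype.card F)
    (a := fun k => (k : ℝ) / (Fintype.card F ^ (e + 1) : ℕ)) (fun k _ => hθ.2 _ _)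
  have h2 : ((Fintype.card F : ℝ)) / (Fintype.card F ^ (e + 1) : ℕ) = 1 / (Fintype.card F : ℝ) ^ e := by
    push_cast
    rw [pow_succ]
    field_simp
  simp only [Nat.cast_zero, zero_div] at h1
  rw [← h2, ← h1, Finset.sum_range]
  have h3 : ∀ i : Fin (Fintype.card F), ∫ x in ((i : ℕ) : ℝ) / (Fintype.card F ^ (e + 1) : ℕ)..(((i : ℕ) + 1 : ℕ) : ℝ) /
      (Fintype.card F ^ (e + 1) : ℕ), P x * ψ (symb φ e x * K e) =
      (∫ x in (0 : ℝ)..(1 / (Fintype.card F : ℝ) ^ (e + 1)), P x) * ψ (φ i * K e) := by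
    intro i
    have hle : ((i : ℕ) : ℝ) / (Fintype.card F ^ (e + 1) : ℕ) ≤ (((i : ℕ) + 1 : ℕ) : ℝ) / (Fintype.card F ^ (e + 1) : ℕ) := by
      gcongr
      simp
    have := hP.intervalIntegral_add_eq 0 (((i : ℕ) : ℝ) / (Fintype.card F ^ (e + 1) : ℕ))
    rw [zero_add] at this
    rw [this, ← intervalIntegral.integral_mul_const]
    have hend : (((i : ℕ) : ℝ) / (Fintype.card F ^ (e + 1) : ℕ)) + 1 / (Fintype.card F : ℝ) ^ (e + 1) =
        (((i : ℕ) + 1 : ℕ) : ℝ) / (Fintype.card F ^ (e + 1) : ℕ) := by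
      push_cast
      ring
    rw [hend]
    refine intervalIntegral.integral_congr_Ioo_of_le hle fun x hx => ?_
    rw [symb_eq_of_digit φ i]
    have hx2 := hx.2
    rw [Nat.cast_succ] at hx2
    have hf := floor_eq_of_mem_block (c := (i : ℕ)) (x := x) hN
      (by rw [Int.cast_natCast]; exact hx.1.le) (by rw [Int.cast_natCast]; exact hx2)
    push_cast at hf
    rw [hf]
    exact Int.emod_eq_of_lt (by positivity) (by exact_mod_cast i.2)
  rw [Finset.sum_congr rfl fun i _ => h3 i, ← Finset.mul_sum,
    Equiv.sum_comp φ fun y => ψ (y * K e), AddChar.sum_mulShift _ hψ, if_neg hK]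
  simp

/-- One integration step: if `Φ` is a Walsh function times a periodic function, then `Φ` has mean zero
on blocks, and its integral is of the same form with the leading digit removed. -/
lemma walsh_step (hψ : ψ.IsPrimitive) {S : Finset ℕ} (hS : S.Nonempty) (hK : ∀ l ∈ S, K l ≠ 0)
    {Φ P : ℝ → ℂ} (hPi : LocInt P) (hΦi : LocInt Φ)
    (hP : Function.Periodic P (1 / (Fintype.card F : ℝ) ^ lead S))
    (hΦ : ∀ t ∈ Set.Ico (0 : ℝ) 1, Φ t = P t * walsh ψ φ K S t) :
    BlockMeanZero (Fintype.card F ^ (lead S - 1)) Φ ∧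
      ∃ P' : ℝ → ℂ, LocInt P' ∧
        Function.Periodic P' (1 / (Fintype.card F : ℝ) ^ (lead S - 1)) ∧
        ∀ t ∈ Set.Ico (0 : ℝ) 1, tailInt Φ t = P' t * walsh ψ φ K (strip S) t := by
  obtain ⟨e, he⟩ : ∃ e, lead S = e + 1 := ⟨lead S - 1, by have := lead_pos.2 hS; omega⟩
  have hKe : K e ≠ 0 := by
    have := hK _ (lead_sub_one_mem hS)
    rwa [he, Nat.add_sub_cancel] at this
  rw [he, Nat.add_sub_cancel]
  rw [he] at hP
  have hN : 0 < Fintype.card F ^ e := pow_pos Fintype.card_pos _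
  have hN' : (0 : ℝ) < (Fintype.card F ^ e : ℕ) := by exact_mod_cast hN
  set θ : ℝ → ℂ := fun x => P x * ψ (symb φ e x * K e) with hθdef
  have hθ : LocInt θ := locInt_mul_char hPi e
  have hθper : Function.Periodic θ (1 / (Fintype.card F : ℝ) ^ e) := periodic_mul_char hP
  have hθ0 : ∀ t, ∫ x in t..(t + 1 / (Fintype.card F : ℝ) ^ e), θ x = 0 := by
    intro t
    rw [hθper.intervalIntegral_add_eq t 0, zero_add]
    exact integral_period_mul_char hψ hPi hP hKe
  have hstrip : lead (strip S) ≤ e := by have := lead_strip_lt hS; omega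
  have hconst : ∀ c < Fintype.card F ^ e, ∀ t x, (c : ℝ) / (Fintype.card F ^ e : ℕ) ≤ t → t < (c + 1 : ℝ) / (Fintype.card F ^ e : ℕ) →
      t ≤ x → x < (c + 1 : ℝ) / (Fintype.card F ^ e : ℕ) → Φ x = θ x * walsh ψ φ K (strip S) t := by
    intro c hc t x h1 h2 h3 h4
    have hx1 : (c + 1 : ℝ) / (Fintype.card F ^ e : ℕ) ≤ 1 := by
      rw [div_le_one hN']
      exact_mod_cast hc
    have hx0 : 0 ≤ (c : ℝ) / (Fintype.card F ^ e : ℕ) := by positivity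
    rw [hΦ x ⟨by linarith, by linarith⟩, walsh_eq_mul_strip ψ φ K hS, he, Nat.add_sub_cancel,
      hθdef, mul_assoc]
    congr 2
    refine walsh_congr ψ φ K hstrip ?_
    have e1 := floor_eq_of_mem_block (c := (c : ℤ)) (x := x) hN
      (by rw [Int.cast_natCast]; exact h1.trans h3) (by rw [Int.cast_natCast]; exact h4)
    have e2 := floor_eq_of_mem_block (c := (c : ℤ)) (x := t) hN
      (by rw [Int.cast_natCast]; exact h1) (by rw [Int.cast_natCast]; exact h2)
    push_cast at e1 e2
    rw [e1, e2]
  have hint : ∀ c < Fintype.card F ^ e, ∀ t, (c : ℝ) / (Fintype.card F ^ e : ℕ) ≤ t → t < (c + 1 : ℝ) / (Fintype.card F ^ e : ℕ) →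
      ∫ x in t..((c + 1 : ℝ) / (Fintype.card F ^ e : ℕ)), Φ x =
        (∫ x in t..((c + 1 : ℝ) / (Fintype.card F ^ e : ℕ)), θ x) * walsh ψ φ K (strip S) t := by
    intro c hc t h1 h2
    rw [← intervalIntegral.integral_mul_const]
    exact intervalIntegral.integral_congr_Ioo_of_le h2.le fun x hx =>
      hconst c hc t x h1 h2 hx.1.le hx.2
  have hbz : BlockMeanZero (Fintype.card F ^ e) Φ := by
    intro c hc
    have hend : ((c : ℝ) / (Fintype.card F ^ e : ℕ)) + 1 / (Fintype.card F : ℝ) ^ e = (c + 1 : ℝ) / (Fintype.card F ^ e : ℕ) := by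
      push_cast
      ring
    have hlt : (c : ℝ) / (Fintype.card F ^ e : ℕ) < (c + 1 : ℝ) / (Fintype.card F ^ e : ℕ) := by
      rw [← hend]
      have := card_pow_pos (F := F) e
      have : 0 < 1 / (Fintype.card F : ℝ) ^ e := by positivity
      linarith
    rw [hint c hc _ le_rfl hlt, ← hend, hθ0, zero_mul]
  refine ⟨hbz, fun t => -∫ x in (0 : ℝ)..t, θ x, ?_, ?_, ?_⟩
  · exact LocInt.of_continuous (intervalIntegral.continuous_primitive hθ.2 0).neg
  · intro t
    simp only
    rw [← intervalIntegral.integral_add_adjacent_intervals (hθ.2 0 t) (hθ.2 _ _), hθ0, add_zero]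
  · intro t ht
    obtain ⟨c, hc, h1, h2⟩ := exists_block hN ht
    rw [hbz.tail_eq hN hΦi hc t, hint c hc t h1 h2]
    congr 1
    have h0 : ∀ n : ℕ, ∫ x in (0 : ℝ)..((n : ℝ) / (Fintype.card F ^ e : ℕ)), θ x = 0 := by
      intro n
      induction n with
      | zero => simp
      | succ n ih =>
        rw [← intervalIntegral.integral_add_adjacent_intervals
          (hθ.2 0 ((n : ℝ) / (Fintype.card F ^ e : ℕ))) (hθ.2 _ _), ih, zero_add]
        have := hθ0 ((n : ℝ) / (Fintype.card F ^ e : ℕ))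
        rw [← this]
        push_cast
        ring_nf
    have h3 := h0 (c + 1)
    push_cast at h3 ⊢
    rw [← intervalIntegral.integral_add_adjacent_intervals (hθ.2 0 t) (hθ.2 _ _)] at h3
    linear_combination h3

lemma iterate_tailInt_walsh (hψ : ψ.IsPrimitive) {S : Finset ℕ} (hK : ∀ l ∈ S, K l ≠ 0) (i : ℕ)
    (hi : 0 < top S i) :
    ∃ P : ℝ → ℂ, LocInt P ∧ Function.Periodic P (1 / (Fintype.card F : ℝ) ^ top S i) ∧
      ∀ t ∈ Set.Ico (0 : ℝ) 1,
        tailInt^[i] (walsh ψ φ K S) t = P t * walsh ψ φ K (strip^[i] S) t := by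
  induction i with
  | zero =>
    exact ⟨fun _ => 1, LocInt.of_continuous continuous_const, fun _ => rfl, fun t _ => by simp⟩
  | succ i ih =>
    have hi' : 0 < top S i := hi.trans_le (top_antitone S (Nat.le_succ i))
    obtain ⟨P, hPi, hP, h⟩ := ih hi'
    have hne := lead_pos.1 hi'
    obtain ⟨-, P', h1, h2, h3⟩ := walsh_step hψ hne
      (fun l hl => hK l (iterate_strip_subset i S hl)) hPi
      ((locInt_walsh ψ φ K S).iterate_tailInt i) hP h
    refine ⟨P', h1, periodic_of_le ?_ h2, ?_⟩
    · have := top_succ_lt hi'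
      have e : top S i = lead (strip^[i] S) := rfl
      omega
    · intro t ht
      rw [Function.iterate_succ_apply', Function.iterate_succ_apply', h3 t ht]

lemma blockMeanZero_iterate_tailInt (hψ : ψ.IsPrimitive) {S : Finset ℕ} (hK : ∀ l ∈ S, K l ≠ 0)
    {i : ℕ} (hi : 0 < top S i) :
    BlockMeanZero (Fintype.card F ^ (top S i - 1)) (tailInt^[i] (walsh ψ φ K S)) := by
  obtain ⟨P, hPi, hP, h⟩ := iterate_tailInt_walsh (φ := φ) hψ hK i hi
  exact (walsh_step hψ (lead_pos.1 hi) (fun l hl => hK l (iterate_strip_subset i S hl)) hPi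
      ((locInt_walsh ψ φ K S).iterate_tailInt i) hP h).1

lemma norm_iterate_tailInt_le (hψ : ψ.IsPrimitive) {S : Finset ℕ} (hK : ∀ l ∈ S, K l ≠ 0) (i : ℕ) :
    ∀ t ∈ Set.Ico (0 : ℝ) 1, ‖tailInt^[i] (walsh ψ φ K S) t‖ ≤
      (Fintype.card F : ℝ) ^ i / (Fintype.card F : ℝ) ^ ∑ l ∈ range i, top S l := by
  induction i with
  | zero => intro t _; simp [norm_walsh]
  | succ i ih =>
    intro t ht
    have hq := card_pos_real (F := F)
    have hq1 := one_le_card_real (F := F)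
    rw [Function.iterate_succ_apply', Finset.sum_range_succ]
    rcases Nat.eq_zero_or_pos (top S i) with h0 | h0
    · rw [h0, add_zero]
      refine (norm_tailInt_le ih ht).trans ?_
      gcongr
      omega
    · refine ((blockMeanZero_iterate_tailInt hψ hK h0).norm_tailInt_le
        (pow_pos Fintype.card_pos _) ((locInt_walsh ψ φ K S).iterate_tailInt i) ih ht).trans
        (le_of_eq ?_)
      obtain ⟨e, he⟩ : ∃ e, top S i = e + 1 := ⟨top S i - 1, by omega⟩
      rw [he, Nat.add_sub_cancel]
      push_cast
      field_simp
      ring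

lemma iterate_tailInt_zero (hψ : ψ.IsPrimitive) {S : Finset ℕ} (hK : ∀ l ∈ S, K l ≠ 0)
    {i : ℕ} (hi : 0 < top S i) : tailInt^[i + 1] (walsh ψ φ K S) 0 = 0 := by
  rw [Function.iterate_succ_apply']
  exact (blockMeanZero_iterate_tailInt hψ hK hi).tailInt_zero (pow_pos Fintype.card_pos _)
    ((locInt_walsh ψ φ K S).iterate_tailInt i)

end Walsh

/-! ### Lebesgue measure on the unit cube -/

/-- Lebesgue measure on `[0,1)`. -/
noncomputable def unitM : Measure ℝ := volume.restrict (Set.Ico 0 1)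

instance : IsProbabilityMeasure unitM := ⟨by simp [unitM]⟩

/-- Lebesgue measure on `[0,1)^ι`. -/
noncomputable abbrev cubeM (ι : Type*) [Fintype ι] : Measure (ι → ℝ) := Measure.pi fun _ => unitM

lemma mem_cube {ι : Type*} {x : ι → ℝ} : x ∈ cube ι ↔ ∀ i, x i ∈ Set.Ico (0 : ℝ) 1 := by
  simp [cube]

lemma glue_mem_cube {ι : Type*} [DecidableEq ι] {u : Finset ι} {x : u → ℝ} {y : ι → ℝ} (hx : x ∈ cube u) (hy : y ∈ cube ι) :
    glue u x y ∈ cube ι := by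
  rw [mem_cube] at *
  intro i
  unfold glue
  split_ifs with h
  · exact hx ⟨i, h⟩
  · exact hy i

lemma integral_comp_of_measurePreserving {α β E : Type*} [MeasurableSpace α] [MeasurableSpace β]
    [NormedAddCommGroup E] [NormedSpace ℝ E] {μ : Measure α} {ν : Measure β} {g : α → β}
    (h : MeasurePreserving g μ ν) {f : β → E} (hf : AEStronglyMeasurable f ν) :
    ∫ x, f (g x) ∂μ = ∫ y, f y ∂ν := by
  rw [← h.map_eq, integral_map h.measurable.aemeasurable (by rwa [h.map_eq])]

section CubeMeasure

variable {ι : Type*} [Fintype ι]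

lemma restrict_cube : (volume : Measure (ι → ℝ)).restrict (cube ι) = cubeM ι :=
  Measure.restrict_pi_pi (fun _ : ι => (volume : Measure ℝ)) fun _ => Set.Ico (0 : ℝ) 1

lemma measurableSet_cube : MeasurableSet (cube ι) :=
  MeasurableSet.univ_pi fun _ => measurableSet_Ico

lemma ae_mem_cube : ∀ᵐ x ∂cubeM ι, x ∈ cube ι := by
  rw [← restrict_cube]
  exact ae_restrict_mem measurableSet_cube

lemma ae_mem_unit : ∀ᵐ x ∂unitM, x ∈ Set.Ico (0 : ℝ) 1 := ae_restrict_mem measurableSet_Ico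

variable [DecidableEq ι]

lemma measurePreserving_glue (u : Finset ι) :
    MeasurePreserving (fun z : (u → ℝ) × (ι → ℝ) => glue u z.1 z.2)
      ((cubeM u).prod (cubeM ι)) (cubeM ι) := by
  have hm : Measurable fun z : (u → ℝ) × (ι → ℝ) => glue u z.1 z.2 := by
    refine measurable_pi_lambda _ fun i => ?_
    unfold glue
    split_ifs with h
    · exact (measurable_pi_apply _).comp measurable_fst
    · exact (measurable_pi_apply _).comp measurable_snd
  refine ⟨hm, (Measure.pi_eq fun s hs => ?_).symm⟩
  rw [Measure.map_apply hm (MeasurableSet.univ_pi hs)]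
  have : (fun z : (u → ℝ) × (ι → ℝ) => glue u z.1 z.2) ⁻¹' Set.univ.pi s =
      (Set.univ.pi fun i : u => s i) ×ˢ
        (Set.univ.pi fun i => if i ∈ u then Set.univ else s i) := by
    ext z
    simp only [Set.mem_preimage, Set.mem_univ_pi, Set.mem_prod, glue]
    constructor
    · intro h
      refine ⟨fun i => by simpa using h i, fun i => ?_⟩
      split_ifs with hi
      · trivial
      · simpa [hi] using h i
    · rintro ⟨h1, h2⟩ i
      split_ifs with hi
      · exact h1 ⟨i, hi⟩
      · simpa [hi] using h2 i
  rw [this, Measure.prod_prod, Measure.pi_pi, Measure.pi_pi]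
  have h2 : ∀ i, unitM (if i ∈ u then Set.univ else s i) = if i ∈ u then 1 else unitM (s i) := by
    intro i
    split_ifs
    · simp
    · rfl
  simp only [h2]
  rw [Finset.prod_coe_sort u fun i => unitM (s i), ← Finset.prod_mul_prod_compl u fun i =>
    unitM (s i)]
  congr 1
  rw [← Finset.prod_mul_prod_compl u]
  rw [Finset.prod_eq_one fun i hi => by simp [hi], one_mul]
  exact Finset.prod_congr rfl fun i hi => by simp [Finset.mem_compl.1 hi]

lemma measurePreserving_restrict (u : Finset ι) :
    MeasurePreserving (fun (x : ι → ℝ) (i : u) => x i) (cubeM ι) (cubeM u) := by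
  have hm : Measurable fun (x : ι → ℝ) (i : u) => x i :=
    measurable_pi_lambda _ fun i => measurable_pi_apply _
  refine ⟨hm, (Measure.pi_eq fun s hs => ?_).symm⟩
  rw [Measure.map_apply hm (MeasurableSet.univ_pi hs)]
  have : (fun (x : ι → ℝ) (i : u) => x i) ⁻¹' Set.univ.pi s =
      Set.univ.pi fun i => if h : i ∈ u then s ⟨i, h⟩ else Set.univ := by
    ext z
    simp only [Set.mem_preimage, Set.mem_univ_pi]
    constructor
    · intro h i
      split_ifs with hi
      · exact h ⟨i, hi⟩
      · trivial
    · rintro h ⟨i, hi⟩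
      simpa [hi] using h i
  rw [this, Measure.pi_pi, ← Finset.prod_mul_prod_compl u]
  rw [Finset.prod_eq_one (s := uᶜ) fun i hi => by simp [Finset.mem_compl.1 hi], mul_one,
    ← Finset.prod_coe_sort u]
  exact Finset.prod_congr rfl fun i _ => by simp

lemma measurePreserving_update (a : ι) :
    MeasurePreserving (fun z : (ι → ℝ) × ℝ => Function.update z.1 a z.2)
      ((cubeM ι).prod unitM) (cubeM ι) := by
  have hm : Measurable fun z : (ι → ℝ) × ℝ => Function.update z.1 a z.2 := by
    refine measurable_pi_lambda _ fun i => ?_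
    by_cases h : i = a
    · subst h; simpa using measurable_snd
    · simpa [h] using! (measurable_pi_apply i).comp measurable_fst
  refine ⟨hm, (Measure.pi_eq fun s hs => ?_).symm⟩
  rw [Measure.map_apply hm (MeasurableSet.univ_pi hs)]
  have : (fun z : (ι → ℝ) × ℝ => Function.update z.1 a z.2) ⁻¹' Set.univ.pi s =
      (Set.univ.pi (Function.update s a Set.univ)) ×ˢ s a := by
    ext z
    simp only [Set.mem_preimage, Set.mem_univ_pi, Set.mem_prod]
    constructor
    · intro h
      refine ⟨fun i => ?_, by simpa using h a⟩
      by_cases hi : i = a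
      · subst hi; simp
      · simpa [hi] using h i
    · rintro ⟨h1, h2⟩ i
      by_cases hi : i = a
      · subst hi; simpa using h2
      · simpa [hi] using h1 i
  rw [this, Measure.prod_prod, Measure.pi_pi, ← Finset.mul_prod_erase univ _ (Finset.mem_univ a),
    ← Finset.mul_prod_erase univ (fun i => unitM (s i)) (Finset.mem_univ a)]
  rw [Function.update_self, measure_univ, one_mul, mul_comm]
  congr 1
  exact Finset.prod_congr rfl fun i hi => by
    rw [Function.update_of_ne (Finset.ne_of_mem_erase hi)]

/-- Integrating over one coordinate first. -/
lemma integral_update {E : Type*} [NormedAddCommGroup E] [NormedSpace ℝ E] (a : ι)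
    {f : (ι → ℝ) → E} (hf : Integrable f (cubeM ι)) :
    ∫ x, ∫ y, f (Function.update x a y) ∂unitM ∂cubeM ι = ∫ x, f x ∂cubeM ι := by
  have h := measurePreserving_update (ι := ι) a
  have h1 : Integrable (fun z : (ι → ℝ) × ℝ => f (Function.update z.1 a z.2))
      ((cubeM ι).prod unitM) := h.integrable_comp_of_integrable hf
  rw [← integral_prod _ h1]
  exact integral_comp_of_measurePreserving h hf.aestronglyMeasurable

/-- Integrating over the coordinates outside `u` first. -/
lemma integral_glue {E : Type*} [NormedAddCommGroup E] [NormedSpace ℝ E] (u : Finset ι)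
    {f : (ι → ℝ) → E} (hf : Integrable f (cubeM ι)) :
    ∫ x, ∫ y, f (glue u x y) ∂cubeM ι ∂cubeM u = ∫ x, f x ∂cubeM ι := by
  have h := measurePreserving_glue (ι := ι) u
  have h1 : Integrable (fun z : (u → ℝ) × (ι → ℝ) => f (glue u z.1 z.2))
      ((cubeM u).prod (cubeM ι)) := h.integrable_comp_of_integrable hf
  rw [← integral_prod _ h1]
  exact integral_comp_of_measurePreserving h hf.aestronglyMeasurable

lemma integral_restrict {E : Type*} [NormedAddCommGroup E] [NormedSpace ℝ E] (u : Finset ι)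
    {f : (u → ℝ) → E} (hf : AEStronglyMeasurable f (cubeM u)) :
    ∫ x, f (fun i => x i) ∂cubeM ι = ∫ x, f x ∂cubeM u :=
  integral_comp_of_measurePreserving (measurePreserving_restrict u) hf

end CubeMeasure

/-! ### Consequences of finite variation -/

section Variation

set_option linter.unusedSectionVars false

variable {κ : Type*} [Fintype κ] [DecidableEq κ]

lemma boxVol_nonneg {a b : κ → ℝ} (h : ∀ i, a i ≤ b i) : 0 ≤ boxVol a b :=
  Finset.prod_nonneg fun i _ => sub_nonneg.2 (h i)

lemma sum_boxVol_le_one {P : Finset ((κ → ℝ) × (κ → ℝ))} (hP : IsBoxFamily P) :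
    ∑ J ∈ P, ENNReal.ofReal (boxVol J.1 J.2) ≤ 1 := by
  have h1 : ∀ J ∈ P, ENNReal.ofReal (boxVol J.1 J.2) =
      (volume : Measure (κ → ℝ)) (Set.pi Set.univ fun i => Set.Ico (J.1 i) (J.2 i)) := by
    intro J hJ
    rw [Real.volume_pi_Ico, boxVol, ENNReal.ofReal_prod_of_nonneg]
    exact fun i _ => sub_nonneg.2 (hP.1 J hJ i).2.1.le
  rw [Finset.sum_congr rfl h1, ← measure_biUnion_finset hP.2
    fun J _ => MeasurableSet.univ_pi fun _ => measurableSet_Ico]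
  calc (volume : Measure (κ → ℝ)) (⋃ J ∈ P, Set.pi Set.univ fun i => Set.Ico (J.1 i) (J.2 i))
      ≤ volume (cube κ) := by
        refine measure_mono (Set.iUnion₂_subset fun J hJ x hx => ?_)
        rw [mem_cube]
        intro i
        have h := hP.1 J hJ i
        have := hx i trivial
        exact ⟨h.1.trans this.1, this.2.trans h.2.2⟩
    _ = 1 := by
        rw [cube, Real.volume_pi_Ico]
        simp

/-- Hölder's inequality for the sum that defines the variation. -/
lemma sum_rpow_mul_boxDelta_le {lam p : ℝ} (hp : 1 ≤ p) (g : (κ → ℝ) → ℝ)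
    {P : Finset ((κ → ℝ) × (κ → ℝ))} (hP : IsBoxFamily P) :
    ∑ J ∈ P, ENNReal.ofReal (boxVol J.1 J.2 * (|boxDelta g J.1 J.2| / boxVol J.1 J.2 ^ lam)) ≤
      vitaliVariation lam p g := by
  have h0 : ∀ J ∈ P, 0 ≤ boxVol J.1 J.2 := fun J hJ =>
    boxVol_nonneg fun i => (hP.1 J hJ i).2.1.le
  have hx : ∀ J ∈ P, 0 ≤ |boxDelta g J.1 J.2| / boxVol J.1 J.2 ^ lam := fun J hJ =>
    div_nonneg (abs_nonneg _) (Real.rpow_nonneg (h0 J hJ) _)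
  calc ∑ J ∈ P, ENNReal.ofReal (boxVol J.1 J.2 * (|boxDelta g J.1 J.2| / boxVol J.1 J.2 ^ lam))
      = ∑ J ∈ P, ENNReal.ofReal (boxVol J.1 J.2) *
          ENNReal.ofReal (|boxDelta g J.1 J.2| / boxVol J.1 J.2 ^ lam) :=
        Finset.sum_congr rfl fun J hJ => ENNReal.ofReal_mul (h0 J hJ)
    _ ≤ (∑ J ∈ P, ENNReal.ofReal (boxVol J.1 J.2)) ^ (1 - p⁻¹) *
          (∑ J ∈ P, ENNReal.ofReal (boxVol J.1 J.2) *
            ENNReal.ofReal (|boxDelta g J.1 J.2| / boxVol J.1 J.2 ^ lam) ^ p) ^ p⁻¹ :=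
        ENNReal.inner_le_weight_mul_Lp_of_nonneg P hp _ _
    _ ≤ 1 * (∑ J ∈ P, ENNReal.ofReal (boxVol J.1 J.2) *
            ENNReal.ofReal (|boxDelta g J.1 J.2| / boxVol J.1 J.2 ^ lam) ^ p) ^ p⁻¹ := by
        gcongr
        exact ENNReal.rpow_le_one (sum_boxVol_le_one hP) (sub_nonneg.2 (inv_le_one_of_one_le₀ hp))
    _ = (∑ J ∈ P, ENNReal.ofReal
          (boxVol J.1 J.2 * (|boxDelta g J.1 J.2| / boxVol J.1 J.2 ^ lam) ^ p)) ^ (1 / p) := by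
        rw [one_mul, one_div]
        congr 1
        refine Finset.sum_congr rfl fun J hJ => ?_
        rw [ENNReal.ofReal_rpow_of_nonneg (hx J hJ) (by linarith), ENNReal.ofReal_mul (h0 J hJ)]
    _ ≤ vitaliVariation lam p g := by
        unfold vitaliVariation
        exact le_iSup₂ (f := fun (P : Finset ((κ → ℝ) × (κ → ℝ))) (_ : IsBoxFamily P) =>
          (∑ J ∈ P, ENNReal.ofReal
            (boxVol J.1 J.2 * (|boxDelta g J.1 J.2| / boxVol J.1 J.2 ^ lam) ^ p)) ^ (1 / p)) P hP

lemma abs_boxDelta_inf_sup (g : (κ → ℝ) → ℝ) (a b : κ → ℝ) :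
    |boxDelta g (a ⊓ b) (a ⊔ b)| = |boxDelta g a b| := by
  set T : Finset κ := univ.filter fun i => b i < a i with hT
  have hcard : ∀ v : Finset κ, (-1 : ℝ) ^ (symmDiff v T).card = (-1) ^ T.card * (-1) ^ v.card := by
    have hsign : ∀ v : Finset κ, (-1 : ℝ) ^ v.card = ∏ i, if i ∈ v then (-1 : ℝ) else 1 := by
      intro v
      rw [Finset.prod_ite]
      simp
    intro v
    rw [hsign, hsign v, hsign T, ← Finset.prod_mul_distrib]
    refine Finset.prod_congr rfl fun i _ => ?_
    by_cases h1 : i ∈ v <;> by_cases h2 : i ∈ T <;> simp [h1, h2, Finset.mem_symmDiff]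
  have : boxDelta g (a ⊓ b) (a ⊔ b) = (-1) ^ T.card * boxDelta g a b := by
    unfold boxDelta
    rw [Finset.mul_sum]
    refine (Fintype.sum_bijective (fun v => symmDiff v T) (symmDiff_left_involutive T).bijective
      _ _ fun v => ?_).symm
    rw [hcard v, mul_assoc]
    congr 3
    funext i
    by_cases h1 : i ∈ v <;> by_cases h2 : b i < a i <;>
      simp [h1, h2, hT, Finset.mem_symmDiff, le_of_lt, le_of_not_gt]
  rw [this, abs_mul, abs_pow, abs_neg, abs_one, one_pow, one_mul]

lemma measurable_boxDelta {α : Type*} [MeasurableSpace α] {g : (κ → ℝ) → ℝ} (hg : Measurable g)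
    {a b : α → κ → ℝ} (ha : Measurable a) (hb : Measurable b) :
    Measurable fun z => boxDelta g (a z) (b z) := by
  unfold boxDelta
  refine Finset.measurable_sum _ fun v _ => (hg.comp (measurable_pi_lambda _ fun i => ?_)).const_mul _
  split_ifs
  · exact (measurable_pi_apply i).comp ha
  · exact (measurable_pi_apply i).comp hb

open Classical in
/-- The values that the box differences of sides `h` take at the points of a lattice with mesh
`|h|`. -/
lemma sum_translates_le {lam p : ℝ} (hp : 1 ≤ p) (g : (κ → ℝ) → ℝ)
    {h : κ → ℝ} (hh : ∀ i, h i ≠ 0) (y : κ → ℝ) {M : ℕ} :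
    ∑ c : κ → Fin M, (if (fun i => y i + (c i : ℕ) * |h i|) ∈ cube κ ∧
        (fun i => y i + (c i : ℕ) * |h i|) + h ∈ cube κ then
      ENNReal.ofReal |boxDelta g (fun i => y i + (c i : ℕ) * |h i|)
        ((fun i => y i + (c i : ℕ) * |h i|) + h)| else 0) ≤
      ENNReal.ofReal ((∏ i, |h i|) ^ (lam - 1)) * vitaliVariation lam p g := by
  set H := ∏ i, |h i| with hH
  have hHpos : 0 < H := Finset.prod_pos fun i _ => abs_pos.2 (hh i)
  set t : (κ → Fin M) → κ → ℝ := fun c i => y i + (c i : ℕ) * |h i| with ht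
  set J : (κ → Fin M) → (κ → ℝ) × (κ → ℝ) := fun c => (t c ⊓ (t c + h), t c ⊔ (t c + h)) with hJ
  have hJ1 : ∀ c i, (J c).1 i = y i + (c i : ℕ) * |h i| + min 0 (h i) := by
    intro c i
    simp only [hJ, ht, Pi.inf_apply, Pi.add_apply]
    rw [← min_add_add_left, add_zero]
  have hJ2 : ∀ c i, (J c).2 i = (J c).1 i + |h i| := by
    intro c i
    rw [hJ1]
    simp only [hJ, ht, Pi.sup_apply, Pi.add_apply]
    rcases lt_or_gt_of_ne (hh i) with h0 | h0
    · rw [max_eq_left (by linarith), min_eq_right h0.le]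
      rw [abs_of_neg h0]; ring
    · rw [max_eq_right (by linarith), min_eq_left h0.le]
      rw [abs_of_pos h0]; ring
  have hvol : ∀ c, boxVol (J c).1 (J c).2 = H := by
    intro c
    unfold boxVol
    exact Finset.prod_congr rfl fun i _ => by rw [hJ2]; ring
  have hsep : ∀ c c' i, (c i : ℕ) < c' i → (J c).2 i ≤ (J c').1 i := by
    intro c c' i hlt
    rw [hJ2, hJ1, hJ1]
    have : ((c i : ℕ) : ℝ) + 1 ≤ ((c' i : ℕ) : ℝ) := by exact_mod_cast hlt
    nlinarith [abs_pos.2 (hh i)]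
  have hinj : Function.Injective J := by
    intro c c' e
    funext i
    by_contra hne
    have habs := abs_pos.2 (hh i)
    rcases lt_or_gt_of_ne (fun e => hne (Fin.ext e) : (c i : ℕ) ≠ c' i) with h1 | h1
    · have := hsep c c' i h1
      rw [hJ2, e] at this
      linarith
    · have := hsep c' c i h1
      rw [hJ2, e] at this
      linarith
  set A : Finset (κ → Fin M) := univ.filter fun c => t c ∈ cube κ ∧ t c + h ∈ cube κ with hA
  have hP : IsBoxFamily (A.image J) := by
    constructor
    · intro x hx i
      obtain ⟨c, hc, rfl⟩ := Finset.mem_image.1 hx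
      have hc' := (Finset.mem_filter.1 hc).2
      have h1 := mem_cube.1 hc'.1 i
      have h2 := mem_cube.1 hc'.2 i
      refine ⟨le_min h1.1 h2.1, ?_, max_lt h1.2 h2.2⟩
      rw [hJ2]
      linarith [abs_pos.2 (hh i)]
    · intro x hx x' hx' hne
      obtain ⟨c, hc, rfl⟩ := Finset.mem_image.1 hx
      obtain ⟨c', hc', rfl⟩ := Finset.mem_image.1 hx'
      have hcc : c ≠ c' := fun e => hne (by rw [e])
      obtain ⟨i, hi⟩ := Function.ne_iff.1 hcc
      refine Set.disjoint_left.2 fun z hz hz' => ?_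
      have h1 := hz i trivial
      have h2 := hz' i trivial
      rcases lt_or_gt_of_ne (fun e => hi (Fin.ext e) : (c i : ℕ) ≠ c' i) with h3 | h3
      · have := hsep c c' i h3
        linarith [h1.2, h2.1]
      · have := hsep c' c i h3
        linarith [h2.2, h1.1]
  have key := sum_rpow_mul_boxDelta_le (lam := lam) hp g hP
  rw [Finset.sum_image fun c _ c' _ e => hinj e] at key
  calc _ = ∑ c ∈ A, ENNReal.ofReal |boxDelta g (t c) (t c + h)| := by
        rw [hA, Finset.sum_filter]
    _ = ∑ c ∈ A, ENNReal.ofReal (H ^ (lam - 1)) * ENNReal.ofReal (boxVol (J c).1 (J c).2 *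
          (|boxDelta g (J c).1 (J c).2| / boxVol (J c).1 (J c).2 ^ lam)) := by
        refine Finset.sum_congr rfl fun c _ => ?_
        rw [← ENNReal.ofReal_mul (Real.rpow_nonneg hHpos.le _), hvol, abs_boxDelta_inf_sup,
          Real.rpow_sub hHpos, Real.rpow_one]
        congr 1
        have := (Real.rpow_pos_of_pos hHpos lam).ne'
        field_simp
    _ ≤ _ := by
        rw [← Finset.mul_sum]
        gcongr

open Classical in
/-- The integral of the box differences of sides `h`. -/
lemma lintegral_boxDelta_translate_le {lam p : ℝ} (hp : 1 ≤ p) {g : (κ → ℝ) → ℝ}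
    (hg : Measurable g) {h : κ → ℝ} (hh : ∀ i, h i ≠ 0) :
    ∫⁻ t : κ → ℝ, (if t ∈ cube κ ∧ t + h ∈ cube κ then
        ENNReal.ofReal |boxDelta g t (t + h)| else 0) ≤
      ENNReal.ofReal ((∏ i, |h i|) ^ lam) * vitaliVariation lam p g := by
  set G : (κ → ℝ) → ℝ≥0∞ := fun t => if t ∈ cube κ ∧ t + h ∈ cube κ then
        ENNReal.ofReal |boxDelta g t (t + h)| else 0 with hG
  have hGm : Measurable G := by
    refine Measurable.ite ?_ ?_ measurable_const
    · exact measurableSet_cube.inter (measurableSet_cube.preimage (measurable_id.add_const h))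
    · exact (measurable_boxDelta hg measurable_id (measurable_id.add_const h)).abs.ennreal_ofReal
  obtain ⟨M, hM⟩ : ∃ M : ℕ, ∀ i, 1 ≤ M * |h i| := by
    obtain ⟨M, hM⟩ := exists_nat_ge (∑ i, 1 / |h i|)
    refine ⟨M, fun i => ?_⟩
    have habs := abs_pos.2 (hh i)
    have : 1 / |h i| ≤ M := (Finset.single_le_sum (f := fun i => 1 / |h i|)
      (fun i _ => by positivity) (Finset.mem_univ i)).trans hM
    rwa [div_le_iff₀ habs] at this
  set B : Set (κ → ℝ) := Set.pi Set.univ fun i => Set.Ico 0 |h i| with hB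
  have hBm : MeasurableSet B := MeasurableSet.univ_pi fun _ => measurableSet_Ico
  have hBvol : volume B = ENNReal.ofReal (∏ i, |h i|) := by
    rw [hB, Real.volume_pi_Ico, ENNReal.ofReal_prod_of_nonneg fun i _ => abs_nonneg _]
    simp
  have hcover : ∀ t, G t ≤ ∑ c : κ → Fin M,
      B.indicator (fun y => G (fun i => y i + (c i : ℕ) * |h i|))
        (t + fun i => -((c i : ℕ) * |h i|)) := by
    intro t
    by_cases ht : t ∈ cube κ ∧ t + h ∈ cube κ
    · have hlt : ∀ i, ⌊t i / |h i|⌋₊ < M := by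
        intro i
        have habs := abs_pos.2 (hh i)
        have h1 := mem_cube.1 ht.1 i
        rw [Nat.floor_lt (div_nonneg h1.1 habs.le), div_lt_iff₀ habs]
        linarith [hM i, h1.2]
      refine le_trans (le_of_eq ?_) (Finset.single_le_sum (f := fun c : κ → Fin M =>
        B.indicator (fun y => G (fun i => y i + (c i : ℕ) * |h i|))
        (t + fun i => -((c i : ℕ) * |h i|))) (fun _ _ => zero_le) (Finset.mem_univ
          fun i => (⟨⌊t i / |h i|⌋₊, hlt i⟩ : Fin M)))
      rw [Set.indicator_of_mem]
      · simp
      · intro i _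
        have habs := abs_pos.2 (hh i)
        have h1 := mem_cube.1 ht.1 i
        have h2 := Nat.floor_le (div_nonneg h1.1 habs.le)
        have h3 := Nat.lt_floor_add_one (t i / |h i|)
        rw [le_div_iff₀ habs] at h2
        rw [div_lt_iff₀ habs] at h3
        constructor
        · simp only [Pi.add_apply]; linarith
        · simp only [Pi.add_apply]; linarith
    · simp [hG, ht]
  have hGc : ∀ c : κ → Fin M, Measurable fun y : κ → ℝ => G (fun i => y i + (c i : ℕ) * |h i|) :=
    fun c => hGm.comp (measurable_pi_lambda _ fun i => (measurable_pi_apply i).add_const _)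
  calc ∫⁻ t, G t ≤ ∫⁻ t, ∑ c : κ → Fin M,
      B.indicator (fun y => G (fun i => y i + (c i : ℕ) * |h i|))
        (t + fun i => -((c i : ℕ) * |h i|)) := lintegral_mono hcover
    _ = ∑ c : κ → Fin M, ∫⁻ t,
      B.indicator (fun y => G (fun i => y i + (c i : ℕ) * |h i|))
        (t + fun i => -((c i : ℕ) * |h i|)) :=
        lintegral_finsetSum _ fun c _ => ((hGc c).indicator hBm).comp (measurable_id.add_const _)
    _ = ∑ c : κ → Fin M, ∫⁻ y in B, G (fun i => y i + (c i : ℕ) * |h i|) := by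
        refine Finset.sum_congr rfl fun c _ => ?_
        rw [lintegral_add_right_eq_self (B.indicator fun y => G (fun i => y i + (c i : ℕ) * |h i|)),
          lintegral_indicator hBm]
    _ = ∫⁻ y in B, ∑ c : κ → Fin M, G (fun i => y i + (c i : ℕ) * |h i|) :=
        (lintegral_finsetSum _ fun c _ => hGc c).symm
    _ ≤ ∫⁻ _ in B, ENNReal.ofReal ((∏ i, |h i|) ^ (lam - 1)) * vitaliVariation lam p g :=
        lintegral_mono fun y => sum_translates_le hp g hh y
    _ = ENNReal.ofReal ((∏ i, |h i|) ^ lam) * vitaliVariation lam p g := by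
        have hHpos : 0 < ∏ i, |h i| := Finset.prod_pos fun i _ => abs_pos.2 (hh i)
        rw [setLIntegral_const, hBvol, mul_right_comm,
          ← ENNReal.ofReal_mul (Real.rpow_nonneg hHpos.le _), Real.rpow_sub hHpos, Real.rpow_one,
          div_mul_cancel₀ _ hHpos.ne']

open Classical in
lemma lintegral_boxDelta_close_le {lam p : ℝ} (hlam : 0 ≤ lam) (hp : 1 ≤ p) {g : (κ → ℝ) → ℝ}
    (hg : Measurable g) {r : κ → ℝ} (hr : ∀ i, 0 < r i) :
    ∫⁻ t', ∫⁻ t, (if ∀ i, |t' i - t i| < r i then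
        ENNReal.ofReal |boxDelta g t t'| else 0) ∂cubeM κ ∂cubeM κ ≤
      ENNReal.ofReal (∏ i, 2 * r i * r i ^ lam) * vitaliVariation lam p g := by
  set R : Set (κ → ℝ) := Set.pi Set.univ fun i => Set.Ioo (-(r i)) (r i) with hR
  have hRm : MeasurableSet R := MeasurableSet.univ_pi fun _ => measurableSet_Ioo
  set T : (κ → ℝ) → (κ → ℝ) → ℝ≥0∞ := fun t h =>
    R.indicator (fun h => if t ∈ cube κ ∧ t + h ∈ cube κ then
        ENNReal.ofReal |boxDelta g t (t + h)| else 0) h with hT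
  have hTm : Measurable (Function.uncurry T) := by
    have : Function.uncurry T = (Set.univ ×ˢ R).indicator (fun z : (κ → ℝ) × (κ → ℝ) =>
        if z.1 ∈ cube κ ∧ z.1 + z.2 ∈ cube κ then
        ENNReal.ofReal |boxDelta g z.1 (z.1 + z.2)| else 0) := by
      funext z
      simp only [Function.uncurry, hT, Set.indicator, Set.mem_prod, Set.mem_univ, true_and]
    rw [this]
    refine Measurable.indicator ?_ (MeasurableSet.univ.prod hRm)
    refine Measurable.ite ?_ ?_ measurable_const
    · exact (measurableSet_cube.preimage measurable_fst).inter
        (measurableSet_cube.preimage (measurable_fst.add measurable_snd))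
    · exact (measurable_boxDelta hg measurable_fst
        (measurable_fst.add measurable_snd)).abs.ennreal_ofReal
  have hFm : Measurable fun z : (κ → ℝ) × (κ → ℝ) => if ∀ i, |z.1 i - z.2 i| < r i then
        ENNReal.ofReal |boxDelta g z.2 z.1| else 0 := by
    refine Measurable.ite ?_
      (measurable_boxDelta hg measurable_snd measurable_fst).abs.ennreal_ofReal measurable_const
    rw [Set.ofPred_forall]
    refine MeasurableSet.iInter fun i => measurableSet_lt ?_ measurable_const
    exact (((measurable_pi_apply i).comp measurable_fst).sub
      ((measurable_pi_apply i).comp measurable_snd)).abs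
  calc ∫⁻ t', ∫⁻ t, (if ∀ i, |t' i - t i| < r i then
        ENNReal.ofReal |boxDelta g t t'| else 0) ∂cubeM κ ∂cubeM κ
      = ∫⁻ t, ∫⁻ t', (if ∀ i, |t' i - t i| < r i then
        ENNReal.ofReal |boxDelta g t t'| else 0) ∂cubeM κ ∂cubeM κ :=
        lintegral_lintegral_swap hFm.aemeasurable
    _ = ∫⁻ t, ∫⁻ h, T t h := by
        rw [← restrict_cube, ← lintegral_indicator measurableSet_cube]
        refine lintegral_congr fun t => ?_
        by_cases ht : t ∈ cube κ
        · rw [Set.indicator_of_mem ht, ← lintegral_indicator measurableSet_cube,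
            ← lintegral_add_left_eq_self _ t]
          refine lintegral_congr fun h => ?_
          have hiff : (∀ i, |(t + h) i - t i| < r i) ↔ h ∈ R := by
            simp only [Pi.add_apply, add_sub_cancel_left, abs_lt, hR, Set.mem_univ_pi, Set.mem_Ioo]
          simp only [hT, Set.indicator, hiff, ht, true_and]
          by_cases h1 : t + h ∈ cube κ <;> by_cases h2 : h ∈ R <;> simp [h1, h2]
        · simp [hT, ht]
    _ = ∫⁻ h, ∫⁻ t, T t h := lintegral_lintegral_swap hTm.aemeasurable
    _ ≤ ∫⁻ h, R.indicator (fun _ => ENNReal.ofReal (∏ i, r i ^ lam) * vitaliVariation lam p g) h := by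
        have hae : ∀ᵐ h : κ → ℝ, ∀ i, h i ≠ 0 := by
          rw [ae_all_iff]
          intro i
          have := Measure.pi_hyperplane (fun _ : κ => (volume : Measure ℝ)) i 0
          rw [ae_iff]
          simpa [volume_pi] using this
        refine lintegral_mono_ae (hae.mono fun h hh => ?_)
        by_cases hRh : h ∈ R
        · simp only [hT, Set.indicator_of_mem hRh]
          refine (lintegral_boxDelta_translate_le (lam := lam) hp hg hh).trans ?_
          gcongr
          rw [← Real.finsetProd_rpow _ _ fun i _ => abs_nonneg _]
          refine Finset.prod_le_prod (fun i _ => Real.rpow_nonneg (abs_nonneg _) _) fun i _ => ?_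
          exact Real.rpow_le_rpow (abs_nonneg _) (abs_lt.2 (hRh i trivial)).le hlam
        · simp [hT, hRh]
    _ = ENNReal.ofReal (∏ i, 2 * r i * r i ^ lam) * vitaliVariation lam p g := by
        rw [lintegral_indicator hRm, setLIntegral_const, hR, Real.volume_pi_Ioo, mul_right_comm]
        congr 1
        rw [← ENNReal.ofReal_prod_of_nonneg fun i _ => by linarith [hr i], ← ENNReal.ofReal_mul
          (Finset.prod_nonneg fun i _ => Real.rpow_nonneg (hr i).le _), ← Finset.prod_mul_distrib]
        congr 1
        exact Finset.prod_congr rfl fun i _ => by ring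

end Variation

section Oscillation

variable {κ : Type*} [Fintype κ] [DecidableEq κ]

set_option linter.unusedSectionVars false

open Classical in
/-- `N` times the indicator of the pairs of points in the same interval of length `1 / N`. -/
noncomputable def sameBlock (N : ℕ) (x y : ℝ) : ℂ := if ⌊x * N⌋ = ⌊y * N⌋ then N else 0

lemma measurable_sameBlock {α : Type*} [MeasurableSpace α] (N : ℕ) {f g : α → ℝ}
    (hf : Measurable f) (hg : Measurable g) : Measurable fun z => sameBlock N (f z) (g z) :=
  Measurable.ite (measurableSet_eq_fun (hf.mul_const _).floor (hg.mul_const _).floor)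
    measurable_const measurable_const

lemma norm_sameBlock_le (N : ℕ) (x y : ℝ) : ‖sameBlock N x y‖ ≤ N := by
  unfold sameBlock
  split_ifs <;> simp

lemma abs_sub_lt_of_sameBlock_ne_zero {N : ℕ} (hN : 0 < N) {x y : ℝ} (h : sameBlock N x y ≠ 0) :
    |x - y| < 1 / N := by
  have hN' : (0 : ℝ) < N := by positivity
  have h1 : ⌊x * N⌋ = ⌊y * N⌋ := by
    by_contra hne
    exact h (if_neg hne)
  have h2 := Int.abs_sub_lt_one_of_floor_eq_floor h1
  rw [← sub_mul, abs_mul, abs_of_pos hN'] at h2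
  rwa [lt_div_iff₀ hN']

lemma integral_mul_sameBlock {N : ℕ} (hN : 0 < N) {c : ℕ} (hc : c < N) {x : ℝ}
    (h1 : (c : ℝ) / N ≤ x) (h2 : x < (c + 1 : ℝ) / N) (Φ : ℝ → ℂ) :
    ∫ y, Φ y * sameBlock N y x ∂unitM =
      (∫ y in ((c : ℝ) / N)..((c + 1 : ℝ) / N), Φ y) * N := by
  have hN' : (0 : ℝ) < N := by positivity
  have hx := floor_eq_of_mem_block (c := (c : ℤ)) (x := x) hN
    (by rw [Int.cast_natCast]; exact h1) (by rw [Int.cast_natCast]; exact h2)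
  have hle : (c : ℝ) / N ≤ (c + 1 : ℝ) / N := by gcongr; linarith
  have hsub : Set.Ico ((c : ℝ) / N) ((c + 1 : ℝ) / N) ⊆ Set.Ico 0 1 := by
    refine Set.Ico_subset_Ico (by positivity) ?_
    rw [div_le_one hN']
    exact_mod_cast hc
  have hind : ∀ y, Φ y * sameBlock N y x =
      (Set.Ico ((c : ℝ) / N) ((c + 1 : ℝ) / N)).indicator (fun y => Φ y * N) y := by
    intro y
    by_cases hy : y ∈ Set.Ico ((c : ℝ) / N) ((c + 1 : ℝ) / N)
    · rw [Set.indicator_of_mem hy, sameBlock, if_pos]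
      rw [hx]
      exact floor_eq_of_mem_block (c := (c : ℤ)) (x := y) hN
        (by rw [Int.cast_natCast]; exact hy.1) (by rw [Int.cast_natCast]; exact hy.2)
    · rw [Set.indicator_of_notMem hy, sameBlock, if_neg, mul_zero]
      intro e
      rw [hx, Int.floor_eq_iff] at e
      refine hy ⟨?_, ?_⟩
      · rw [div_le_iff₀ hN']; exact_mod_cast e.1
      · rw [lt_div_iff₀ hN']; exact_mod_cast e.2
  simp only [hind]
  rw [integral_indicator measurableSet_Ico, unitM, Measure.restrict_restrict measurableSet_Ico,
    Set.inter_eq_left.2 hsub, integral_mul_const, intervalIntegral.integral_of_le hle,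
    integral_Ico_eq_integral_Ioo, integral_Ioc_eq_integral_Ioo]

lemma measurePreserving_mix (v : Finset κ) :
    MeasurePreserving (fun (z : (κ → ℝ) × (κ → ℝ)) i => if i ∈ v then z.1 i else z.2 i)
      ((cubeM κ).prod (cubeM κ)) (cubeM κ) := by
  have h := (measurePreserving_glue v).comp
    ((measurePreserving_restrict (ι := κ) v).prod (MeasurePreserving.id (cubeM κ)))
  convert! h using 1

section Integral

variable {g : (κ → ℝ) → ℝ} {Φ : κ → ℝ → ℂ} {N : κ → ℕ} {M : κ → ℝ}

lemma integrable_mix_mul (hgi : Integrable g (cubeM κ)) (hΦ : ∀ j, LocInt (Φ j))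
    (hM : ∀ j, ∀ x ∈ Set.Ico (0 : ℝ) 1, ‖Φ j x‖ ≤ M j) (v : Finset κ) :
    Integrable (fun z : (κ → ℝ) × (κ → ℝ) =>
      (∏ j, Φ j (z.2 j) * sameBlock (N j) (z.2 j) (z.1 j)) *
        ((g (fun i => if i ∈ v then z.1 i else z.2 i) : ℝ) : ℂ))
      ((cubeM κ).prod (cubeM κ)) := by
  have h1 : Integrable (fun z : (κ → ℝ) × (κ → ℝ) =>
      ((g (fun i => if i ∈ v then z.1 i else z.2 i) : ℝ) : ℂ)) ((cubeM κ).prod (cubeM κ)) :=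
    ((measurePreserving_mix v).integrable_comp_of_integrable hgi).ofReal
  refine h1.bdd_mul (c := ∏ j, M j * N j) ?_ ?_
  · refine (Finset.measurable_prod _ fun j _ => ?_).aestronglyMeasurable
    exact ((hΦ j).1.comp ((measurable_pi_apply j).comp measurable_snd)).mul
      (measurable_sameBlock _ ((measurable_pi_apply j).comp measurable_snd)
        ((measurable_pi_apply j).comp measurable_fst))
  · have h2 : ∀ᵐ z ∂(cubeM κ).prod (cubeM κ), z.2 ∈ cube κ :=
      Measure.quasiMeasurePreserving_snd.ae ae_mem_cube
    filter_upwards [h2] with z hz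
    rw [norm_prod]
    refine Finset.prod_le_prod (fun _ _ => norm_nonneg _) fun j _ => ?_
    rw [norm_mul]
    have := hM j _ (mem_cube.1 hz j)
    exact mul_le_mul this (norm_sameBlock_le _ _ _) (norm_nonneg _) ((norm_nonneg _).trans this)

lemma integral_mix_mul_eq_zero (hgi : Integrable g (cubeM κ)) (hΦ : ∀ j, LocInt (Φ j))
    (hM : ∀ j, ∀ x ∈ Set.Ico (0 : ℝ) 1, ‖Φ j x‖ ≤ M j) (hN : ∀ j, 0 < N j)
    (hz : ∀ j, BlockMeanZero (N j) (Φ j)) {v : Finset κ} (hv : v.Nonempty) :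
    ∫ z : (κ → ℝ) × (κ → ℝ), (∏ j, Φ j (z.2 j) * sameBlock (N j) (z.2 j) (z.1 j)) *
        ((g (fun i => if i ∈ v then z.1 i else z.2 i) : ℝ) : ℂ)
      ∂(cubeM κ).prod (cubeM κ) = 0 := by
  obtain ⟨a, ha⟩ := hv
  have hint := integrable_mix_mul (N := N) hgi hΦ hM v
  rw [integral_prod _ hint]
  refine integral_eq_zero_of_ae ?_
  filter_upwards [hint.prod_right_ae, ae_mem_cube] with t' hi ht'
  simp only [Pi.zero_apply]
  rw [← integral_update a hi]
  refine integral_eq_zero_of_ae (Filter.Eventually.of_forall fun t => ?_)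
  simp only [Pi.zero_apply]
  have h1 : ∀ y : ℝ, (∏ j, Φ j (Function.update t a y j) *
      sameBlock (N j) (Function.update t a y j) (t' j)) *
        ((g (fun i => if i ∈ v then t' i else Function.update t a y i) : ℝ) : ℂ) =
      (Φ a y * sameBlock (N a) y (t' a)) *
        ((∏ j ∈ univ.erase a, Φ j (t j) * sameBlock (N j) (t j) (t' j)) *
        ((g (fun i => if i ∈ v then t' i else t i) : ℝ) : ℂ)) := by
    intro y
    rw [← Finset.mul_prod_erase univ _ (Finset.mem_univ a), Function.update_self, mul_assoc]
    congr 2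
    · exact Finset.prod_congr rfl fun j hj => by
        rw [Function.update_of_ne (Finset.ne_of_mem_erase hj)]
    · congr 2
      funext i
      by_cases hi : i ∈ v
      · simp [hi]
      · rw [if_neg hi, if_neg hi, Function.update_of_ne]
        rintro rfl
        exact hi ha
  simp only [h1]
  rw [integral_mul_const]
  obtain ⟨c, hc, h2, h3⟩ := exists_block (hN a) (mem_cube.1 ht' a)
  rw [integral_mul_sameBlock (hN a) hc h2 h3, hz a c hc]
  simp

lemma integral_mix_empty (hgi : Integrable g (cubeM κ)) (hΦ : ∀ j, LocInt (Φ j))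
    (hM : ∀ j, ∀ x ∈ Set.Ico (0 : ℝ) 1, ‖Φ j x‖ ≤ M j) (hN : ∀ j, 0 < N j) :
    ∫ z : (κ → ℝ) × (κ → ℝ), (∏ j, Φ j (z.2 j) * sameBlock (N j) (z.2 j) (z.1 j)) *
        ((g (fun i => if i ∈ (∅ : Finset κ) then z.1 i else z.2 i) : ℝ) : ℂ)
      ∂(cubeM κ).prod (cubeM κ) = ∫ t, (∏ j, Φ j (t j)) * (g t : ℂ) ∂cubeM κ := by
  have hint := integrable_mix_mul (N := N) hgi hΦ hM ∅
  rw [integral_prod_symm _ hint]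
  refine integral_congr_ae ?_
  filter_upwards [ae_mem_cube] with t ht
  simp only [Finset.notMem_empty, if_false]
  rw [integral_mul_const]
  congr 1
  rw [integral_fintype_prod_eq_prod (fun j y => Φ j (t j) * sameBlock (N j) (t j) y)]
  refine Finset.prod_congr rfl fun j _ => ?_
  obtain ⟨c, hc, h2, h3⟩ := exists_block (hN j) (mem_cube.1 ht j)
  have hsymm : ∀ y, sameBlock (N j) (t j) y = sameBlock (N j) y (t j) := fun y => by
    unfold sameBlock
    simp only [eq_comm]
  simp only [hsymm]
  rw [integral_mul_sameBlock (hN j) hc h2 h3 fun _ => Φ j (t j)]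
  have : (N j : ℂ) ≠ 0 := by exact_mod_cast (hN j).ne'
  rw [intervalIntegral.integral_const, ← sub_div, add_sub_cancel_left, Complex.real_smul]
  push_cast
  field_simp

/-- The integral of `g` against a product of functions with vanishing means on blocks is bounded by
the variation of `g`. -/
lemma norm_integral_mul_prod_le {lam p : ℝ} (hlam : 0 ≤ lam) (hp : 1 ≤ p) (hg : Measurable g)
    (hgi : Integrable g (cubeM κ)) (hΦ : ∀ j, LocInt (Φ j))
    (hM : ∀ j, ∀ x ∈ Set.Ico (0 : ℝ) 1, ‖Φ j x‖ ≤ M j) (hN : ∀ j, 0 < N j)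
    (hz : ∀ j, BlockMeanZero (N j) (Φ j)) (hV : vitaliVariation lam p g ≠ ⊤) :
    ‖∫ t, (∏ j, Φ j (t j)) * (g t : ℂ) ∂cubeM κ‖ ≤
      (∏ j, 2 * M j * (N j : ℝ) ^ (-lam)) * (vitaliVariation lam p g).toReal := by
  classical
  have hM0 : ∀ j, 0 ≤ M j := fun j => (norm_nonneg _).trans (hM j 0 (by simp))
  set D : (κ → ℝ) × (κ → ℝ) → ℂ := fun z =>
    (∏ j, Φ j (z.2 j) * sameBlock (N j) (z.2 j) (z.1 j)) * ((boxDelta g z.1 z.2 : ℝ) : ℂ) with hD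
  have hsum : ∀ z, D z = ∑ v : Finset κ, (-1 : ℂ) ^ v.card *
      ((∏ j, Φ j (z.2 j) * sameBlock (N j) (z.2 j) (z.1 j)) *
        ((g (fun i => if i ∈ v then z.1 i else z.2 i) : ℝ) : ℂ)) := by
    intro z
    simp only [hD, boxDelta]
    push_cast
    rw [Finset.mul_sum]
    exact Finset.sum_congr rfl fun v _ => by ring
  have hid : ∫ t, (∏ j, Φ j (t j)) * (g t : ℂ) ∂cubeM κ =
      ∫ z, D z ∂(cubeM κ).prod (cubeM κ) := by
    simp only [hsum]
    rw [integral_finsetSum _ fun v _ => (integrable_mix_mul hgi hΦ hM v).const_mul _,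
      Finset.sum_eq_single ∅]
    · rw [integral_const_mul, integral_mix_empty hgi hΦ hM hN]
      simp
    · intro v _ hv
      rw [integral_const_mul, integral_mix_mul_eq_zero hgi hΦ hM hN hz
        (Finset.nonempty_iff_ne_empty.2 hv), mul_zero]
    · simp
  have hmeas : Measurable fun z : (κ → ℝ) × (κ → ℝ) => if ∀ i, |z.1 i - z.2 i| < 1 / N i then
        ENNReal.ofReal |boxDelta g z.2 z.1| else 0 := by
    refine Measurable.ite ?_
      (measurable_boxDelta hg measurable_snd measurable_fst).abs.ennreal_ofReal measurable_const
    rw [Set.ofPred_forall]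
    refine MeasurableSet.iInter fun i => measurableSet_lt ?_ measurable_const
    exact (((measurable_pi_apply i).comp measurable_fst).sub
      ((measurable_pi_apply i).comp measurable_snd)).abs
  have hbound : ∫⁻ z, ‖D z‖ₑ ∂(cubeM κ).prod (cubeM κ) ≤
      ENNReal.ofReal (∏ j, M j * N j) * (ENNReal.ofReal
        (∏ j, 2 * (1 / (N j : ℝ)) * (1 / (N j : ℝ)) ^ lam) * vitaliVariation lam p g) := by
    calc ∫⁻ z, ‖D z‖ₑ ∂(cubeM κ).prod (cubeM κ)
        ≤ ∫⁻ z, ENNReal.ofReal (∏ j, M j * N j) * (if ∀ i, |z.1 i - z.2 i| < 1 / N i then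
            ENNReal.ofReal |boxDelta g z.2 z.1| else 0) ∂(cubeM κ).prod (cubeM κ) := by
          have h2 : ∀ᵐ z ∂(cubeM κ).prod (cubeM κ), z.2 ∈ cube κ :=
            Measure.quasiMeasurePreserving_snd.ae ae_mem_cube
          refine lintegral_mono_ae ?_
          filter_upwards [h2] with z hz2
          by_cases h0 : ∃ j, sameBlock (N j) (z.2 j) (z.1 j) = 0
          · obtain ⟨j, hj⟩ := h0
            have : D z = 0 := by
              simp only [hD]
              rw [Finset.prod_eq_zero (Finset.mem_univ j) (by rw [hj, mul_zero]), zero_mul]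
            simp [this]
          · push Not at h0
            rw [if_pos fun i => by
              rw [abs_sub_comm]; exact abs_sub_lt_of_sameBlock_ne_zero (hN i) (h0 i),
              ← ENNReal.ofReal_mul (Finset.prod_nonneg fun j _ => mul_nonneg (hM0 j)
                (Nat.cast_nonneg _)), ← ofReal_norm]
            refine ENNReal.ofReal_le_ofReal ?_
            simp only [hD]
            rw [norm_mul, norm_prod, Complex.norm_real, Real.norm_eq_abs,
              ← abs_boxDelta_inf_sup g z.2, inf_comm, sup_comm, abs_boxDelta_inf_sup]
            refine mul_le_mul_of_nonneg_right (Finset.prod_le_prod (fun _ _ => norm_nonneg _)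
              fun j _ => ?_) (abs_nonneg _)
            rw [norm_mul]
            exact mul_le_mul (hM j _ (mem_cube.1 hz2 j)) (norm_sameBlock_le _ _ _)
              (norm_nonneg _) (hM0 j)
      _ ≤ _ := by
          rw [lintegral_const_mul _ hmeas, lintegral_prod _ hmeas.aemeasurable]
          gcongr
          convert! lintegral_boxDelta_close_le (lam := lam) hlam hp hg
            (r := fun j => 1 / (N j : ℝ)) fun j => by have := hN j; positivity
  rw [hid]
  refine (norm_integral_le_lintegral_norm _).trans ?_
  simp only [ofReal_norm]
  refine (ENNReal.toReal_mono (by finiteness) hbound).trans (le_of_eq ?_)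
  rw [ENNReal.toReal_mul, ENNReal.toReal_mul, ENNReal.toReal_ofReal, ENNReal.toReal_ofReal,
    ← mul_assoc, ← Finset.prod_mul_distrib]
  · congr 1
    refine Finset.prod_congr rfl fun j _ => ?_
    have hNj : (0 : ℝ) < N j := by exact_mod_cast hN j
    rw [one_div, Real.inv_rpow hNj.le, Real.rpow_neg hNj.le]
    field_simp
  · exact Finset.prod_nonneg fun j _ => by positivity
  · exact Finset.prod_nonneg fun j _ => mul_nonneg (hM0 j) (Nat.cast_nonneg _)

end Integral

end Oscillation

section HardyKrause

set_option linter.unusedSectionVars false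

variable {ι : Type*} [Fintype ι] [DecidableEq ι]

lemma boxDelta_congr {κ : Type*} [Fintype κ] [DecidableEq κ] {g g' : (κ → ℝ) → ℝ}
    (h : ∀ x ∈ cube κ, g x = g' x) {a b : κ → ℝ} (ha : a ∈ cube κ) (hb : b ∈ cube κ) :
    boxDelta g a b = boxDelta g' a b := by
  unfold boxDelta
  refine Finset.sum_congr rfl fun v _ => ?_
  rw [h]
  rw [mem_cube] at *
  intro i
  split_ifs
  · exact ha i
  · exact hb i

lemma vitaliVariation_congr {κ : Type*} [Fintype κ] [DecidableEq κ] {g g' : (κ → ℝ) → ℝ}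
    (h : ∀ x ∈ cube κ, g x = g' x) (lam p : ℝ) :
    vitaliVariation lam p g = vitaliVariation lam p g' := by
  unfold vitaliVariation
  refine iSup_congr fun P => iSup_congr fun hP => ?_
  congr 1
  refine Finset.sum_congr rfl fun J hJ => ?_
  rw [boxDelta_congr h]
  · rw [mem_cube]
    intro i
    have := hP.1 J hJ i
    exact ⟨this.1, this.2.1.trans this.2.2⟩
  · rw [mem_cube]
    intro i
    have := hP.1 J hJ i
    exact ⟨this.1.trans this.2.1.le, this.2.2⟩

lemma proj_congr {g g' : (ι → ℝ) → ℝ} (h : ∀ x ∈ cube ι, g x = g' x) (w : Finset ι) {x : w → ℝ}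
    (hx : x ∈ cube w) : proj g w x = proj g' w x :=
  setIntegral_congr_fun measurableSet_cube fun _ hy => h _ (glue_mem_cube hx hy)

lemma hkVariation_congr {g g' : (ι → ℝ) → ℝ} (h : ∀ x ∈ cube ι, g x = g' x) (lam p q : ℝ) :
    hkVariation lam p q g = hkVariation lam p q g' := by
  unfold hkVariation
  have h1 : IntegrableOn g (cube ι) ↔ IntegrableOn g' (cube ι) :=
    integrableOn_congr_fun h measurableSet_cube
  have h2 : ∀ w, vitaliVariation lam p (proj g w) = vitaliVariation lam p (proj g' w) := fun w =>
    vitaliVariation_congr (fun x hx => proj_congr h w hx) lam p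
  simp only [h2]
  by_cases hI : IntegrableOn g' (cube ι)
  · rw [if_pos (h1.2 hI), if_pos hI]
  · rw [if_neg fun h => hI (h1.1 h), if_neg hI]

lemma integrable_of_hkVariation {g : (ι → ℝ) → ℝ} {lam p q : ℝ} (h : hkVariation lam p q g ≠ ⊤) :
    Integrable g (cubeM ι) := by
  rw [← restrict_cube]
  by_contra hne
  exact h (if_neg hne)

lemma vitaliVariation_proj_le {g : (ι → ℝ) → ℝ} {lam p q : ℝ} (hq : 1 ≤ q) (w : Finset ι) :
    vitaliVariation lam p (proj g w) ≤ hkVariation lam p q g := by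
  unfold hkVariation
  split_ifs
  · rw [one_div, ENNReal.le_rpow_inv_iff (by linarith)]
    exact Finset.single_le_sum (f := fun w => vitaliVariation lam p (proj g w) ^ q)
      (fun _ _ => zero_le) (Finset.mem_univ w)
  · exact le_top

lemma measurable_proj {g : (ι → ℝ) → ℝ} (hg : Measurable g) (w : Finset ι) :
    Measurable (proj g w) := by
  unfold proj
  rw [restrict_cube]
  exact (StronglyMeasurable.integral_prod_right (f := fun x y => g (glue w x y))
    (hg.comp (measurePreserving_glue w).measurable).stronglyMeasurable).measurable

lemma integrable_proj {g : (ι → ℝ) → ℝ} (hg : Integrable g (cubeM ι)) (w : Finset ι) :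
    Integrable (proj g w) (cubeM w) := by
  unfold proj
  rw [restrict_cube]
  exact ((measurePreserving_glue w).integrable_comp_of_integrable hg).integral_prod_left

lemma integral_prod_mul_eq_proj {g : (ι → ℝ) → ℝ} {w : Finset ι} {Φ : ι → ℝ → ℂ}
    (hint : Integrable (fun t => (∏ j ∈ w, Φ j (t j)) * (g t : ℂ)) (cubeM ι)) :
    ∫ t, (∏ j ∈ w, Φ j (t j)) * (g t : ℂ) ∂cubeM ι =
      ∫ x, (∏ j : w, Φ j (x j)) * (proj g w x : ℂ) ∂cubeM w := by
  rw [← integral_glue w hint]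
  refine integral_congr_ae (Filter.Eventually.of_forall fun x => ?_)
  simp only
  unfold proj
  rw [restrict_cube, ← integral_complex_ofReal, ← integral_const_mul]
  congr 1
  funext y
  congr 1
  rw [← Finset.prod_coe_sort]
  exact Finset.prod_congr rfl fun j _ => by simp [glue]

lemma integrable_prod_mul {g : (ι → ℝ) → ℝ} (hgi : Integrable g (cubeM ι)) {Φ : ι → ℝ → ℂ}
    {M : ι → ℝ} (hΦ : ∀ j, LocInt (Φ j)) (hM : ∀ j, ∀ x ∈ Set.Ico (0 : ℝ) 1, ‖Φ j x‖ ≤ M j)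
    (w : Finset ι) : Integrable (fun t => (∏ j ∈ w, Φ j (t j)) * (g t : ℂ)) (cubeM ι) := by
  refine hgi.ofReal.bdd_mul (c := ∏ j ∈ w, M j) ?_ ?_
  · exact (Finset.measurable_prod _ fun j _ =>
      (hΦ j).1.comp (measurable_pi_apply j)).aestronglyMeasurable
  · filter_upwards [ae_mem_cube] with t ht
    rw [norm_prod]
    exact Finset.prod_le_prod (fun _ _ => norm_nonneg _) fun j _ => hM j _ (mem_cube.1 ht j)

/-- Splitting off the mean. -/
lemma exists_mean_add {Ψ : ℝ → ℂ} {M lam : ℝ} {N : ℕ} (hΨ : LocInt Ψ)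
    (hM : ∀ x ∈ Set.Ico (0 : ℝ) 1, ‖Ψ x‖ ≤ M) (h : BlockMeanZero N Ψ ∨ N = 1) :
    ∃ (c : ℂ) (Φ : ℝ → ℂ), (∀ x, Ψ x = Φ x + c) ∧ LocInt Φ ∧ BlockMeanZero N Φ ∧
      (∀ x ∈ Set.Ico (0 : ℝ) 1, ‖Φ x‖ ≤ 2 * M) ∧ ‖c‖ ≤ M * (N : ℝ) ^ (-lam) := by
  have hM0 : 0 ≤ M := (norm_nonneg _).trans (hM 0 (by simp))
  rcases h with h | rfl
  · refine ⟨0, Ψ, by simp, hΨ, h, fun x hx => (hM x hx).trans (by linarith), ?_⟩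
    rw [norm_zero]
    positivity
  · have hc : ‖tailInt Ψ 0‖ ≤ M := norm_tailInt_le hM (by simp)
    refine ⟨tailInt Ψ 0, fun x => Ψ x - tailInt Ψ 0, by simp,
      ⟨hΨ.1.sub_const _, fun a b => (hΨ.2 a b).sub intervalIntegrable_const⟩, ?_, ?_, by simpa⟩
    · intro c hc
      obtain rfl : c = 0 := by omega
      simp only [Nat.cast_zero, zero_add, Nat.cast_one, div_one]
      rw [intervalIntegral.integral_sub (hΨ.2 _ _) intervalIntegrable_const]
      simp [tailInt]
    · intro x hx
      exact (norm_sub_le _ _).trans (by linarith [hM x hx])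

/-- The integral of `g` against a product of functions each of which has vanishing means on blocks,
or is only bounded. -/
lemma norm_integral_mul_prod_le_hk {lam p q : ℝ} (hlam : 0 ≤ lam) (hp : 1 ≤ p) (hq : 1 ≤ q)
    {g : (ι → ℝ) → ℝ} (hg : Measurable g) (hV : hkVariation lam p q g ≠ ⊤) {Ψ : ι → ℝ → ℂ}
    {N : ι → ℕ} {M : ι → ℝ} (hΨ : ∀ j, LocInt (Ψ j))
    (hM : ∀ j, ∀ x ∈ Set.Ico (0 : ℝ) 1, ‖Ψ j x‖ ≤ M j) (hN : ∀ j, 0 < N j)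
    (hz : ∀ j, BlockMeanZero (N j) (Ψ j) ∨ N j = 1) :
    ‖∫ t, (∏ j, Ψ j (t j)) * (g t : ℂ) ∂cubeM ι‖ ≤
      2 ^ Fintype.card ι * (∏ j, 4 * M j * (N j : ℝ) ^ (-lam)) * (hkVariation lam p q g).toReal := by
  have hgi := integrable_of_hkVariation hV
  have hM0 : ∀ j, 0 ≤ M j := fun j => (norm_nonneg _).trans (hM j 0 (by simp))
  choose c Φ h1 h2 h3 h4 h5 using fun j => exists_mean_add (lam := lam) (hΨ j) (hM j) (hz j)
  have hexp : ∀ t : ι → ℝ, (∏ j, Ψ j (t j)) * (g t : ℂ) =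
      ∑ w : Finset ι, (∏ j ∈ wᶜ, c j) * ((∏ j ∈ w, Φ j (t j)) * (g t : ℂ)) := by
    intro t
    simp only [h1]
    rw [Finset.prod_add, Finset.sum_mul, Finset.powerset_univ]
    refine Finset.sum_congr rfl fun w _ => ?_
    rw [Finset.compl_eq_univ_sdiff]
    ring
  simp only [hexp]
  rw [integral_finsetSum _ fun w _ => (integrable_prod_mul hgi h2 h4 w).const_mul _]
  refine (norm_sum_le _ _).trans ?_
  have hw : ∀ w ∈ (univ : Finset (Finset ι)),
      ‖∫ t, (∏ j ∈ wᶜ, c j) * ((∏ j ∈ w, Φ j (t j)) * (g t : ℂ)) ∂cubeM ι‖ ≤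
      (∏ j, 4 * M j * (N j : ℝ) ^ (-lam)) * (hkVariation lam p q g).toReal := by
    intro w _
    have hle := vitaliVariation_proj_le (g := g) (lam := lam) (p := p) hq w
    rw [integral_const_mul, norm_mul, integral_prod_mul_eq_proj (integrable_prod_mul hgi h2 h4 w)]
    have hb := norm_integral_mul_prod_le (κ := w) hlam hp (measurable_proj hg w)
      (integrable_proj hgi w) (fun j => h2 j) (fun j => h4 j) (fun j => hN j) (fun j => h3 j)
      (ne_top_of_le_ne_top hV hle)
    have hnn : ∀ j, 0 ≤ M j * (N j : ℝ) ^ (-lam) := fun j =>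
      mul_nonneg (hM0 j) (Real.rpow_nonneg (Nat.cast_nonneg _) _)
    calc _ ≤ (∏ j ∈ wᶜ, 4 * M j * (N j : ℝ) ^ (-lam)) *
          ((∏ j : w, 4 * M j * (N j : ℝ) ^ (-lam)) * (hkVariation lam p q g).toReal) := by
          rw [norm_prod]
          refine mul_le_mul ?_ ?_ (norm_nonneg _) (Finset.prod_nonneg fun j _ => ?_)
          · refine Finset.prod_le_prod (fun _ _ => norm_nonneg _) fun j _ => ?_
            linarith [h5 j, hnn j]
          · refine hb.trans (mul_le_mul ?_ (ENNReal.toReal_mono hV hle) ENNReal.toReal_nonneg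
              (Finset.prod_nonneg fun j _ => by linarith [hnn j]))
            refine le_of_eq (Finset.prod_congr rfl fun j _ => by ring)
          · linarith [hnn j]
      _ = _ := by
          rw [← mul_assoc, Finset.prod_coe_sort w fun j => 4 * M j * (N j : ℝ) ^ (-lam),
            mul_comm (∏ j ∈ wᶜ, _), Finset.prod_mul_prod_compl]
  refine (Finset.sum_le_card_nsmul _ _ _ hw).trans (le_of_eq ?_)
  rw [Finset.card_univ, Fintype.card_finset, nsmul_eq_mul, mul_assoc]
  push_cast
  ring

end HardyKrause

/-! ### Taylor's formula -/

/-- The kernel of the Taylor formula of order `δ`: monomials for `i < δ`, and the kernel of the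
integral remainder for `i = δ`. -/
noncomputable def taylorKernel (δ i : ℕ) (x t : ℝ) : ℝ :=
  if i < δ then x ^ i / i.factorial else if t < x then (x - t) ^ (δ - 1) / (δ - 1).factorial else 0

lemma taylor_remainder_step {G₀ G₁ : ℝ → ℝ} (k : ℕ)
    (h : ∀ x ∈ Set.Ico (0 : ℝ) 1, HasDerivWithinAt G₀ (G₁ x) (Set.Ico 0 1) x)
    (hc : ContinuousOn G₁ (Set.Ico (0 : ℝ) 1)) {x : ℝ} (hx : x ∈ Set.Ico (0 : ℝ) 1) :
    (k = 0 → G₀ x = G₀ 0 + ∫ t in (0 : ℝ)..x, G₁ t) ∧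
    (0 < k → ∫ t in (0 : ℝ)..x, G₀ t * ((x - t) ^ (k - 1) / (k - 1).factorial) =
      G₀ 0 * (x ^ k / k.factorial) + ∫ t in (0 : ℝ)..x, G₁ t * ((x - t) ^ k / k.factorial)) := by
  have hsub : Set.Icc 0 x ⊆ Set.Ico (0 : ℝ) 1 := fun y hy => ⟨hy.1, hy.2.trans_lt hx.2⟩
  have hc0 : ContinuousOn G₀ (Set.Icc 0 x) := fun y hy =>
    ((h y (hsub hy)).continuousWithinAt).mono hsub
  have hc1 : ContinuousOn G₁ (Set.Icc 0 x) := hc.mono hsub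
  have hd : ∀ y ∈ Set.Ioo 0 x, HasDerivAt G₀ (G₁ y) y := fun y hy =>
    (h y (hsub ⟨hy.1.le, hy.2.le⟩)).hasDerivAt (Ico_mem_nhds hy.1 (hy.2.trans hx.2))
  constructor
  · rintro rfl
    rw [intervalIntegral.integral_eq_sub_of_hasDerivAt_of_le hx.1 hc0 hd
      (hc1.intervalIntegrable_of_Icc hx.1)]
    ring
  · intro hk
    obtain ⟨k, rfl⟩ : ∃ k', k = k' + 1 := ⟨k - 1, by omega⟩
    rw [Nat.add_sub_cancel]
    have hpol : ∀ n : ℕ, ContinuousOn (fun t : ℝ => (x - t) ^ n / (n.factorial : ℝ)) (Set.Icc 0 x) :=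
      fun n => by fun_prop
    have i0 : IntervalIntegrable (fun t => G₀ t * ((x - t) ^ k / k.factorial)) volume 0 x :=
      (hc0.mul (hpol k)).intervalIntegrable_of_Icc hx.1
    have i1 : IntervalIntegrable (fun t => G₁ t * ((x - t) ^ (k + 1) / (k + 1).factorial))
        volume 0 x := (hc1.mul (hpol (k + 1))).intervalIntegrable_of_Icc hx.1
    have hF : ∀ y ∈ Set.Ioo 0 x, HasDerivAt (fun t => -(G₀ t * ((x - t) ^ (k + 1) / (k + 1).factorial)))
        (G₀ y * ((x - y) ^ k / k.factorial) - G₁ y * ((x - y) ^ (k + 1) / (k + 1).factorial)) y := by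
      intro y hy
      have hp : HasDerivAt (fun t : ℝ => (x - t) ^ (k + 1) / ((k + 1).factorial : ℝ))
          (-((x - y) ^ k / k.factorial)) y := by
        have := (((hasDerivAt_id y).const_sub x).pow (k + 1)).div_const ((k + 1).factorial : ℝ)
        convert! this using 1
        have : (k.factorial : ℝ) ≠ 0 := by positivity
        rw [Nat.factorial_succ]
        push_cast
        simp only [id]
        field_simp
      convert! ((hd y hy).mul hp).neg using 1
      ring
    have := intervalIntegral.integral_eq_sub_of_hasDerivAt_of_le hx.1
      (hc0.mul (hpol (k + 1))).neg hF (i0.sub i1)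
    rw [intervalIntegral.integral_sub i0 i1] at this
    have hE : -(G₀ x * ((x - x) ^ (k + 1) / ((k + 1).factorial : ℝ))) -
        -(G₀ 0 * ((x - 0) ^ (k + 1) / ((k + 1).factorial : ℝ))) =
        G₀ 0 * (x ^ (k + 1) / ((k + 1).factorial : ℝ)) := by simp
    linarith [this.trans hE]

lemma taylor_remainder {G : ℕ → ℝ → ℝ} {k : ℕ} (hk : 0 < k)
    (h : ∀ i < k, ∀ x ∈ Set.Ico (0 : ℝ) 1, HasDerivWithinAt (G i) (G (i + 1) x) (Set.Ico 0 1) x)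
    (hc : ∀ i ≤ k, ContinuousOn (G i) (Set.Ico (0 : ℝ) 1)) {x : ℝ} (hx : x ∈ Set.Ico (0 : ℝ) 1) :
    G 0 x = ∑ i ∈ range k, G i 0 * (x ^ i / i.factorial) +
      ∫ t in (0 : ℝ)..x, G k t * ((x - t) ^ (k - 1) / (k - 1).factorial) := by
  induction k, hk using Nat.le_induction with
  | base =>
    have := (taylor_remainder_step 0 (h 0 (by omega)) (hc 1 le_rfl) hx).1 rfl
    simpa using this
  | succ k hk ih =>
    rw [ih (fun i hi => h i (by omega)) (fun i hi => hc i (by omega)),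
      (taylor_remainder_step k (h k (by omega)) (hc (k + 1) le_rfl) hx).2 hk,
      Finset.sum_range_succ, Nat.add_sub_cancel, add_assoc]

/-- Taylor's formula with both kinds of terms in the same form. -/
lemma taylor_kernel {G : ℕ → ℝ → ℝ} {δ : ℕ} (hδ : 0 < δ)
    (h : ∀ i < δ, ∀ x ∈ Set.Ico (0 : ℝ) 1, HasDerivWithinAt (G i) (G (i + 1) x) (Set.Ico 0 1) x)
    (hc : ∀ i ≤ δ, ContinuousOn (G i) (Set.Ico (0 : ℝ) 1)) {x : ℝ} (hx : x ∈ Set.Ico (0 : ℝ) 1) :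
    G 0 x = ∑ i ∈ range (δ + 1),
      ∫ y, G i (if i = δ then y else 0) * taylorKernel δ i x y ∂unitM := by
  rw [taylor_remainder hδ h hc hx, Finset.sum_range_succ]
  congr 1
  · refine Finset.sum_congr rfl fun i hi => ?_
    have hi' := Finset.mem_range.1 hi
    simp [taylorKernel, hi', hi'.ne]
  · simp only [if_true, taylorKernel, lt_irrefl, if_false]
    have : ∀ y, G δ y * (if y < x then (x - y) ^ (δ - 1) / ((δ - 1).factorial : ℝ) else 0) =
        (Set.Iio x).indicator (fun y => G δ y * ((x - y) ^ (δ - 1) / (δ - 1).factorial)) y := by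
      intro y
      by_cases hy : y < x <;> simp [hy]
    simp only [this]
    rw [integral_indicator measurableSet_Iio, unitM, Measure.restrict_restrict measurableSet_Iio,
      intervalIntegral.integral_of_le hx.1, integral_Ioc_eq_integral_Ioo,
      ← integral_Ico_eq_integral_Ioo]
    congr 2
    ext y
    simp only [Set.mem_Ico, Set.mem_inter_iff, Set.mem_Iio]
    exact ⟨fun h => ⟨h.2, h.1, h.2.trans hx.2⟩, fun h => ⟨h.2.1, h.1⟩⟩

lemma measurable_taylorKernel {α : Type*} [MeasurableSpace α] (δ i : ℕ) {f g : α → ℝ}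
    (hf : Measurable f) (hg : Measurable g) : Measurable fun z => taylorKernel δ i (f z) (g z) := by
  unfold taylorKernel
  split_ifs
  · exact (hf.pow_const _).div_const _
  · exact Measurable.ite (measurableSet_lt hg hf) (((hf.sub hg).pow_const _).div_const _)
      measurable_const

lemma taylorKernel_nonneg {δ i : ℕ} {x t : ℝ} (hx : x ∈ Set.Ico (0 : ℝ) 1) :
    0 ≤ taylorKernel δ i x t := by
  unfold taylorKernel
  split_ifs with h1 h2
  · exact div_nonneg (pow_nonneg hx.1 _) (Nat.cast_nonneg _)
  · exact div_nonneg (pow_nonneg (by linarith) _) (Nat.cast_nonneg _)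
  · exact le_rfl

lemma taylorKernel_le_one {δ i : ℕ} {x t : ℝ} (hx : x ∈ Set.Ico (0 : ℝ) 1) (ht : 0 ≤ t) :
    taylorKernel δ i x t ≤ 1 := by
  have hf : ∀ n : ℕ, (1 : ℝ) ≤ n.factorial := fun n => by exact_mod_cast n.factorial_pos
  unfold taylorKernel
  split_ifs with h1 h2
  · exact div_le_one_of_le₀ ((pow_le_one₀ hx.1 hx.2.le).trans (hf _)) (Nat.cast_nonneg _)
  · exact div_le_one_of_le₀ ((pow_le_one₀ (by linarith) (by linarith [hx.2])).trans (hf _))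
      (Nat.cast_nonneg _)
  · exact zero_le_one

lemma abs_taylorKernel_le {δ i : ℕ} {x t : ℝ} (hx : x ∈ Set.Ico (0 : ℝ) 1) (ht : 0 ≤ t) :
    |taylorKernel δ i x t| ≤ 1 := by
  rw [abs_of_nonneg (taylorKernel_nonneg hx)]
  exact taylorKernel_le_one hx ht

section Multivariate

variable {s : ℕ} {δ : ℕ} {f : (Fin s → ℝ) → ℝ}

/-- The point at which the mixed derivative is taken in Taylor's formula for the variables in `A`. -/
noncomputable def taylorPoint (δ : ℕ) (A : Finset (Fin s)) (τ : Fin s → ℕ) (x t : Fin s → ℝ) :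
    Fin s → ℝ :=
  fun j => if j ∈ A then (if τ j = δ then t j else 0) else x j

/-- The integrand of Taylor's formula in the variables in `A`. -/
noncomputable def taylorTerm (δ : ℕ) (f : (Fin s → ℝ) → ℝ) (A : Finset (Fin s)) (τ : Fin s → ℕ)
    (x t : Fin s → ℝ) : ℝ :=
  mixedPartial τ f (taylorPoint δ A τ x t) * ∏ j ∈ A, taylorKernel δ (τ j) (x j) (t j)

lemma taylorPoint_mem_cube {A : Finset (Fin s)} {τ : Fin s → ℕ} {x t : Fin s → ℝ}
    (hx : x ∈ cube (Fin s)) (ht : t ∈ cube (Fin s)) : taylorPoint δ A τ x t ∈ cube (Fin s) := by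
  rw [mem_cube] at *
  intro j
  unfold taylorPoint
  split_ifs
  · exact ht j
  · simp
  · exact hx j

lemma measurable_indicator_of_continuousOn {ι : Type*} [Fintype ι] {g : (ι → ℝ) → ℝ}
    (hg : ContinuousOn g (cube ι)) : Measurable ((cube ι).indicator g) := by
  classical
  rw [← Set.piecewise_eq_indicator]
  exact hg.measurable_piecewise continuousOn_const measurableSet_cube

lemma measurable_taylorPoint (δ : ℕ) (A : Finset (Fin s)) (τ : Fin s → ℕ) (x : Fin s → ℝ) :
    Measurable (taylorPoint δ A τ x) := by
  refine measurable_pi_lambda _ fun j => ?_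
  unfold taylorPoint
  split_ifs
  · exact measurable_pi_apply j
  · exact measurable_const
  · exact measurable_const

lemma integrable_taylorTerm (hf : HasMixedPartials δ f) {A : Finset (Fin s)} {τ : Fin s → ℕ}
    (hτ : ∀ j, τ j ≤ δ) {x : Fin s → ℝ} (hx : x ∈ cube (Fin s)) :
    Integrable (taylorTerm δ f A τ x) (cubeM (Fin s)) := by
  have hcont := (hf τ hτ).1
  have hsub : Set.Icc 0 x ⊆ cube (Fin s) := fun y hy => by
    rw [mem_cube]
    exact fun i => ⟨hy.1 i, (hy.2 i).trans_lt (mem_cube.1 hx i).2⟩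
  obtain ⟨B, hB⟩ := (isCompact_Icc (a := (0 : Fin s → ℝ)) (b := x)).exists_bound_of_continuousOn
    (hcont.mono hsub)
  have h0 : (0 : Fin s → ℝ) ∈ Set.Icc 0 x := ⟨le_rfl, fun i => (mem_cube.1 hx i).1⟩
  have hB0 : 0 ≤ B := (norm_nonneg _).trans (hB 0 h0)
  refine Integrable.of_bound (C := B) ?_ ?_
  · refine AEStronglyMeasurable.congr (f := fun t =>
      (cube (Fin s)).indicator (mixedPartial τ f) (taylorPoint δ A τ x t) *
        ∏ j ∈ A, taylorKernel δ (τ j) (x j) (t j)) ?_ ?_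
    · refine Measurable.aestronglyMeasurable (Measurable.mul ?_ ?_)
      · exact (measurable_indicator_of_continuousOn hcont).comp (measurable_taylorPoint δ A τ x)
      · exact Finset.measurable_prod _ fun j _ =>
          measurable_taylorKernel _ _ measurable_const (measurable_pi_apply j)
    · filter_upwards [ae_mem_cube] with t ht
      rw [taylorTerm, Set.indicator_of_mem (taylorPoint_mem_cube hx ht)]
  · filter_upwards [ae_mem_cube] with t ht
    unfold taylorTerm
    rw [norm_mul, norm_prod]
    have hk1 : ∏ j ∈ A, ‖taylorKernel δ (τ j) (x j) (t j)‖ ≤ 1 :=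
      Finset.prod_le_one (fun _ _ => norm_nonneg _) fun j _ =>
        abs_taylorKernel_le (mem_cube.1 hx j) (mem_cube.1 ht j).1
    by_cases hz : ∃ j ∈ A, τ j = δ ∧ ¬ t j < x j
    · obtain ⟨j, hj, h1, h2⟩ := hz
      rw [Finset.prod_eq_zero hj (by simp [taylorKernel, h1, h2]), mul_zero]
      exact hB0
    · push Not at hz
      have hmem : taylorPoint δ A τ x t ∈ Set.Icc 0 x := by
        refine ⟨fun j => (mem_cube.1 (taylorPoint_mem_cube hx ht) j).1, fun j => ?_⟩
        unfold taylorPoint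
        split_ifs with h1 h2
        · exact (hz j h1 h2).le
        · exact (mem_cube.1 hx j).1
        · exact le_rfl
      exact (mul_le_of_le_one_right (norm_nonneg _) hk1).trans (hB _ hmem)

lemma taylorTerm_eq_sum (hδ : 0 < δ) (hf : HasMixedPartials δ f) {A : Finset (Fin s)} {a : Fin s}
    (ha : a ∉ A) {τ : Fin s → ℕ} (hτ : ∀ j, τ j ≤ δ) (hτa : τ a = 0) {x t : Fin s → ℝ}
    (hx : x ∈ cube (Fin s)) (ht : t ∈ cube (Fin s)) :
    taylorTerm δ f A τ x t = ∑ i ∈ range (δ + 1), ∫ y,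
      taylorTerm δ f (insert a A) (Function.update τ a i) x (Function.update t a y) ∂unitM := by
  set X := taylorPoint δ A τ x t with hX
  have hXc : X ∈ cube (Fin s) := taylorPoint_mem_cube hx ht
  have hXu : ∀ y ∈ Set.Ico (0 : ℝ) 1, Function.update X a y ∈ cube (Fin s) := by
    intro y hy
    rw [mem_cube] at hXc ⊢
    intro j
    by_cases hj : j = a
    · subst hj; simpa using hy
    · simpa [hj] using hXc j
  have hXa : X a = x a := by simp [hX, taylorPoint, ha]
  set G : ℕ → ℝ → ℝ := fun i y => mixedPartial (Function.update τ a i) f (Function.update X a y)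
    with hG
  have hle : ∀ i ≤ δ, ∀ j, Function.update τ a i j ≤ δ := by
    intro i hi j
    by_cases hj : j = a
    · subst hj; simpa using hi
    · simpa [hj] using hτ j
  have hT := taylor_kernel (G := G) hδ (x := x a) ?_ ?_ (mem_cube.1 hx a)
  · have h0 : G 0 (x a) = mixedPartial τ f X := by
      simp only [hG]
      rw [← hτa, Function.update_eq_self, ← hXa, Function.update_eq_self]
    rw [taylorTerm, ← hX, ← h0, hT, Finset.sum_mul]
    refine Finset.sum_congr rfl fun i _ => ?_
    rw [← integral_mul_const]
    congr 1
    funext y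
    unfold taylorTerm
    rw [Finset.prod_insert ha, Function.update_self, Function.update_self, ← mul_assoc]
    have hp : taylorPoint δ (insert a A) (Function.update τ a i) x (Function.update t a y) =
        Function.update X a (if i = δ then y else 0) := by
      funext j
      by_cases hj : j = a
      · subst hj; simp [taylorPoint]
      · simp [taylorPoint, hj, hX]
    rw [hp]
    congr 1
    refine Finset.prod_congr rfl fun j hj => ?_
    have hja : j ≠ a := fun e => ha (e ▸ hj)
    rw [Function.update_of_ne hja, Function.update_of_ne hja]
  · intro i hi y hy
    have h1 := (hf (Function.update τ a i) (hle i hi.le)).2 a (by simpa using hi) _ (hXu y hy)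
    have h2 : Function.update τ a i + Pi.single a 1 = Function.update τ a (i + 1) := by
      funext j
      by_cases hj : j = a
      · subst hj; simp
      · simp [hj]
    rw [h2] at h1
    simpa [hG] using h1
  · intro i hi
    refine (hf (Function.update τ a i) (hle i hi)).1.comp (Continuous.continuousOn ?_) hXu
    exact continuous_const.update a continuous_id

/-- Taylor's formula in the variables in `A`. -/
lemma taylor_partial (hδ : 0 < δ) (hf : HasMixedPartials δ f) (A : Finset (Fin s)) {x : Fin s → ℝ}
    (hx : x ∈ cube (Fin s)) :
    f x = ∑ τ ∈ Fintype.piFinset (fun j => if j ∈ A then range (δ + 1) else {0}),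
      ∫ t, taylorTerm δ f A τ x t ∂cubeM (Fin s) := by
  induction A using Finset.induction_on with
  | empty =>
    have h1 : (Fintype.piFinset fun j : Fin s => if j ∈ (∅ : Finset (Fin s)) then range (δ + 1)
        else {0}) = {0} := by
      simp only [Finset.notMem_empty, if_false]
      exact Fintype.piFinset_singleton (0 : Fin s → ℕ)
    rw [h1, Finset.sum_singleton]
    have h2 : mixedPartial (0 : Fin s → ℕ) f = f := by
      unfold mixedPartial
      induction List.finRange s with
      | nil => rfl
      | cons j l ih => simp
    have h3 : ∀ t, taylorTerm δ f ∅ 0 x t = f x := by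
      intro t
      have : taylorPoint δ ∅ 0 x t = x := by
        funext j
        simp [taylorPoint]
      simp [taylorTerm, h2, this]
    simp [h3]
  | insert a A ha ih =>
    have hmem : ∀ (B : Finset (Fin s)) (τ : Fin s → ℕ),
        τ ∈ Fintype.piFinset (fun j => if j ∈ B then range (δ + 1) else {0}) ↔
          (∀ j ∈ B, τ j ≤ δ) ∧ ∀ j ∉ B, τ j = 0 := by
      intro B τ
      rw [Fintype.mem_piFinset]
      constructor
      · refine fun h => ⟨fun j hj => ?_, fun j hj => ?_⟩
        · have := h j
          rw [if_pos hj, Finset.mem_range] at this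
          omega
        · simpa [hj] using h j
      · rintro ⟨h1, h2⟩ j
        split_ifs with hj
        · have := h1 j hj
          rw [Finset.mem_range]
          omega
        · simpa using h2 j hj
    have hstep : ∀ τ ∈ Fintype.piFinset (fun j => if j ∈ A then range (δ + 1) else {0}),
        ∫ t, taylorTerm δ f A τ x t ∂cubeM (Fin s) = ∑ i ∈ range (δ + 1),
          ∫ t, taylorTerm δ f (insert a A) (Function.update τ a i) x t ∂cubeM (Fin s) := by
      intro τ hτ
      obtain ⟨h1, h2⟩ := (hmem A τ).1 hτ
      have hle : ∀ j, τ j ≤ δ := fun j => by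
        by_cases hj : j ∈ A
        · exact h1 j hj
        · rw [h2 j hj]; omega
      have hint : ∀ i ∈ range (δ + 1),
          Integrable (taylorTerm δ f (insert a A) (Function.update τ a i) x) (cubeM (Fin s)) := by
        intro i hi
        refine integrable_taylorTerm hf (fun j => ?_) hx
        by_cases hj : j = a
        · subst hj
          have := Finset.mem_range.1 hi
          simp only [Function.update_self]
          omega
        · simpa [hj] using hle j
      calc ∫ t, taylorTerm δ f A τ x t ∂cubeM (Fin s)
          = ∫ t, ∑ i ∈ range (δ + 1), ∫ y, taylorTerm δ f (insert a A) (Function.update τ a i) x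
              (Function.update t a y) ∂unitM ∂cubeM (Fin s) := by
            refine integral_congr_ae ?_
            filter_upwards [ae_mem_cube] with t ht
            exact taylorTerm_eq_sum hδ hf ha hle (h2 a ha) hx ht
        _ = ∑ i ∈ range (δ + 1), ∫ t, ∫ y, taylorTerm δ f (insert a A) (Function.update τ a i) x
              (Function.update t a y) ∂unitM ∂cubeM (Fin s) := by
            refine integral_finsetSum _ fun i hi => ?_
            exact ((measurePreserving_update a).integrable_comp_of_integrable
              (hint i hi)).integral_prod_left
        _ = _ := Finset.sum_congr rfl fun i hi => integral_update a (hint i hi)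
    rw [ih, Finset.sum_congr rfl hstep, ← Finset.sum_product']
    refine Finset.sum_nbij' (fun z => Function.update z.1 a z.2)
      (fun τ => (Function.update τ a 0, τ a)) ?_ ?_ ?_ ?_ ?_
    · rintro ⟨τ, i⟩ hz
      obtain ⟨hz1, hz2⟩ := Finset.mem_product.1 hz
      obtain ⟨h1, h2⟩ := (hmem A τ).1 hz1
      have hi := Finset.mem_range.1 hz2
      refine (hmem _ _).2 ⟨fun j hj => ?_, fun j hj => ?_⟩
      · by_cases hja : j = a
        · subst hja
          simp only [Function.update_self]
          simp only at hi
          omega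
        · simpa [hja] using h1 j ((Finset.mem_insert.1 hj).resolve_left hja)
      · rw [Finset.mem_insert, not_or] at hj
        simpa [hj.1] using h2 j hj.2
    · intro τ hτ
      obtain ⟨h1, h2⟩ := (hmem _ τ).1 hτ
      refine Finset.mem_product.2 ⟨(hmem _ _).2 ⟨fun j hj => ?_, fun j hj => ?_⟩, ?_⟩
      · have hja : j ≠ a := fun e => ha (e ▸ hj)
        simpa [hja] using h1 j (Finset.mem_insert_of_mem hj)
      · by_cases hja : j = a
        · subst hja; simp
        · simpa [hja] using h2 j (by simp [hja, hj])
      · have := h1 a (Finset.mem_insert_self a A)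
        exact Finset.mem_range.2 (by simpa using Nat.lt_succ_of_le this)
    · rintro ⟨τ, i⟩ hz
      have h2 := ((hmem A τ).1 (Finset.mem_product.1 hz).1).2 a ha
      simp [← h2]
    · intro τ _
      simp
    · intro z _
      rfl

/-- The function `f^{(τ)}(·, 0)` as a function of all variables. -/
noncomputable def anchoredFull (δ : ℕ) (τ : Fin s → ℕ) (f : (Fin s → ℝ) → ℝ) (t : Fin s → ℝ) : ℝ :=
  anchored δ τ f fun j => t j

/-- Taylor's formula. -/
lemma taylor_full (hδ : 0 < δ) (hf : HasMixedPartials δ f) {x : Fin s → ℝ}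
    (hx : x ∈ cube (Fin s)) :
    f x = ∑ τ : Fin s → Fin (δ + 1), ∫ t, anchoredFull δ (fun j => (τ j : ℕ)) f t *
      ∏ j, taylorKernel δ (τ j) (x j) (t j) ∂cubeM (Fin s) := by
  rw [taylor_partial hδ hf univ hx]
  symm
  refine Finset.sum_nbij (fun (τ : Fin s → Fin (δ + 1)) j => (τ j : ℕ)) ?_ ?_ ?_ ?_
  · intro τ _
    simp only [Fintype.mem_piFinset, Finset.mem_univ, if_true, Finset.mem_range]
    exact fun j => (τ j).2
  · intro τ _ τ' _ h
    funext j
    exact Fin.ext (congrFun h j)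
  · intro τ hτ
    have hτ' : ∀ j, τ j < δ + 1 := fun j => by
      simpa using Fintype.mem_piFinset.1 (Finset.mem_coe.1 hτ) j
    exact ⟨fun j => ⟨τ j, hτ' j⟩, by simp, rfl⟩
  · intro τ _
    congr 1
    funext t
    unfold taylorTerm anchoredFull anchored
    congr 2
    funext j
    by_cases hj : (τ j : ℕ) = δ <;> simp [glue, taylorPoint, topSet, hj]

end Multivariate

/-! ### Iterated integrals as integrals against Taylor kernels -/

/-- The kernel of `n + 1`-fold integration. -/
noncomputable def truncPow (n : ℕ) (x t : ℝ) : ℝ :=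
  if t < x then (x - t) ^ n / n.factorial else 0

lemma measurable_truncPow {α : Type*} [MeasurableSpace α] (n : ℕ) {f g : α → ℝ}
    (hf : Measurable f) (hg : Measurable g) : Measurable fun z => truncPow n (f z) (g z) :=
  Measurable.ite (measurableSet_lt hg hf) (((hf.sub hg).pow_const _).div_const _) measurable_const

lemma abs_truncPow_le {n : ℕ} {x t : ℝ} (hx : x ∈ Set.Ico (0 : ℝ) 1) (ht : 0 ≤ t) :
    |truncPow n x t| ≤ 1 := by
  have := abs_taylorKernel_le (δ := n + 1) (i := n + 1) hx ht
  simpa [taylorKernel, truncPow] using this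

lemma tailInt_eq_integral_truncPow (Φ : ℝ → ℂ) {t : ℝ} (ht : t ∈ Set.Ico (0 : ℝ) 1) :
    tailInt Φ t = ∫ x, Φ x * (truncPow 0 x t : ℂ) ∂unitM := by
  have h : ∀ x, Φ x * (truncPow 0 x t : ℂ) = (Set.Ioi t).indicator Φ x := by
    intro x
    by_cases hx : t < x <;> simp [truncPow, hx]
  simp only [h]
  rw [integral_indicator measurableSet_Ioi, unitM, Measure.restrict_restrict measurableSet_Ioi,
    tailInt, intervalIntegral.integral_of_le ht.2.le, integral_Ioc_eq_integral_Ioo]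
  congr 2
  ext x
  simp only [Set.mem_Ioo, Set.mem_inter_iff, Set.mem_Ioi, Set.mem_Ico]
  exact ⟨fun h => ⟨h.1, ht.1.trans h.1.le, h.2⟩, fun h => ⟨h.1, h.2.2⟩⟩

lemma integral_truncPow_mul {n : ℕ} {t y : ℝ} (ht : t ∈ Set.Ico (0 : ℝ) 1)
    (hy : y ∈ Set.Ico (0 : ℝ) 1) :
    ∫ x, truncPow 0 y x * truncPow n x t ∂unitM = truncPow (n + 1) y t := by
  have h : ∀ x, truncPow 0 y x * truncPow n x t =
      (Set.Ioo t y).indicator (fun x => (x - t) ^ n / (n.factorial : ℝ)) x := by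
    intro x
    by_cases h1 : t < x <;> by_cases h2 : x < y <;> simp [truncPow, h1, h2]
  simp only [h]
  rw [integral_indicator measurableSet_Ioo, unitM, Measure.restrict_restrict measurableSet_Ioo,
    Set.inter_eq_left.2 (show Set.Ioo t y ⊆ Set.Ico 0 1 from
      fun x hx => ⟨ht.1.trans hx.1.le, hx.2.trans hy.2⟩)]
  unfold truncPow
  split_ifs with hty
  · rw [← integral_Ioc_eq_integral_Ioo, ← intervalIntegral.integral_of_le hty.le,
      intervalIntegral.integral_div, intervalIntegral.integral_comp_sub_right (fun x => x ^ n),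
      integral_pow, Nat.factorial_succ]
    have : (n.factorial : ℝ) ≠ 0 := by positivity
    push_cast
    simp only [sub_self, ne_eq, Nat.succ_ne_zero, not_false_eq_true, zero_pow, sub_zero]
    field_simp
  · rw [Set.Ioo_eq_empty hty, setIntegral_empty]

lemma iterate_tailInt_eq {Φ : ℝ → ℂ} (hΦ : LocInt Φ) (n : ℕ) :
    ∀ t ∈ Set.Ico (0 : ℝ) 1,
      tailInt^[n + 1] Φ t = ∫ x, Φ x * (truncPow n x t : ℂ) ∂unitM := by
  induction n generalizing Φ with
  | zero => exact fun t ht => tailInt_eq_integral_truncPow Φ ht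
  | succ n ih =>
    intro t ht
    rw [Function.iterate_succ_apply, ih hΦ.tailInt t ht]
    have hΦi : Integrable Φ unitM := by
      have := (intervalIntegrable_iff_integrableOn_Ico_of_le zero_le_one).1 (hΦ.2 0 1)
      exact this
    have hint : Integrable (Function.uncurry fun x y : ℝ =>
        Φ y * ((truncPow 0 y x * truncPow n x t : ℝ) : ℂ)) (unitM.prod unitM) := by
      refine (hΦi.comp_snd unitM).mul_bdd (c := 1) ?_ ?_
      · exact (Complex.measurable_ofReal.comp ((measurable_truncPow _ measurable_snd
          measurable_fst).mul (measurable_truncPow _ measurable_fst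
            measurable_const))).aestronglyMeasurable
      · have h1 : ∀ᵐ z ∂unitM.prod unitM, z.1 ∈ Set.Ico (0 : ℝ) 1 :=
          Measure.quasiMeasurePreserving_fst.ae ae_mem_unit
        have h2 : ∀ᵐ z ∂unitM.prod unitM, z.2 ∈ Set.Ico (0 : ℝ) 1 :=
          Measure.quasiMeasurePreserving_snd.ae ae_mem_unit
        filter_upwards [h1, h2] with z hz1 hz2
        rw [Complex.norm_real, Real.norm_eq_abs, abs_mul]
        exact mul_le_one₀ (abs_truncPow_le hz2 hz1.1) (abs_nonneg _) (abs_truncPow_le hz1 ht.1)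
    calc ∫ x, tailInt Φ x * (truncPow n x t : ℂ) ∂unitM
        = ∫ x, ∫ y, Φ y * ((truncPow 0 y x * truncPow n x t : ℝ) : ℂ) ∂unitM ∂unitM := by
          refine integral_congr_ae ?_
          filter_upwards [ae_mem_unit] with x hx
          rw [tailInt_eq_integral_truncPow Φ hx, ← integral_mul_const]
          congr 1
          funext y
          push_cast
          ring
      _ = ∫ y, ∫ x, Φ y * ((truncPow 0 y x * truncPow n x t : ℝ) : ℂ) ∂unitM ∂unitM :=
          integral_integral_swap hint
      _ = ∫ y, Φ y * (truncPow (n + 1) y t : ℂ) ∂unitM := by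
          refine integral_congr_ae ?_
          filter_upwards [ae_mem_unit] with y hy
          rw [integral_const_mul, integral_complex_ofReal, integral_truncPow_mul ht hy]

/-- The factor in the Walsh coefficient of a term of Taylor's formula. -/
noncomputable def taylorFactor (δ i : ℕ) (Φ : ℝ → ℂ) (t : ℝ) : ℂ :=
  if i = δ then tailInt^[δ] Φ t else tailInt^[i + 1] Φ 0

lemma integral_taylorKernel {δ i : ℕ} (hδ : 0 < δ) (hi : i ≤ δ) {Φ : ℝ → ℂ} (hΦ : LocInt Φ)
    {t : ℝ} (ht : t ∈ Set.Ico (0 : ℝ) 1) :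
    ∫ x, Φ x * (taylorKernel δ i x t : ℂ) ∂unitM = taylorFactor δ i Φ t := by
  unfold taylorFactor
  split_ifs with h
  · subst h
    obtain ⟨n, rfl⟩ : ∃ n, i = n + 1 := ⟨i - 1, by omega⟩
    rw [iterate_tailInt_eq hΦ n t ht]
    simp [taylorKernel, truncPow]
  · rw [iterate_tailInt_eq hΦ i 0 (by simp)]
    refine integral_congr_ae ?_
    have hne : ∀ᵐ x ∂unitM, x ≠ 0 := by
      refine ae_restrict_of_ae ?_
      simp [ae_iff]
    filter_upwards [ae_mem_unit, hne] with x hx hx0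
    have hlt : 0 < x := lt_of_le_of_ne hx.1 (Ne.symm hx0)
    have hi' : i < δ := lt_of_le_of_ne hi h
    simp [taylorKernel, truncPow, hlt, hi']

/-! ### Walsh coefficients of smooth functions -/

section Coefficients

variable {s : ℕ} {δ : ℕ} {f : (Fin s → ℝ) → ℝ}

lemma cast_le_of_fin (τ : Fin s → Fin (δ + 1)) (j : Fin s) : (τ j : ℕ) ≤ δ :=
  Nat.lt_succ_iff.1 (τ j).2

lemma hkVariation_ne_top {lam p q r : ℝ} {γ : Finset (Fin s) → ℝ≥0} (hr : 1 ≤ r)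
    (h : smoothNorm δ lam p q r γ f ≠ ⊤) (τ : Fin s → Fin (δ + 1)) :
    hkVariation lam p q (anchored δ (fun j => (τ j : ℕ)) f) ≠ ⊤ := by
  intro htop
  apply h
  have hr0 : (0 : ℝ) < 1 / r := by positivity
  unfold smoothNorm
  rw [ENNReal.rpow_eq_top_iff_of_pos hr0]
  refine ENNReal.sum_eq_top.2 ⟨τ, Finset.mem_univ _, ?_⟩
  rw [htop, ENNReal.top_rpow_of_pos (by linarith), ENNReal.top_div_of_ne_top ENNReal.coe_ne_top]

lemma continuousOn_anchored (hf : HasMixedPartials δ f) (τ : Fin s → Fin (δ + 1)) :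
    ContinuousOn (anchored δ (fun j => (τ j : ℕ)) f) (cube _) := by
  refine (hf _ (cast_le_of_fin τ)).1.comp (Continuous.continuousOn ?_) fun x hx =>
    glue_mem_cube hx (by simp [mem_cube])
  refine continuous_pi fun j => ?_
  unfold glue
  split_ifs
  · exact continuous_apply _
  · exact continuous_const

lemma integrable_anchoredFull (τ : Fin s → Fin (δ + 1))
    (h : Integrable (anchored δ (fun j => (τ j : ℕ)) f) (cubeM _)) :
    Integrable (anchoredFull δ (fun j => (τ j : ℕ)) f) (cubeM (Fin s)) :=
  (measurePreserving_restrict _).integrable_comp_of_integrable h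

lemma integrable_anchored_mul_kernel (τ : Fin s → Fin (δ + 1))
    (h : Integrable (anchored δ (fun j => (τ j : ℕ)) f) (cubeM _)) :
    Integrable (fun z : (Fin s → ℝ) × (Fin s → ℝ) => anchoredFull δ (fun j => (τ j : ℕ)) f z.2 *
      ∏ j, taylorKernel δ (τ j) (z.1 j) (z.2 j)) ((cubeM (Fin s)).prod (cubeM (Fin s))) := by
  refine ((integrable_anchoredFull τ h).comp_snd (cubeM (Fin s))).mul_bdd (c := 1) ?_ ?_
  · exact (Finset.measurable_prod _ fun j _ => measurable_taylorKernel _ _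
      ((measurable_pi_apply j).comp measurable_fst)
      ((measurable_pi_apply j).comp measurable_snd)).aestronglyMeasurable
  · have h1 : ∀ᵐ z ∂(cubeM (Fin s)).prod (cubeM (Fin s)), z.1 ∈ cube (Fin s) :=
      Measure.quasiMeasurePreserving_fst.ae ae_mem_cube
    have h2 : ∀ᵐ z ∂(cubeM (Fin s)).prod (cubeM (Fin s)), z.2 ∈ cube (Fin s) :=
      Measure.quasiMeasurePreserving_snd.ae ae_mem_cube
    filter_upwards [h1, h2] with z hz1 hz2
    rw [norm_prod]
    exact Finset.prod_le_one (fun _ _ => norm_nonneg _) fun j _ =>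
      abs_taylorKernel_le (mem_cube.1 hz1 j) (mem_cube.1 hz2 j).1

lemma integrable_of_taylor (hδ : 0 < δ) (hf : HasMixedPartials δ f)
    (h : ∀ τ : Fin s → Fin (δ + 1), Integrable (anchored δ (fun j => (τ j : ℕ)) f) (cubeM _)) :
    Integrable f (cubeM (Fin s)) := by
  have h1 : Integrable (fun x => ∑ τ : Fin s → Fin (δ + 1),
      ∫ t, anchoredFull δ (fun j => (τ j : ℕ)) f t *
      ∏ j, taylorKernel δ (τ j) (x j) (t j) ∂cubeM (Fin s)) (cubeM (Fin s)) :=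
    integrable_finsetSum _ fun τ _ => (integrable_anchored_mul_kernel τ (h τ)).integral_prod_left
  refine h1.congr ?_
  filter_upwards [ae_mem_cube] with x hx
  exact (taylor_full hδ hf hx).symm

/-- The contribution of one term of Taylor's formula to the integral of `f ∏ Φ_j`. -/
noncomputable def coefTerm (δ : ℕ) (f : (Fin s → ℝ) → ℝ) (Φ : Fin s → ℝ → ℂ)
    (τ : Fin s → Fin (δ + 1)) : ℂ :=
  ∫ t, (∏ j, taylorFactor δ (τ j) (Φ j) (t j)) *
    (anchoredFull δ (fun j => (τ j : ℕ)) f t : ℂ) ∂cubeM (Fin s)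

lemma integral_mul_prod_eq_sum (hδ : 0 < δ) (hf : HasMixedPartials δ f)
    (h : ∀ τ : Fin s → Fin (δ + 1), Integrable (anchored δ (fun j => (τ j : ℕ)) f) (cubeM _))
    {Φ : Fin s → ℝ → ℂ} (hΦ : ∀ j, LocInt (Φ j)) (hb : ∀ j x, ‖Φ j x‖ ≤ 1) :
    ∫ x, (f x : ℂ) * ∏ j, Φ j (x j) ∂cubeM (Fin s) =
      ∑ τ : Fin s → Fin (δ + 1), coefTerm δ f Φ τ := by
  have hint : ∀ τ : Fin s → Fin (δ + 1), Integrable (fun z : (Fin s → ℝ) × (Fin s → ℝ) =>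
      ((anchoredFull δ (fun j => (τ j : ℕ)) f z.2 *
        ∏ j, taylorKernel δ (τ j) (z.1 j) (z.2 j) : ℝ) : ℂ) * ∏ j, Φ j (z.1 j))
      ((cubeM (Fin s)).prod (cubeM (Fin s))) := by
    intro τ
    refine (integrable_anchored_mul_kernel τ (h τ)).ofReal.mul_bdd (c := 1) ?_ ?_
    · exact (Finset.measurable_prod _ fun j _ =>
        (hΦ j).1.comp ((measurable_pi_apply j).comp measurable_fst)).aestronglyMeasurable
    · refine Filter.Eventually.of_forall fun z => ?_
      rw [norm_prod]
      exact Finset.prod_le_one (fun _ _ => norm_nonneg _) fun j _ => hb j _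
  calc ∫ x, (f x : ℂ) * ∏ j, Φ j (x j) ∂cubeM (Fin s)
      = ∫ x, ∑ τ : Fin s → Fin (δ + 1), ∫ t, ((anchoredFull δ (fun j => (τ j : ℕ)) f t *
        ∏ j, taylorKernel δ (τ j) (x j) (t j) : ℝ) : ℂ) * ∏ j, Φ j (x j)
          ∂cubeM (Fin s) ∂cubeM (Fin s) := by
        refine integral_congr_ae ?_
        filter_upwards [ae_mem_cube] with x hx
        rw [taylor_full hδ hf hx, Complex.ofReal_sum, Finset.sum_mul]
        refine Finset.sum_congr rfl fun τ _ => ?_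
        rw [← integral_complex_ofReal, ← integral_mul_const]
    _ = ∑ τ : Fin s → Fin (δ + 1), ∫ x, ∫ t, ((anchoredFull δ (fun j => (τ j : ℕ)) f t *
        ∏ j, taylorKernel δ (τ j) (x j) (t j) : ℝ) : ℂ) * ∏ j, Φ j (x j)
          ∂cubeM (Fin s) ∂cubeM (Fin s) :=
        integral_finsetSum _ fun τ _ => (hint τ).integral_prod_left
    _ = ∑ τ : Fin s → Fin (δ + 1), coefTerm δ f Φ τ := by
        refine Finset.sum_congr rfl fun τ _ => ?_
        rw [integral_integral_swap (hint τ), coefTerm]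
        refine integral_congr_ae ?_
        filter_upwards [ae_mem_cube] with t ht
        have h1 : ∀ x : Fin s → ℝ, ((anchoredFull δ (fun j => (τ j : ℕ)) f t *
            ∏ j, taylorKernel δ (τ j) (x j) (t j) : ℝ) : ℂ) * ∏ j, Φ j (x j) =
            (∏ j, Φ j (x j) * (taylorKernel δ (τ j) (x j) (t j) : ℂ)) *
              (anchoredFull δ (fun j => (τ j : ℕ)) f t : ℂ) := by
          intro x
          push_cast
          rw [Finset.prod_mul_distrib]
          ring
        simp only [h1]
        rw [integral_mul_const, integral_fintype_prod_eq_prod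
          (fun j y => Φ j y * (taylorKernel δ (τ j) y (t j) : ℂ))]
        congr 1
        exact Finset.prod_congr rfl fun j _ =>
          integral_taylorKernel hδ (cast_le_of_fin τ j) (hΦ j) (mem_cube.1 ht j)

end Coefficients

/-! ### Bounds for Walsh coefficients -/

/-- The factor by which a Walsh coefficient with digits supported on `S` decays in base `q`, for
smoothness `δ + lam`. -/
noncomputable def decay (q δ : ℕ) (lam : ℝ) (S : Finset ℕ) : ℝ :=
  (q : ℝ) ^ (-((∑ i ∈ range δ, top S i : ℕ) + lam * (top S δ : ℕ) : ℝ))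

lemma decay_nonneg (q δ : ℕ) (lam : ℝ) (S : Finset ℕ) : 0 ≤ decay q δ lam S :=
  Real.rpow_nonneg (Nat.cast_nonneg _) _

section Decay

variable {F : Type*} [Field F] [Fintype F] {ψ : AddChar F ℂ} {φ : Fin (Fintype.card F) ≃ F}

lemma decay_eq (δ : ℕ) (lam : ℝ) (S : Finset ℕ) :
    decay (Fintype.card F) δ lam S = ((Fintype.card F : ℝ) ^ ∑ i ∈ range δ, top S i)⁻¹ *
      (Fintype.card F : ℝ) ^ (-(lam * (top S δ : ℕ))) := by
  unfold decay
  rw [neg_add, Real.rpow_add card_pos_real, Real.rpow_neg card_pos_real.le, Real.rpow_natCast]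

lemma sum_range_top_of_eq_zero {S : Finset ℕ} {i δ : ℕ} (hi : i ≤ δ) (h : top S i = 0) :
    ∑ l ∈ range δ, top S l = ∑ l ∈ range i, top S l := by
  refine (Finset.sum_subset (Finset.range_subset_range.2 hi) fun l _ hl => ?_).symm
  have := top_antitone S (not_lt.1 fun h' => hl (Finset.mem_range.2 h'))
  omega

lemma norm_taylorFactor_zero_le (hψ : ψ.IsPrimitive) {K : ℕ → F} {S : Finset ℕ}
    (hK : ∀ l ∈ S, K l ≠ 0) {i δ : ℕ} (hi : i < δ) (lam : ℝ) :
    ‖tailInt^[i + 1] (walsh ψ φ K S) 0‖ ≤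
      4 * (Fintype.card F : ℝ) ^ (δ + 1) * decay (Fintype.card F) δ lam S := by
  rcases Nat.eq_zero_or_pos (top S i) with h0 | h0
  · have hδ : top S δ = 0 := by
      have := top_antitone S hi.le
      omega
    refine (norm_iterate_tailInt_le (φ := φ) hψ hK (i + 1) 0 (by simp)).trans ?_
    rw [decay_eq, hδ, sum_range_top_of_eq_zero hi.le h0, Finset.sum_range_succ, h0, add_zero]
    have := card_pow_pos (F := F) (∑ l ∈ range i, top S l)
    simp only [CharP.cast_eq_zero, mul_zero, neg_zero, Real.rpow_zero, mul_one]
    rw [← div_eq_mul_inv]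
    gcongr
    have h1 : (Fintype.card F : ℝ) ^ (i + 1) ≤ (Fintype.card F : ℝ) ^ (δ + 1) :=
      pow_le_pow_right₀ one_le_card_real (by omega)
    linarith [card_pow_pos (F := F) (δ + 1)]
  · rw [iterate_tailInt_zero hψ hK h0, norm_zero]
    have := card_pow_pos (F := F) (δ + 1)
    have := decay_nonneg (Fintype.card F) δ lam S
    positivity

lemma mul_rpow_top_le_decay {δ : ℕ} {lam : ℝ} (h1 : lam ≤ 1) (S : Finset ℕ) :
    4 * ((Fintype.card F : ℝ) ^ δ / (Fintype.card F : ℝ) ^ ∑ l ∈ range δ, top S l) *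
      ((Fintype.card F ^ (top S δ - 1) : ℕ) : ℝ) ^ (-lam) ≤
      4 * (Fintype.card F : ℝ) ^ (δ + 1) * decay (Fintype.card F) δ lam S := by
  have hq := card_pos_real (F := F)
  have h2 : ((Fintype.card F ^ (top S δ - 1) : ℕ) : ℝ) ^ (-lam) ≤
      (Fintype.card F : ℝ) * (Fintype.card F : ℝ) ^ (-(lam * (top S δ : ℕ))) := by
    have h3 : (Fintype.card F : ℝ) * (Fintype.card F : ℝ) ^ (-(lam * (top S δ : ℕ))) =
        (Fintype.card F : ℝ) ^ (1 + -(lam * (top S δ : ℕ))) := by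
      rw [Real.rpow_add hq, Real.rpow_one]
    rw [h3]
    push_cast
    rw [← Real.rpow_natCast, ← Real.rpow_mul hq.le]
    refine Real.rpow_le_rpow_of_exponent_le one_le_card_real ?_
    rcases Nat.eq_zero_or_pos (top S δ) with h | h
    · simp [h]
    · rw [Nat.cast_sub (by omega)]
      push_cast
      nlinarith
  rw [decay_eq]
  calc _ ≤ 4 * ((Fintype.card F : ℝ) ^ δ / (Fintype.card F : ℝ) ^ ∑ l ∈ range δ, top S l) *
      ((Fintype.card F : ℝ) * (Fintype.card F : ℝ) ^ (-(lam * (top S δ : ℕ)))) := by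
        gcongr
    _ = _ := by
        rw [pow_succ]
        ring

variable {s δ : ℕ} {f : (Fin s → ℝ) → ℝ} {K : Fin s → ℕ → F} {S : Fin s → Finset ℕ}

lemma coefTerm_eq_zero (hψ : ψ.IsPrimitive) (hK : ∀ j, ∀ l ∈ S j, K j l ≠ 0) (hδ : 0 < δ)
    {τ : Fin s → Fin (δ + 1)} {j : Fin s} (hj : τ j = 0) (hS : (S j).Nonempty) :
    coefTerm δ f (fun j => walsh ψ φ (K j) (S j)) τ = 0 := by
  unfold coefTerm
  have h0 : ∀ t : ℝ, taylorFactor δ (τ j) (walsh ψ φ (K j) (S j)) t = 0 := by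
    intro t
    rw [taylorFactor, hj, if_neg (by simpa using hδ.ne)]
    exact iterate_tailInt_zero hψ (hK j) (i := 0) (lead_pos.2 hS)
  have h1 : ∀ t : Fin s → ℝ,
      ∏ j, taylorFactor δ (τ j) (walsh ψ φ (K j) (S j)) (t j) = 0 := fun t =>
    Finset.prod_eq_zero (Finset.mem_univ j) (h0 _)
  simp [h1]

lemma norm_coefTerm_le (hψ : ψ.IsPrimitive) (hK : ∀ j, ∀ l ∈ S j, K j l ≠ 0)
    {lam p q : ℝ} (hl0 : 0 ≤ lam) (hl1 : lam ≤ 1) (hp : 1 ≤ p) (hq : 1 ≤ q)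
    (hf : HasMixedPartials δ f) {τ : Fin s → Fin (δ + 1)}
    (hV : hkVariation lam p q (anchored δ (fun j => (τ j : ℕ)) f) ≠ ⊤) :
    ‖coefTerm δ f (fun j => walsh ψ φ (K j) (S j)) τ‖ ≤
      2 ^ s * (∏ j, 4 * (Fintype.card F : ℝ) ^ (δ + 1) * decay (Fintype.card F) δ lam (S j)) *
        (hkVariation lam p q (anchored δ (fun j => (τ j : ℕ)) f)).toReal := by
  set u := topSet δ fun j => (τ j : ℕ) with hu
  have hmem : ∀ j, j ∈ u ↔ (τ j : ℕ) = δ := fun j => by simp [hu, topSet]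
  set h := anchored δ (fun j => (τ j : ℕ)) f with hh
  set g := (cube u).indicator h with hg
  have hgm : Measurable g := measurable_indicator_of_continuousOn (continuousOn_anchored hf τ)
  have hgh : ∀ x ∈ cube u, g x = h x := fun x hx => Set.indicator_of_mem hx _
  have hVg : hkVariation lam p q g = hkVariation lam p q h := hkVariation_congr hgh lam p q
  have hfac : ∀ t ∈ cube (Fin s),
      (∏ j, taylorFactor δ (τ j) (walsh ψ φ (K j) (S j)) (t j)) *
        (anchoredFull δ (fun j => (τ j : ℕ)) f t : ℂ) =
      (∏ j ∈ uᶜ, tailInt^[(τ j : ℕ) + 1] (walsh ψ φ (K j) (S j)) 0) *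
        ((∏ j : u, tailInt^[δ] (walsh ψ φ (K j) (S j)) (t j)) * (g (fun j => t j) : ℂ)) := by
    intro t ht
    rw [← Finset.prod_mul_prod_compl u, mul_comm (∏ j ∈ u, _), mul_assoc]
    congr 1
    · refine Finset.prod_congr rfl fun j hj => ?_
      rw [taylorFactor, if_neg fun h => (Finset.mem_compl.1 hj) ((hmem j).2 h)]
    · congr 1
      · rw [← Finset.prod_coe_sort]
        exact Finset.prod_congr rfl fun j _ => by rw [taylorFactor, if_pos ((hmem j).1 j.2)]
      · rw [hgh _ (mem_cube.2 fun j => mem_cube.1 ht j)]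
        rfl
  have hcoef : coefTerm δ f (fun j => walsh ψ φ (K j) (S j)) τ =
      (∏ j ∈ uᶜ, tailInt^[(τ j : ℕ) + 1] (walsh ψ φ (K j) (S j)) 0) *
        ∫ x, (∏ j : u, tailInt^[δ] (walsh ψ φ (K j) (S j)) (x j)) * (g x : ℂ) ∂cubeM u := by
    unfold coefTerm
    rw [integral_congr_ae (ae_mem_cube.mono hfac), integral_const_mul]
    congr 1
    refine integral_restrict u (f := fun x =>
      (∏ j : u, tailInt^[δ] (walsh ψ φ (K j) (S j)) (x j)) * (g x : ℂ)) ?_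
    refine Measurable.aestronglyMeasurable (Measurable.mul (Finset.measurable_prod _ fun j _ => ?_)
      (Complex.measurable_ofReal.comp hgm))
    exact (((locInt_walsh ψ φ (K j) (S j)).iterate_tailInt δ).1).comp (measurable_pi_apply j)
  have hmain := norm_integral_mul_prod_le_hk (ι := u) (g := g) (lam := lam) (p := p) (q := q)
    hl0 hp hq hgm (by rw [hVg]; exact hV)
    (Ψ := fun j => tailInt^[δ] (walsh ψ φ (K j) (S j)))
    (N := fun j => Fintype.card F ^ (top (S j) δ - 1))
    (M := fun j => (Fintype.card F : ℝ) ^ δ / (Fintype.card F : ℝ) ^ ∑ l ∈ range δ, top (S j) l)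
    (fun j => (locInt_walsh ψ φ (K j) (S j)).iterate_tailInt δ)
    (fun j => norm_iterate_tailInt_le hψ (hK j) δ)
    (fun j => pow_pos Fintype.card_pos _)
    (fun j => by
      rcases Nat.eq_zero_or_pos (top (S j) δ) with h0 | h0
      · right; simp [h0]
      · left; exact blockMeanZero_iterate_tailInt hψ (hK j) h0)
  rw [hVg] at hmain
  set D : Fin s → ℝ := fun j =>
    4 * (Fintype.card F : ℝ) ^ (δ + 1) * decay (Fintype.card F) δ lam (S j) with hD
  have hD0 : ∀ j, 0 ≤ D j := fun j =>
    mul_nonneg (by have := card_pow_pos (F := F) (δ + 1); positivity) (decay_nonneg _ _ _ _)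
  rw [hcoef, norm_mul]
  calc _ ≤ (∏ j ∈ uᶜ, D j) * (2 ^ s * (∏ j : u, D j) * (hkVariation lam p q h).toReal) := by
        refine mul_le_mul ?_ (hmain.trans ?_) (norm_nonneg _) (Finset.prod_nonneg fun j _ => hD0 j)
        · rw [norm_prod]
          refine Finset.prod_le_prod (fun _ _ => norm_nonneg _) fun j hj => ?_
          refine norm_taylorFactor_zero_le hψ (hK j) ?_ lam
          exact lt_of_le_of_ne (cast_le_of_fin τ j) fun e => (Finset.mem_compl.1 hj) ((hmem j).2 e)
        · refine mul_le_mul_of_nonneg_right (mul_le_mul ?_ ?_ (Finset.prod_nonneg fun j _ => ?_)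
            (by positivity)) ENNReal.toReal_nonneg
          · refine pow_le_pow_right₀ one_le_two ?_
            rw [Fintype.card_coe]
            exact (Finset.card_le_univ u).trans (by simp)
          · refine Finset.prod_le_prod (fun j _ => ?_) fun j _ => mul_rpow_top_le_decay hl1 _
            have h1 := card_pow_pos (F := F) δ
            have h2 := card_pow_pos (F := F) (∑ l ∈ range δ, top (S j) l)
            have h3 : (0 : ℝ) ≤ ((Fintype.card F ^ (top (S j) δ - 1) : ℕ) : ℝ) ^ (-lam) :=
              Real.rpow_nonneg (Nat.cast_nonneg _) _
            positivity
          · have h1 := card_pow_pos (F := F) δ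
            have h2 := card_pow_pos (F := F) (∑ l ∈ range δ, top (S j) l)
            have h3 : (0 : ℝ) ≤ ((Fintype.card F ^ (top (S j) δ - 1) : ℕ) : ℝ) ^ (-lam) :=
              Real.rpow_nonneg (Nat.cast_nonneg _) _
            positivity
    _ = _ := by
        rw [Finset.prod_coe_sort u D, ← Finset.prod_mul_prod_compl u D]
        ring

end Decay

/-! ### Walsh series and the integration error -/

section WalshSeries

set_option linter.unusedSectionVars false

variable {F : Type*} [Field F] [Fintype F]

/-- The extension by zero of a finite sequence of digits. -/
noncomputable def extDigits {G : ℕ} (k : Fin G → F) (l : ℕ) : F := if h : l < G then k ⟨l, h⟩ else 0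

open Classical in
/-- The positions of the nonzero digits. -/
noncomputable def digitSupp {G : ℕ} (k : Fin G → F) : Finset ℕ :=
  (range G).filter fun l => extDigits k l ≠ 0

lemma mem_digitSupp {G : ℕ} {k : Fin G → F} {l : ℕ} : l ∈ digitSupp k ↔ extDigits k l ≠ 0 := by
  classical
  unfold digitSupp
  rw [Finset.mem_filter, Finset.mem_range, and_iff_right_iff_imp]
  intro h
  by_contra hl
  exact h (dif_neg hl)

lemma digitSupp_nonempty {G : ℕ} {k : Fin G → F} : (digitSupp k).Nonempty ↔ k ≠ 0 := by
  constructor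
  · rintro ⟨l, hl⟩ rfl
    rw [mem_digitSupp] at hl
    exact hl (by simp [extDigits])
  · intro h
    obtain ⟨i, hi⟩ := Function.ne_iff.1 h
    exact ⟨i, mem_digitSupp.2 (by simpa [extDigits] using hi)⟩

/-- The Walsh function with the digits `k`. -/
noncomputable def walshFn (ψ : AddChar F ℂ) (φ : Fin (Fintype.card F) ≃ F) {G : ℕ} (k : Fin G → F) :
    ℝ → ℂ :=
  walsh ψ φ (extDigits k) (digitSupp k)

variable (ψ : AddChar F ℂ) (φ : Fin (Fintype.card F) ≃ F)

lemma walshFn_eq {G : ℕ} (k : Fin G → F) (x : ℝ) :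
    walshFn ψ φ k x = ∏ l : Fin G, ψ (symb φ l x * k l) := by
  classical
  unfold walshFn walsh digitSupp
  rw [Finset.prod_filter_of_ne]
  · rw [Finset.prod_range]
    exact Finset.prod_congr rfl fun l _ => by simp [extDigits]
  · intro l _ h h0
    exact h (by rw [h0, mul_zero, AddChar.map_zero_eq_one])

variable {ψ φ}

lemma sum_walshFn_mul (hψ : ψ.IsPrimitive) {G : ℕ} {x y : ℝ} (hx : x ∈ Set.Ico (0 : ℝ) 1)
    (hy : y ∈ Set.Ico (0 : ℝ) 1) :
    ∑ k : Fin G → F, walshFn ψ φ k y * walshFn ψ φ (-k) x =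
      sameBlock (Fintype.card F ^ G) y x := by
  classical
  have h1 : ∀ k : Fin G → F, walshFn ψ φ k y * walshFn ψ φ (-k) x =
      ∏ l : Fin G, ψ (k l * (symb φ l y - symb φ l x)) := by
    intro k
    rw [walshFn_eq, walshFn_eq, ← Finset.prod_mul_distrib]
    refine Finset.prod_congr rfl fun l _ => ?_
    rw [← AddChar.map_add_eq_mul]
    congr 1
    simp only [Pi.neg_apply]
    ring
  simp only [h1]
  rw [← Fintype.prod_sum fun (l : Fin G) c => ψ (c * (symb φ l y - symb φ l x))]
  have h2 : ∀ l : Fin G, ∑ c, ψ (c * (symb φ l y - symb φ l x)) =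
      if symb φ l y = symb φ l x then (Fintype.card F : ℂ) else 0 := by
    intro l
    rw [AddChar.sum_mulShift _ hψ]
    simp [sub_eq_zero]
  simp only [h2]
  have hfl : ⌊y⌋ = ⌊x⌋ := by
    rw [Int.floor_eq_zero_iff.2 hx, Int.floor_eq_zero_iff.2 hy]
  have hiff := floor_eq_iff_symb φ hfl G
  unfold sameBlock
  push_cast
  by_cases h : ∀ l < G, symb φ l y = symb φ l x
  · rw [if_pos (hiff.2 h), Finset.prod_congr rfl fun (l : Fin G) _ => if_pos (h l l.2)]
    simp
  · rw [if_neg fun h' => h (hiff.1 h')]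
    push Not at h
    obtain ⟨l, hl, hne⟩ := h
    exact Finset.prod_eq_zero (Finset.mem_univ (⟨l, hl⟩ : Fin G)) (if_neg hne)

variable {s : ℕ} {f : (Fin s → ℝ) → ℝ}

/-- The Walsh coefficient of `f`. -/
noncomputable def walshCoef (ψ : AddChar F ℂ) (φ : Fin (Fintype.card F) ≃ F)
    (f : (Fin s → ℝ) → ℝ) {G : ℕ} (k : Fin s → Fin G → F) : ℂ :=
  ∫ x, (f x : ℂ) * ∏ j, walshFn ψ φ (k j) (x j) ∂cubeM (Fin s)

lemma integrable_mul_walsh (hf : Integrable f (cubeM (Fin s))) {G : ℕ} (k : Fin s → Fin G → F) :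
    Integrable (fun x => (f x : ℂ) * ∏ j, walshFn ψ φ (k j) (x j)) (cubeM (Fin s)) := by
  refine hf.ofReal.mul_bdd (c := 1) ?_ ?_
  · exact (Finset.measurable_prod _ fun j _ =>
      (measurable_walsh ψ φ _ _).comp (measurable_pi_apply j)).aestronglyMeasurable
  · refine Filter.Eventually.of_forall fun x => ?_
    rw [norm_prod]
    exact (Finset.prod_eq_one fun j _ => norm_walsh ψ φ _ _ _).le

lemma walsh_partial_sum (hψ : ψ.IsPrimitive) (hf : Integrable f (cubeM (Fin s))) (G : ℕ)
    {x : Fin s → ℝ} (hx : x ∈ cube (Fin s)) :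
    ∑ k : Fin s → Fin G → F, walshCoef ψ φ f k * ∏ j, walshFn ψ φ (-k j) (x j) =
      ∫ y, (f y : ℂ) * ∏ j, sameBlock (Fintype.card F ^ G) (y j) (x j) ∂cubeM (Fin s) := by
  unfold walshCoef
  simp only [← integral_mul_const]
  rw [← integral_finsetSum _ fun k _ => (integrable_mul_walsh hf k).mul_const _]
  refine integral_congr_ae ?_
  filter_upwards [ae_mem_cube] with y hy
  rw [Finset.prod_congr rfl fun j _ =>
    (sum_walshFn_mul (φ := φ) hψ (G := G) (mem_cube.1 hx j) (mem_cube.1 hy j)).symm,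
    Fintype.prod_sum fun (j : Fin s) k => walshFn ψ φ k (y j) * walshFn ψ φ (-k) (x j),
    Finset.mul_sum]
  refine Finset.sum_congr rfl fun k _ => ?_
  rw [Finset.prod_mul_distrib, mul_assoc]

lemma integral_prod_sameBlock {N : ℕ} (hN : 0 < N) {x : Fin s → ℝ} (hx : x ∈ cube (Fin s)) :
    ∫ y, ∏ j, sameBlock N (y j) (x j) ∂cubeM (Fin s) = 1 := by
  rw [integral_fintype_prod_eq_prod fun j y => sameBlock N y (x j)]
  refine Finset.prod_eq_one fun j _ => ?_
  obtain ⟨c, hc, h1, h2⟩ := exists_block hN (mem_cube.1 hx j)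
  have := integral_mul_sameBlock hN hc h1 h2 fun _ => 1
  simp only [one_mul] at this
  have hN' : (N : ℂ) ≠ 0 := by exact_mod_cast hN.ne'
  rw [this, intervalIntegral.integral_const, ← sub_div, add_sub_cancel_left, Complex.real_smul]
  push_cast
  field_simp

lemma tendsto_walsh_partial_sum (hψ : ψ.IsPrimitive) (hf : Integrable f (cubeM (Fin s)))
    (hc : ContinuousOn f (cube (Fin s))) {x : Fin s → ℝ} (hx : x ∈ cube (Fin s)) :
    Filter.Tendsto (fun G => ∑ k : Fin s → Fin G → F,
      walshCoef ψ φ f k * ∏ j, walshFn ψ φ (-k j) (x j)) Filter.atTop (nhds (f x : ℂ)) := by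
  rw [Metric.tendsto_atTop]
  intro ε hε
  obtain ⟨η, hη, hη'⟩ := Metric.continuousOn_iff.1 hc x hx (ε / 2) (half_pos hε)
  have hq2 : (1 : ℝ) < Fintype.card F := by exact_mod_cast Fintype.one_lt_card
  obtain ⟨G₀, hG₀⟩ := exists_pow_lt_of_lt_one hη (inv_lt_one_of_one_lt₀ hq2)
  refine ⟨G₀, fun G hG => ?_⟩
  have hN : 0 < Fintype.card F ^ G := pow_pos Fintype.card_pos _
  have hNη : 1 / ((Fintype.card F ^ G : ℕ) : ℝ) < η := by
    refine lt_of_le_of_lt ?_ hG₀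
    push_cast
    rw [inv_pow, one_div]
    exact inv_anti₀ (card_pow_pos _) (pow_le_pow_right₀ hq2.le hG)
  have hB : Integrable (fun y : Fin s → ℝ => ∏ j, sameBlock (Fintype.card F ^ G) (y j) (x j))
      (cubeM (Fin s)) := by
    refine Integrable.of_bound (C := ∏ j : Fin s, ((Fintype.card F ^ G : ℕ) : ℝ)) ?_ ?_
    · exact (Finset.measurable_prod _ fun j _ => measurable_sameBlock _ (measurable_pi_apply j)
        measurable_const).aestronglyMeasurable
    · refine Filter.Eventually.of_forall fun y => ?_
      rw [norm_prod]
      exact Finset.prod_le_prod (fun _ _ => norm_nonneg _) fun j _ => norm_sameBlock_le _ _ _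
  have hBn : ∀ y : Fin s → ℝ, ‖∏ j, sameBlock (Fintype.card F ^ G) (y j) (x j)‖ =
      (∏ j, sameBlock (Fintype.card F ^ G) (y j) (x j)).re := by
    intro y
    have : ∀ j : Fin s, sameBlock (Fintype.card F ^ G) (y j) (x j) =
        ((if ⌊y j * (Fintype.card F ^ G : ℕ)⌋ = ⌊x j * (Fintype.card F ^ G : ℕ)⌋ then
          ((Fintype.card F ^ G : ℕ) : ℝ) else 0 : ℝ) : ℂ) := by
      intro j
      unfold sameBlock
      split_ifs <;> simp
    simp only [this]
    rw [← Complex.ofReal_prod, Complex.norm_real, Complex.ofReal_re, Real.norm_of_nonneg]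
    exact Finset.prod_nonneg fun j _ => by split_ifs <;> positivity
  rw [walsh_partial_sum hψ hf G hx, dist_eq_norm]
  have h1 : (f x : ℂ) = ∫ y, (f x : ℂ) * ∏ j, sameBlock (Fintype.card F ^ G) (y j) (x j)
      ∂cubeM (Fin s) := by
    rw [integral_const_mul, integral_prod_sameBlock hN hx, mul_one]
  have hfB : Integrable (fun y => (f y : ℂ) * ∏ j, sameBlock (Fintype.card F ^ G) (y j) (x j))
      (cubeM (Fin s)) := by
    refine hf.ofReal.mul_bdd (c := ∏ j : Fin s, ((Fintype.card F ^ G : ℕ) : ℝ)) hB.1 ?_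
    refine Filter.Eventually.of_forall fun y => ?_
    rw [norm_prod]
    exact Finset.prod_le_prod (fun _ _ => norm_nonneg _) fun j _ => norm_sameBlock_le _ _ _
  rw [h1, ← integral_sub hfB (hB.const_mul _)]
  refine lt_of_le_of_lt ?_ (half_lt_self hε)
  refine (norm_integral_le_integral_norm _).trans ?_
  calc _ ≤ ∫ y, ε / 2 * (∏ j, sameBlock (Fintype.card F ^ G) (y j) (x j)).re ∂cubeM (Fin s) := by
        refine integral_mono_of_nonneg (Filter.Eventually.of_forall fun _ => norm_nonneg _)
          (hB.re.const_mul _) ?_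
        filter_upwards [ae_mem_cube] with y hy
        rw [← sub_mul, norm_mul, ← hBn]
        by_cases h0 : ∃ j, sameBlock (Fintype.card F ^ G) (y j) (x j) = 0
        · obtain ⟨j, hj⟩ := h0
          rw [Finset.prod_eq_zero (Finset.mem_univ j) hj]
          simp
        · push Not at h0
          refine mul_le_mul_of_nonneg_right ?_ (norm_nonneg _)
          have hd : dist y x < η := by
            rw [dist_pi_lt_iff hη]
            intro j
            rw [Real.dist_eq]
            exact (abs_sub_lt_of_sameBlock_ne_zero hN (h0 j)).trans hNη
          have := hη' y hy hd
          rw [Real.dist_eq] at this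
          rw [← Complex.ofReal_sub, Complex.norm_real, Real.norm_eq_abs]
          exact this.le
    _ = ε / 2 := by
        rw [integral_const_mul]
        have := integral_re (𝕜 := ℂ) hB
        simp only [RCLike.re_to_complex] at this
        rw [this, integral_prod_sameBlock hN hx, Complex.one_re, mul_one]

end WalshSeries

section NetError

variable {F : Type*} [Field F] [Fintype F]

set_option linter.unusedSectionVars false

lemma addChar_sum {ι A : Type*} [AddCommMonoid A] (ψ : AddChar A ℂ) (f : ι → A) (T : Finset ι) :
    ψ (∑ i ∈ T, f i) = ∏ i ∈ T, ψ (f i) := by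
  classical
  induction T using Finset.induction_on with
  | empty => simp
  | insert a T ha ih => rw [Finset.sum_insert ha, Finset.prod_insert ha, AddChar.map_add_eq_mul, ih]

lemma digit_sum_mem (n : ℕ) (d : ℕ → Fin (Fintype.card F)) :
    ∑ i ∈ range n, ((d i : ℕ) : ℝ) / (Fintype.card F : ℝ) ^ (i + 1) ∈ Set.Ico (0 : ℝ) 1 := by
  have hq := card_pos_real (F := F)
  refine ⟨Finset.sum_nonneg fun i _ => by positivity, ?_⟩
  induction n generalizing d with
  | zero => simp
  | succ n ih =>
    have h := ih fun i => d (i + 1)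
    have hd : ((d 0 : ℕ) : ℝ) + 1 ≤ Fintype.card F := by exact_mod_cast (d 0).2
    have he : ∑ i ∈ range n, ((d (i + 1) : ℕ) : ℝ) / (Fintype.card F : ℝ) ^ (i + 1 + 1) =
        (∑ i ∈ range n, ((d (i + 1) : ℕ) : ℝ) / (Fintype.card F : ℝ) ^ (i + 1)) /
          Fintype.card F := by
      rw [Finset.sum_div]
      refine Finset.sum_congr rfl fun i _ => ?_
      rw [pow_succ _ (i + 1), div_div]
    rw [Finset.sum_range_succ', he, zero_add, pow_one, ← add_div, div_lt_one hq]
    linarith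

lemma symb_mul_card (φ : Fin (Fintype.card F) ≃ F) (l : ℕ) (x : ℝ) :
    symb φ (l + 1) x = symb φ l (x * Fintype.card F) := by
  rw [symb, symb]
  have : x * (Fintype.card F : ℝ) ^ (l + 1 + 1) =
      x * Fintype.card F * (Fintype.card F : ℝ) ^ (l + 1) := by ring
  simp only [this]

lemma symb_natCast_add (φ : Fin (Fintype.card F) ≃ F) (l d : ℕ) (x : ℝ) :
    symb φ l (d + x) = symb φ l x := by
  rw [symb_eq_iff, add_mul]
  have : (d : ℝ) * (Fintype.card F : ℝ) ^ (l + 1) =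
      ((((d * Fintype.card F ^ l : ℕ) : ℤ) * (Fintype.card F : ℤ) : ℤ) : ℝ) := by
    push_cast
    ring
  rw [this, Int.floor_intCast_add, add_comm, Int.add_mul_emod_self_right]

lemma symb_digit_sum (φ : Fin (Fintype.card F) ≃ F) (n l : ℕ) (d : ℕ → Fin (Fintype.card F)) :
    symb φ l (∑ i ∈ range n, ((d i : ℕ) : ℝ) / (Fintype.card F : ℝ) ^ (i + 1)) =
      if l < n then φ (d l) else φ ⟨0, Fintype.card_pos⟩ := by
  have hq := card_pos_real (F := F)
  have h0 : ∀ l, symb φ l 0 = φ ⟨0, Fintype.card_pos⟩ := fun l =>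
    symb_eq_of_digit φ ⟨0, Fintype.card_pos⟩ (by simp)
  have hT : ∀ (n : ℕ) (d : ℕ → Fin (Fintype.card F)),
      (∑ i ∈ range (n + 1), ((d i : ℕ) : ℝ) / (Fintype.card F : ℝ) ^ (i + 1)) * Fintype.card F =
        (d 0 : ℕ) + ∑ i ∈ range n, ((d (i + 1) : ℕ) : ℝ) / (Fintype.card F : ℝ) ^ (i + 1) := by
    intro n d
    rw [Finset.sum_range_succ', add_mul, add_comm, Finset.sum_mul]
    congr 1
    · rw [zero_add, pow_one, div_mul_cancel₀ _ hq.ne']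
    · refine Finset.sum_congr rfl fun i _ => ?_
      rw [pow_succ _ (i + 1)]
      field_simp
  induction l generalizing n d with
  | zero =>
    cases n with
    | zero => simp [h0]
    | succ n =>
      rw [if_pos (Nat.succ_pos n)]
      refine symb_eq_of_digit φ _ ?_
      rw [zero_add, pow_one, hT, add_comm, Int.floor_add_natCast,
        Int.floor_eq_zero_iff.2 (digit_sum_mem n fun i => d (i + 1)), zero_add]
      exact Int.emod_eq_of_lt (by positivity) (by exact_mod_cast (d 0).2)
  | succ l ih =>
    cases n with
    | zero => simp [h0]
    | succ n =>
      rw [symb_mul_card, hT, symb_natCast_add, ih n fun i => d (i + 1)]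
      simp

variable {s n m : ℕ}

lemma netPoint_eq (φ : Fin (Fintype.card F) ≃ F) (C : Fin s → Matrix (Fin n) (Fin m) F) (h : ℕ)
    (j : Fin s) : netPoint φ C h j = ∑ l ∈ range n,
      (((if hl : l < n then φ.symm ((C j).mulVec (digitVec φ m h) ⟨l, hl⟩)
        else ⟨0, Fintype.card_pos⟩ : Fin (Fintype.card F)) : ℕ) : ℝ) /
          (Fintype.card F : ℝ) ^ (l + 1) := by
  rw [netPoint, Finset.sum_range]
  exact Finset.sum_congr rfl fun l _ => by simp

lemma netPoint_mem_cube (φ : Fin (Fintype.card F) ≃ F) (C : Fin s → Matrix (Fin n) (Fin m) F)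
    (h : ℕ) : netPoint φ C h ∈ cube (Fin s) := by
  rw [mem_cube]
  intro j
  rw [netPoint_eq]
  exact digit_sum_mem n _

lemma symb_netPoint (φ : Fin (Fintype.card F) ≃ F) (C : Fin s → Matrix (Fin n) (Fin m) F) (h : ℕ)
    (j : Fin s) (l : ℕ) : symb φ l (netPoint φ C h j) =
      if hl : l < n then (C j).mulVec (digitVec φ m h) ⟨l, hl⟩
      else φ ⟨0, Fintype.card_pos⟩ := by
  rw [netPoint_eq, symb_digit_sum]
  split_ifs with hl
  · simp
  · rfl

/-- The combination of the rows of the generating matrices with the digits of `k`. -/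
noncomputable def rowSum (C : Fin s → Matrix (Fin n) (Fin m) F) {G : ℕ} (k : Fin s → Fin G → F) :
    Fin m → F :=
  ∑ j, ∑ l : Fin n, extDigits (k j) l • C j l

lemma sum_digitVec (φ : Fin (Fintype.card F) ≃ F) (m : ℕ) (g : (Fin m → F) → ℂ) :
    ∑ h ∈ range (Fintype.card F ^ m), g (digitVec φ m h) = ∑ z, g z := by
  rw [Finset.sum_range]
  exact Fintype.sum_equiv (finFunctionFinEquiv.symm.trans (Equiv.arrowCongr (Equiv.refl _) φ)) _ _
    fun a => rfl

lemma sum_char_dotProduct {ψ : AddChar F ℂ} (hψ : ψ.IsPrimitive) {r : Fin m → F} (hr : r ≠ 0) :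
    ∑ z : Fin m → F, ψ (-(∑ b, z b * r b)) = 0 := by
  classical
  have h1 : ∀ z : Fin m → F, ψ (-(∑ b, z b * r b)) = ∏ b, ψ (z b * (-r b)) := by
    intro z
    rw [← addChar_sum]
    congr 1
    rw [← Finset.sum_neg_distrib]
    exact Finset.sum_congr rfl fun b _ => by ring
  simp only [h1]
  rw [← Fintype.prod_sum fun (b : Fin m) c => ψ (c * (-r b))]
  obtain ⟨b, hb⟩ := Function.ne_iff.1 hr
  refine Finset.prod_eq_zero (Finset.mem_univ b) ?_
  rw [AddChar.sum_mulShift _ hψ, if_neg (neg_ne_zero.2 hb)]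
  simp

lemma sum_walsh_netPoint {ψ : AddChar F ℂ} (hψ : ψ.IsPrimitive) (φ : Fin (Fintype.card F) ≃ F)
    (C : Fin s → Matrix (Fin n) (Fin m) F) {G : ℕ} (hG : n ≤ G) {k : Fin s → Fin G → F}
    (hk : rowSum C k ≠ 0) :
    ∑ h ∈ range (Fintype.card F ^ m), ∏ j, walshFn ψ φ (-k j) (netPoint φ C h j) = 0 := by
  set y₀ : F := φ ⟨0, Fintype.card_pos⟩
  set c : F := ∑ j, ∑ l : Fin G, if (l : ℕ) < n then 0 else y₀ * k j l with hc
  have h1 : ∀ h, ∏ j, walshFn ψ φ (-k j) (netPoint φ C h j) =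
      ψ (-c) * ψ (-(∑ b, digitVec φ m h b * rowSum C k b)) := by
    intro h
    rw [← AddChar.map_add_eq_mul]
    simp only [walshFn_eq]
    rw [Finset.prod_congr rfl fun j _ => (addChar_sum ψ _ _).symm,
      ← addChar_sum]
    congr 1
    have h2 : ∀ j, ∑ l : Fin G, symb φ l (netPoint φ C h j) * (-k j) l =
        -(∑ l : Fin G, if (l : ℕ) < n then 0 else y₀ * k j l) -
          ∑ l : Fin n, (C j).mulVec (digitVec φ m h) l * extDigits (k j) l := by
      intro j
      have h3 : ∑ l : Fin n, (C j).mulVec (digitVec φ m h) l * extDigits (k j) l =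
          ∑ l : Fin G, if hl : (l : ℕ) < n then (C j).mulVec (digitVec φ m h) ⟨l, hl⟩ * k j l
            else 0 := by
        obtain ⟨e, rfl⟩ := Nat.exists_eq_add_of_le hG
        rw [Fin.sum_univ_add]
        simp [extDigits, Nat.lt_add_right]
        rfl
      rw [h3, ← Finset.sum_neg_distrib, ← Finset.sum_sub_distrib]
      refine Finset.sum_congr rfl fun l _ => ?_
      rw [symb_netPoint, Pi.neg_apply]
      split_ifs <;> ring
    rw [Finset.sum_congr rfl fun j _ => h2 j, Finset.sum_sub_distrib, Finset.sum_neg_distrib,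
      sub_eq_add_neg]
    congr 2
    have h4 : ∀ b, rowSum C k b = ∑ j, ∑ l : Fin n, extDigits (k j) l * C j l b := by
      intro b
      simp [rowSum, Finset.sum_apply]
    simp only [h4, Finset.mul_sum]
    rw [eq_comm, Finset.sum_comm]
    refine Finset.sum_congr rfl fun j _ => ?_
    rw [Finset.sum_comm]
    refine Finset.sum_congr rfl fun l _ => ?_
    rw [eq_comm]
    rw [Matrix.mulVec, dotProduct, Finset.sum_mul]
    exact Finset.sum_congr rfl fun b _ => by ring
  simp only [h1]
  rw [← Finset.mul_sum, sum_digitVec φ m fun z => ψ (-(∑ b, z b * rowSum C k b)),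
    sum_char_dotProduct hψ hk, mul_zero]

variable {f : (Fin s → ℝ) → ℝ}

open Classical in
/-- The nonzero elements of the dual of a digital net with at most `G` digits. -/
noncomputable def dualSet (C : Fin s → Matrix (Fin n) (Fin m) F) (G : ℕ) :
    Finset (Fin s → Fin G → F) :=
  univ.filter fun k => k ≠ 0 ∧ rowSum C k = 0

lemma norm_integral_sub_le {ψ : AddChar F ℂ} (hψ : ψ.IsPrimitive) (φ : Fin (Fintype.card F) ≃ F)
    (C : Fin s → Matrix (Fin n) (Fin m) F) (f : (Fin s → ℝ) → ℝ) {G : ℕ} (hG : n ≤ G) :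
    ‖((∫ x, f x ∂cubeM (Fin s) : ℝ) : ℂ) - (∑ h ∈ range (Fintype.card F ^ m),
      ∑ k : Fin s → Fin G → F, walshCoef ψ φ f k * ∏ j, walshFn ψ φ (-k j) (netPoint φ C h j)) /
        (Fintype.card F : ℂ) ^ m‖ ≤ ∑ k ∈ dualSet C G, ‖walshCoef ψ φ f k‖ := by
  classical
  have hq : (Fintype.card F : ℂ) ^ m ≠ 0 := pow_ne_zero _ (by exact_mod_cast Fintype.card_ne_zero)
  set b : (Fin s → Fin G → F) → ℂ := fun k =>
    (∑ h ∈ range (Fintype.card F ^ m), ∏ j, walshFn ψ φ (-k j) (netPoint φ C h j)) /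
      (Fintype.card F : ℂ) ^ m with hb
  have hb1 : ∀ k, ‖b k‖ ≤ 1 := by
    intro k
    simp only [hb]
    rw [norm_div, norm_pow, Complex.norm_natCast, div_le_one (card_pow_pos m)]
    refine (norm_sum_le _ _).trans ?_
    have : ∀ h, ‖∏ j, walshFn ψ φ (-k j) (netPoint φ C h j)‖ = 1 := fun h => by
      rw [norm_prod]
      exact Finset.prod_eq_one fun j _ => norm_walsh ψ φ _ _ _
    simp [this]
  have hb0 : b 0 = 1 := by
    simp only [hb, Pi.zero_apply, neg_zero]
    have : ∀ x, walshFn ψ φ (0 : Fin G → F) x = 1 := fun x => by simp [walshFn_eq]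
    simp only [this, Finset.prod_const_one, Finset.sum_const, Finset.card_range, nsmul_eq_mul,
      mul_one]
    push_cast
    exact div_self hq
  have hc0 : walshCoef ψ φ f (0 : Fin s → Fin G → F) = ((∫ x, f x ∂cubeM (Fin s) : ℝ) : ℂ) := by
    unfold walshCoef
    have : ∀ x, walshFn ψ φ (0 : Fin G → F) x = 1 := fun x => by simp [walshFn_eq]
    simp only [Pi.zero_apply, this, Finset.prod_const_one, mul_one]
    rw [integral_complex_ofReal]
  have h1 : (∑ h ∈ range (Fintype.card F ^ m),
      ∑ k : Fin s → Fin G → F, walshCoef ψ φ f k * ∏ j, walshFn ψ φ (-k j) (netPoint φ C h j)) /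
        (Fintype.card F : ℂ) ^ m = ∑ k, walshCoef ψ φ f k * b k := by
    rw [Finset.sum_comm, Finset.sum_div]
    refine Finset.sum_congr rfl fun k _ => ?_
    rw [← Finset.mul_sum, mul_div_assoc]
  rw [h1, ← Finset.add_sum_erase univ _ (Finset.mem_univ (0 : Fin s → Fin G → F)), hb0, hc0, mul_one,
    sub_add_cancel_left, norm_neg]
  have h2 : ∑ k ∈ univ.erase (0 : Fin s → Fin G → F), walshCoef ψ φ f k * b k =
      ∑ k ∈ dualSet C G, walshCoef ψ φ f k * b k := by
    symm
    refine Finset.sum_subset (fun k hk => ?_) fun k hk hk' => ?_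
    · have := (Finset.mem_filter.1 hk).2.1
      exact Finset.mem_erase.2 ⟨this, Finset.mem_univ k⟩
    · have hr : rowSum C k ≠ 0 := fun h =>
        hk' (Finset.mem_filter.2 ⟨Finset.mem_univ _, Finset.ne_of_mem_erase hk, h⟩)
      simp only [hb]
      rw [sum_walsh_netPoint hψ φ C hG hr, zero_div, mul_zero]
  rw [h2]
  refine (norm_sum_le _ _).trans (Finset.sum_le_sum fun k _ => ?_)
  rw [norm_mul]
  exact mul_le_of_le_one_right (norm_nonneg _) (hb1 k)

/-- The integration error is bounded by the sum of the Walsh coefficients over the dual net. -/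
lemma abs_integrationError_le {ψ : AddChar F ℂ} (hψ : ψ.IsPrimitive) (φ : Fin (Fintype.card F) ≃ F)
    (C : Fin s → Matrix (Fin n) (Fin m) F) (hf : Integrable f (cubeM (Fin s)))
    (hc : ContinuousOn f (cube (Fin s))) {B : ℝ}
    (hB : ∀ G, n ≤ G → ∑ k ∈ dualSet C G, ‖walshCoef ψ φ f k‖ ≤ B) :
    |integrationError φ C f| ≤ B := by
  have h1 : Filter.Tendsto (fun G => ((∫ x, f x ∂cubeM (Fin s) : ℝ) : ℂ) -
      (∑ h ∈ range (Fintype.card F ^ m), ∑ k : Fin s → Fin G → F,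
        walshCoef ψ φ f k * ∏ j, walshFn ψ φ (-k j) (netPoint φ C h j)) /
        (Fintype.card F : ℂ) ^ m) Filter.atTop (nhds (integrationError φ C f : ℂ)) := by
    have h2 := (tendsto_const_nhds (x := ((∫ x, f x ∂cubeM (Fin s) : ℝ) : ℂ))).sub
      ((tendsto_finsetSum (range (Fintype.card F ^ m)) fun h _ =>
        tendsto_walsh_partial_sum (φ := φ) hψ hf hc (netPoint_mem_cube φ C h)).div_const
          ((Fintype.card F : ℂ) ^ m))
    convert! h2 using 2
    unfold integrationError
    rw [restrict_cube]
    push_cast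
    rfl
  have h3 := le_of_tendsto h1.norm (Filter.eventually_atTop.2
    ⟨n, fun G hG => (norm_integral_sub_le hψ φ C f hG).trans (hB G hG)⟩)
  rwa [Complex.norm_real, Real.norm_eq_abs] at h3

end NetError

/-! ### Counting the dual net -/

lemma card_piAntidiag_le {ι : Type*} [DecidableEq ι] {T : Finset ι} (hT : T.Nonempty) (N : ℕ) :
    (T.piAntidiag N : Finset (ι → ℕ)).card ≤ (N + 1) ^ (T.card - 1) := by
  obtain ⟨i₀, hi₀⟩ := hT
  have hle : ∀ f ∈ (T.piAntidiag N : Finset (ι → ℕ)), ∀ i ∈ T, f i ≤ N := by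
    intro f hf i hi
    rw [← (mem_piAntidiag.1 hf).1]
    exact Finset.single_le_sum (fun _ _ => Nat.zero_le _) hi
  have h1 : (Fintype.piFinset fun _ : (T.erase i₀ : Finset ι) => range (N + 1)).card =
      (N + 1) ^ (T.card - 1) := by
    simp [Fintype.card_piFinset, Finset.card_erase_of_mem hi₀]
  rw [← h1]
  refine Finset.card_le_card_of_injOn (fun f i => f i) ?_ ?_
  · intro f hf
    rw [Finset.mem_coe, Fintype.mem_piFinset]
    intro i
    exact Finset.mem_range.2 (Nat.lt_succ_of_le (hle f hf i (Finset.mem_of_mem_erase i.2)))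
  · intro f hf g hg h
    have hf' := mem_piAntidiag.1 (Finset.mem_coe.1 hf)
    have hg' := mem_piAntidiag.1 (Finset.mem_coe.1 hg)
    have he : ∀ i ∈ T.erase i₀, f i = g i := fun i hi => congrFun h ⟨i, hi⟩
    have h0 : f i₀ = g i₀ := by
      have h2 := hf'.1.trans hg'.1.symm
      rw [← Finset.add_sum_erase T f hi₀, ← Finset.add_sum_erase T g hi₀,
        Finset.sum_congr rfl he] at h2
      exact Nat.add_right_cancel h2
    funext i
    by_cases hi : i ∈ T
    · by_cases hi' : i = i₀
      · rw [hi', h0]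
      · exact he i (Finset.mem_erase.2 ⟨hi', hi⟩)
    · rw [not_imp_comm.1 (hf'.2 i) hi, not_imp_comm.1 (hg'.2 i) hi]

lemma exists_le_sum_eq {ι : Type*} (T : Finset ι) (a : ι → ℕ) (N : ℕ) (hN : N ≤ ∑ i ∈ T, a i) :
    ∃ c : ι → ℕ, (∀ i, c i ≤ a i) ∧ ∑ i ∈ T, c i = N := by
  classical
  induction T using Finset.induction_on generalizing N with
  | empty => exact ⟨fun _ => 0, fun _ => Nat.zero_le _, by simpa using hN.antisymm' (Nat.zero_le _)⟩
  | insert i T hi ih =>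
    rw [Finset.sum_insert hi] at hN
    obtain ⟨c, hc, hs⟩ := ih (N - min N (a i)) (by omega)
    refine ⟨Function.update c i (min N (a i)), fun j => ?_, ?_⟩
    · rcases eq_or_ne j i with rfl | hj
      · simp
      · simpa [hj] using hc j
    · rw [Finset.sum_insert hi, Function.update_self,
        Finset.sum_congr rfl fun j hj => Function.update_of_ne (ne_of_mem_of_not_mem hj hi) _ c, hs]
      omega

section Fiber

variable {F : Type*} [Field F] [Fintype F] {s n m : ℕ}

omit [Fintype F] in
@[simp] lemma extDigits_sub {G : ℕ} (k k' : Fin G → F) (l : ℕ) :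
    extDigits (k - k') l = extDigits k l - extDigits k' l := by
  unfold extDigits
  split_ifs <;> simp

omit [Fintype F] in
lemma rowSum_sub (C : Fin s → Matrix (Fin n) (Fin m) F) {G : ℕ} (k k' : Fin s → Fin G → F) :
    rowSum C (k - k') = rowSum C k - rowSum C k' := by
  simp only [rowSum, Pi.sub_apply, extDigits_sub, sub_smul, Finset.sum_sub_distrib]

/-- The elements of the dual of a net are determined up to few choices by the positions of their
leading digits. -/
lemma card_filter_top_le (C : Fin s → Matrix (Fin n) (Fin m) F) {G L δ : ℕ}
    (hL : ∀ k ∈ dualSet C G, L < ∑ j, lead (digitSupp (k j)))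
    (a : Fin s → ℕ → ℕ) (X : Finset (Fin s → Fin G → F))
    (hX : ∀ k ∈ X, rowSum C k = 0 ∧ ∀ j, ∀ i ≤ δ, top (digitSupp (k j)) i = a j i) :
    X.card ≤ Fintype.card F ^ (s * (δ + 1)) * Fintype.card F ^ (∑ j, a j δ - L) := by
  classical
  obtain ⟨c, hc, hcs⟩ := exists_le_sum_eq univ (fun j => a j δ) (min L (∑ j, a j δ))
    (min_le_right _ _)
  have hcard : Fintype.card ((Fin s × Fin (δ + 1) → F) × (((j : Fin s) × Fin (a j δ - c j)) → F)) =
      Fintype.card F ^ (s * (δ + 1)) * Fintype.card F ^ (∑ j, a j δ - L) := by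
    rw [Fintype.card_prod, Fintype.card_fun, Fintype.card_fun, Fintype.card_prod, Fintype.card_sigma]
    simp only [Fintype.card_fin]
    congr 2
    have : ∑ j, (a j δ - c j) + ∑ j, c j = ∑ j, a j δ := by
      rw [← Finset.sum_add_distrib]
      exact Finset.sum_congr rfl fun j _ => Nat.sub_add_cancel (hc j)
    omega
  rw [← hcard, ← Finset.card_univ]
  refine Finset.card_le_card_of_injOn
    (fun k => (fun x => extDigits (k x.1) (a x.1 x.2 - 1), fun x => extDigits (k x.1) (c x.1 + x.2)))
    (fun _ _ => Finset.mem_coe.2 (Finset.mem_univ _)) ?_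
  intro k hk k' hk' h
  obtain ⟨h1, h2⟩ := Prod.mk.inj h
  obtain ⟨hr, ht⟩ := hX k hk
  obtain ⟨hr', ht'⟩ := hX k' hk'
  by_contra hne
  have hmem : k - k' ∈ dualSet C G := Finset.mem_filter.2
    ⟨Finset.mem_univ _, sub_ne_zero.2 hne, by rw [rowSum_sub, hr, hr', sub_self]⟩
  have hlead : ∀ j, lead (digitSupp ((k - k') j)) ≤ c j := by
    intro j
    rw [lead_le]
    intro l hl
    rw [mem_digitSupp, Pi.sub_apply, extDigits_sub] at hl
    by_contra hlc
    rw [not_lt] at hlc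
    refine hl (sub_eq_zero.2 ?_)
    rcases lt_or_ge l (a j δ) with hla | hla
    · have := congrFun h2 ⟨j, ⟨l - c j, by omega⟩⟩
      simpa [Nat.add_sub_cancel' hlc] using this
    · have htop : ∀ k₁ k₂ : Fin s → Fin G → F, k₁ ∈ X → k₂ ∈ X → l ∈ digitSupp (k₁ j) →
          ∃ i : Fin (δ + 1), a j i - 1 = l := by
        intro k₁ k₂ hk₁ hk₂ hl₁
        have e := (hX k₁ hk₁).2 j
        rcases mem_top_or_lt hl₁ δ with ⟨i, hi, ei⟩ | h'
        · exact ⟨⟨i, by omega⟩, by rw [← e i hi, ei]; rfl⟩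
        · rw [e δ le_rfl] at h'
          omega
      have hex : ∃ i : Fin (δ + 1), a j i - 1 = l := by
        by_cases h0 : l ∈ digitSupp (k j)
        · exact htop k k' hk hk' h0
        · by_cases h0' : l ∈ digitSupp (k' j)
          · exact htop k' k hk' hk h0'
          · rw [mem_digitSupp, not_not] at h0 h0'
            exact absurd (by rw [h0, h0', sub_self]) hl
      obtain ⟨i, rfl⟩ := hex
      exact congrFun h1 (j, i)
  have h3 := hL _ hmem
  have h4 : ∑ j, lead (digitSupp ((k - k') j)) ≤ ∑ j, c j := Finset.sum_le_sum fun j _ => hlead j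
  omega

lemma card_filter_grade_le (C : Fin s → Matrix (Fin n) (Fin m) F) {G L δ : ℕ} (hδ : 1 ≤ δ)
    (hL : ∀ k ∈ dualSet C G, L < ∑ j, lead (digitSupp (k j)))
    {v : Finset (Fin s)} (hv : v.Nonempty) (A B : ℕ) (X : Finset (Fin s → Fin G → F))
    (hX : ∀ k ∈ X, rowSum C k = 0 ∧ (∀ j ∉ v, k j = 0) ∧
      ∑ j ∈ v, ∑ i ∈ range δ, (top (digitSupp (k j)) i - top (digitSupp (k j)) δ) = A ∧
      ∑ j ∈ v, top (digitSupp (k j)) δ = B) :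
    X.card ≤ (A + 1) ^ (v.card * δ - 1) * (B + 1) ^ (v.card - 1) *
      (Fintype.card F ^ (s * (δ + 1)) * Fintype.card F ^ (B - L)) := by
  classical
  have hw : (v ×ˢ range δ).Nonempty := hv.product (Finset.nonempty_range_iff.2 (by omega))
  set P := ((v ×ˢ range δ).piAntidiag A : Finset (Fin s × ℕ → ℕ)) ×ˢ
    (v.piAntidiag B : Finset (Fin s → ℕ)) with hP
  have hPc : P.card ≤ (A + 1) ^ (v.card * δ - 1) * (B + 1) ^ (v.card - 1) := by
    rw [hP, Finset.card_product]
    have h1 := card_piAntidiag_le hw A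
    rw [Finset.card_product, Finset.card_range] at h1
    exact Nat.mul_le_mul h1 (card_piAntidiag_le hv B)
  refine le_trans ?_ (Nat.mul_le_mul_right _ hPc)
  rw [mul_comm]
  let g : (Fin s → Fin G → F) → (Fin s × ℕ → ℕ) × (Fin s → ℕ) := fun k =>
    (fun x => if x ∈ v ×ˢ range δ then
      top (digitSupp (k x.1)) x.2 - top (digitSupp (k x.1)) δ else 0,
      fun j => if j ∈ v then top (digitSupp (k j)) δ else 0)
  refine Finset.card_le_mul_card_image_of_maps_to (f := g) ?_ _ ?_
  · intro k hk
    obtain ⟨-, -, hA, hB⟩ := hX k hk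
    simp only [hP, Finset.mem_product, mem_piAntidiag, g]
    refine ⟨⟨?_, fun i => ?_⟩, ?_, fun i => ?_⟩
    · rw [Finset.sum_congr rfl fun x hx => if_pos (Finset.mem_product.1 hx), Finset.sum_product]
      exact hA
    · simp +contextual
    · rw [Finset.sum_congr rfl fun x hx => if_pos hx]
      exact hB
    · simp +contextual
  · rintro ⟨e, b⟩ heb
    have hb := mem_piAntidiag.1 (Finset.mem_product.1 heb).2
    have hbs : ∑ j, b j = B := by
      rw [← hb.1]
      exact (Finset.sum_subset (Finset.subset_univ v) fun j _ hj =>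
        not_imp_comm.1 (hb.2 j) hj).symm
    rw [← hbs]
    have := card_filter_top_le C hL (δ := δ) (fun j i => if i < δ then e (j, i) + b j else b j)
      (X.filter fun k => g k = (e, b)) ?_
    · simpa using this
    · intro k hk
      obtain ⟨hk, hg⟩ := Finset.mem_filter.1 hk
      obtain ⟨hr, h0, -, -⟩ := hX k hk
      refine ⟨hr, fun j i hi => ?_⟩
      obtain ⟨he, hb'⟩ := Prod.mk.inj hg
      have he := congrFun he (j, i)
      have hb' := congrFun hb' j
      have hanti := top_antitone (digitSupp (k j)) hi
      by_cases hj : j ∈ v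
      · simp only [Finset.mem_product, hj, true_and, Finset.mem_range, if_true] at he hb'
        rcases hi.eq_or_lt with rfl | hi'
        · simp [hb']
        · simp only [hi', if_true] at he ⊢
          omega
      · have hS : digitSupp (k j) = ∅ := by
          rw [← Finset.not_nonempty_iff_eq_empty, digitSupp_nonempty, not_not]
          exact h0 j hj
        simp only [Finset.mem_product, hj, false_and, if_false] at he hb'
        rw [hS, top_empty, ← he, ← hb']
        simp

end Fiber

/-! ### Sums over the dual net -/

lemma sum_pow_mul_geometric_le (p M : ℕ) {x : ℝ} (h0 : 0 ≤ x) (h1 : x < 1) :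
    ∑ n ∈ range M, ((n : ℝ) + 1) ^ p * x ^ n ≤ (p.factorial : ℝ) / (1 - x) ^ (p + 1) := by
  have hs := hasSum_choose_mul_geometric_of_norm_lt_one p (r := x)
    (by rwa [Real.norm_eq_abs, abs_of_nonneg h0])
  have h2 := sum_le_hasSum (range M) (fun n _ => by positivity) hs
  have h3 : ∀ n : ℕ, ((n : ℝ) + 1) ^ p ≤ p.factorial * ((n + p).choose p : ℝ) := by
    intro n
    have := Nat.pow_succ_le_ascFactorial (n + 1) p
    rw [Nat.ascFactorial_eq_factorial_mul_choose] at this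
    exact_mod_cast this
  calc ∑ n ∈ range M, ((n : ℝ) + 1) ^ p * x ^ n
      ≤ ∑ n ∈ range M, p.factorial * (((n + p).choose p : ℝ) * x ^ n) :=
        Finset.sum_le_sum fun n _ => by
          rw [← mul_assoc]
          exact mul_le_mul_of_nonneg_right (h3 n) (pow_nonneg h0 n)
    _ ≤ p.factorial * (1 / (1 - x) ^ (p + 1)) := by
        rw [← Finset.mul_sum]
        exact mul_le_mul_of_nonneg_left h2 (Nat.cast_nonneg _)
    _ = _ := by ring

lemma sum_pow_mul_geometric_tail_le (p M N : ℕ) {x : ℝ} (h0 : 0 ≤ x) (h1 : x < 1) :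
    ∑ n ∈ (range M).filter (N ≤ ·), ((n : ℝ) + 1) ^ p * x ^ n ≤
      ((N : ℝ) + 1) ^ p * x ^ N * ((p.factorial : ℝ) / (1 - x) ^ (p + 1)) := by
  have h2 : ∑ n ∈ (range M).filter (N ≤ ·), ((n : ℝ) + 1) ^ p * x ^ n ≤
      ∑ n ∈ range M, (((N + n : ℕ) : ℝ) + 1) ^ p * x ^ (N + n) := by
    rw [← Finset.sum_image (s := range M) (g := fun n => N + n)
      (f := fun n : ℕ => ((n : ℝ) + 1) ^ p * x ^ n) fun a _ b _ h => Nat.add_left_cancel h]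
    refine Finset.sum_le_sum_of_subset_of_nonneg (fun n hn => ?_) fun n _ _ => by positivity
    obtain ⟨hn, hN⟩ := Finset.mem_filter.1 hn
    rw [Finset.mem_range] at hn
    exact Finset.mem_image.2 ⟨n - N, Finset.mem_range.2 (by omega), by omega⟩
  refine h2.trans ?_
  calc ∑ n ∈ range M, (((N + n : ℕ) : ℝ) + 1) ^ p * x ^ (N + n)
      ≤ ∑ n ∈ range M, ((N : ℝ) + 1) ^ p * x ^ N * (((n : ℝ) + 1) ^ p * x ^ n) := by
        refine Finset.sum_le_sum fun n _ => ?_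
        have : ((N + n : ℕ) : ℝ) + 1 ≤ ((N : ℝ) + 1) * ((n : ℝ) + 1) := by
          push_cast
          nlinarith [mul_nonneg (Nat.cast_nonneg (α := ℝ) N) (Nat.cast_nonneg (α := ℝ) n)]
        calc (((N + n : ℕ) : ℝ) + 1) ^ p * x ^ (N + n)
            ≤ (((N : ℝ) + 1) * ((n : ℝ) + 1)) ^ p * x ^ (N + n) :=
              mul_le_mul_of_nonneg_right (pow_le_pow_left₀ (by positivity) this _)
                (pow_nonneg h0 _)
          _ = _ := by rw [mul_pow, pow_add]; ring
    _ ≤ _ := by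
        rw [← Finset.mul_sum]
        exact mul_le_mul_of_nonneg_left (sum_pow_mul_geometric_le p M h0 h1) (by positivity)

/-- The constant in the bound for sums over a dual net. -/
noncomputable def dualConst (Q s δ c₀ : ℕ) : ℝ :=
  (Q : ℝ) ^ (s * (δ + 1)) * ((Q : ℝ) ^ c₀ * ((δ : ℝ) + 1) ^ (s * δ) * (s * δ).factorial *
    2 ^ (s * δ) * s.factorial)

lemma dualConst_pos {Q : ℕ} (hQ : 0 < Q) (s δ c₀ : ℕ) : 0 < dualConst Q s δ c₀ := by
  unfold dualConst
  have : (0 : ℝ) < Q := by exact_mod_cast hQ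
  have := Nat.factorial_pos (s * δ)
  have := Nat.factorial_pos s
  positivity

lemma grade_sum_le {Q s δ c₀ κ L : ℕ} (hQ : 2 ≤ Q) (hδ : 1 ≤ δ) (hκ : 1 ≤ κ) (hκs : κ ≤ s)
    {y : ℝ} (hy0 : 0 < y) (hy1 : y < 1) (M : ℕ) :
    ∑ B ∈ range M, ∑ A ∈ (range M).filter (fun A => (δ + 1) * L ≤ A + (δ + 1) * B + c₀),
      ((A : ℝ) + 1) ^ (κ * δ - 1) * ((B : ℝ) + 1) ^ (κ - 1) *
        ((Q : ℝ) ^ (s * (δ + 1)) * (Q : ℝ) ^ (B - L)) *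
          (((Q : ℝ)⁻¹) ^ A * (((Q : ℝ)⁻¹) ^ δ * y) ^ B) ≤
      dualConst Q s δ c₀ * (((Q : ℝ)⁻¹) ^ δ * y) ^ L * ((L : ℝ) + 1) ^ (κ - 1) *
        (∑ b ∈ range (L + 1), ((b : ℝ) + 1) ^ (κ * δ - 1) * ((Q : ℝ)⁻¹ / y) ^ b +
          ((1 - ((Q : ℝ)⁻¹) ^ (δ - 1) * y) ^ κ)⁻¹) := by
  have hQ0 : (0 : ℝ) < Q := by exact_mod_cast (by omega : 0 < Q)
  set x : ℝ := (Q : ℝ)⁻¹ with hx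
  have hx0 : 0 < x := inv_pos.2 hQ0
  have hx2 : x ≤ 1 / 2 := by
    rw [hx, inv_le_comm₀ hQ0 (by norm_num)]
    norm_num
    exact_mod_cast hQ
  have hQx : (Q : ℝ) * x = 1 := mul_inv_cancel₀ hQ0.ne'
  set z : ℝ := x ^ δ * y with hz
  have hz0 : 0 < z := by positivity
  set w : ℝ := x ^ (δ - 1) * y with hw
  have hw0 : 0 < w := by positivity
  have hw1 : w < 1 := (mul_le_of_le_one_left hy0.le
    (pow_le_one₀ hx0.le (by linarith))).trans_lt hy1
  have hzw : z = x * w := by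
    rw [hz, hw, ← mul_assoc, ← pow_succ', Nat.sub_add_cancel hδ]
  set p := κ * δ - 1 with hp
  have hκδ : κ * δ ≤ s * δ := Nat.mul_le_mul_right _ hκs
  have hps : p ≤ s * δ := by omega
  set U : ℝ := (p.factorial : ℝ) * 2 ^ (p + 1) with hU
  have htail : ∀ N, ∑ A ∈ (range M).filter (N ≤ ·), ((A : ℝ) + 1) ^ p * x ^ A ≤
      ((N : ℝ) + 1) ^ p * x ^ N * U := by
    intro N
    refine (sum_pow_mul_geometric_tail_le p M N hx0.le (by linarith)).trans ?_
    refine mul_le_mul_of_nonneg_left ?_ (by positivity)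
    rw [hU, div_eq_mul_inv]
    refine mul_le_mul_of_nonneg_left ?_ (Nat.cast_nonneg _)
    rw [← inv_pow]
    refine pow_le_pow_left₀ (inv_nonneg.2 (by linarith)) ?_ _
    rw [inv_le_comm₀ (by linarith) (by norm_num)]
    linarith
  set E : ℝ := (Q : ℝ) ^ (s * (δ + 1)) with hE
  have hE0 : 0 < E := by positivity
  set inner : ℕ → ℝ := fun B => ∑ A ∈ (range M).filter
    (fun A => (δ + 1) * L ≤ A + (δ + 1) * B + c₀), ((A : ℝ) + 1) ^ p * x ^ A with hinner
  have hI0 : ∀ B, 0 ≤ inner B := fun B => Finset.sum_nonneg fun A _ => by positivity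
  have h1 : ∀ B, ∑ A ∈ (range M).filter (fun A => (δ + 1) * L ≤ A + (δ + 1) * B + c₀),
      ((A : ℝ) + 1) ^ p * ((B : ℝ) + 1) ^ (κ - 1) * (E * (Q : ℝ) ^ (B - L)) * (x ^ A * z ^ B) =
      E * (((B : ℝ) + 1) ^ (κ - 1) * ((Q : ℝ) ^ (B - L) * z ^ B)) * inner B := by
    intro B
    rw [hinner, Finset.mul_sum]
    exact Finset.sum_congr rfl fun A _ => by ring
  rw [Finset.sum_congr rfl fun B _ => h1 B]
  set R : ℝ := (Q : ℝ) ^ c₀ * ((δ : ℝ) + 1) ^ (s * δ) * (s * δ).factorial * 2 ^ (s * δ) *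
    s.factorial with hR
  have hδ1 : (1 : ℝ) ≤ (δ : ℝ) + 1 := by linarith [Nat.cast_nonneg (α := ℝ) δ]
  have hUle : U ≤ (s * δ).factorial * 2 ^ (s * δ) := by
    rw [hU]
    refine mul_le_mul (by exact_mod_cast Nat.factorial_le hps)
      (pow_le_pow_right₀ (by norm_num) ?_) (by positivity) (by positivity)
    have : 0 < κ * δ := Nat.mul_pos hκ hδ
    omega
  have hs1 : (1 : ℝ) ≤ s.factorial := by exact_mod_cast Nat.factorial_pos s
  have hQ1 : (1 : ℝ) ≤ (Q : ℝ) ^ c₀ := one_le_pow₀ (by exact_mod_cast (by omega : 1 ≤ Q))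
  have hF0 : (0 : ℝ) < (s * δ).factorial := by exact_mod_cast Nat.factorial_pos _
  have hlow : ∑ B ∈ (range M).filter (· < L),
      E * (((B : ℝ) + 1) ^ (κ - 1) * ((Q : ℝ) ^ (B - L) * z ^ B)) * inner B ≤
      E * R * z ^ L * ((L : ℝ) + 1) ^ (κ - 1) *
        ∑ b ∈ range (L + 1), ((b : ℝ) + 1) ^ p * (x / y) ^ b := by
    have hterm : ∀ B ∈ (range M).filter (· < L),
        E * (((B : ℝ) + 1) ^ (κ - 1) * ((Q : ℝ) ^ (B - L) * z ^ B)) * inner B ≤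
        E * R * z ^ L * ((L : ℝ) + 1) ^ (κ - 1) *
          ((((L - B : ℕ) : ℝ) + 1) ^ p * (x / y) ^ (L - B)) := by
      intro B hB
      have hBL := (Finset.mem_filter.1 hB).2
      obtain ⟨b, rfl⟩ := Nat.exists_eq_add_of_lt hBL
      have e1 : B + b + 1 - B = b + 1 := by omega
      have e2 : B - (B + b + 1) = 0 := by omega
      rw [e1, e2, pow_zero, one_mul]
      have hin : inner B ≤ ((Q : ℝ) ^ c₀ * x ^ ((δ + 1) * (b + 1))) *
          (((δ : ℝ) + 1) ^ (s * δ) * (((b + 1 : ℕ) : ℝ) + 1) ^ p) * U := by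
        have h3 := htail ((δ + 1) * (b + 1) - c₀)
        have h4 : (range M).filter (fun A => (δ + 1) * (B + b + 1) ≤ A + (δ + 1) * B + c₀) =
            (range M).filter ((δ + 1) * (b + 1) - c₀ ≤ ·) := by
          refine Finset.filter_congr fun A _ => ?_
          have : (δ + 1) * (B + b + 1) = (δ + 1) * B + (δ + 1) * (b + 1) := by ring
          omega
        rw [hinner]
        simp only
        rw [h4]
        refine h3.trans (mul_le_mul_of_nonneg_right ?_ (by positivity))
        rw [mul_comm]
        refine mul_le_mul ?_ ?_ (by positivity) (by positivity)
        · have h5 : x ^ ((δ + 1) * (b + 1) - c₀) = (Q : ℝ) ^ c₀ *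
              x ^ ((δ + 1) * (b + 1) - c₀ + c₀) := by
            rw [pow_add, mul_comm ((Q : ℝ) ^ c₀), mul_assoc, ← mul_pow, mul_comm x, hQx, one_pow,
              mul_one]
          rw [h5]
          exact mul_le_mul_of_nonneg_left
            (pow_le_pow_of_le_one hx0.le (by linarith) (by omega)) (by positivity)
        · have h6 : (((δ + 1) * (b + 1) - c₀ : ℕ) : ℝ) + 1 ≤
              ((δ : ℝ) + 1) * (((b + 1 : ℕ) : ℝ) + 1) := by
            have : (((δ + 1) * (b + 1) - c₀ : ℕ) : ℝ) ≤ (((δ + 1) * (b + 1) : ℕ) : ℝ) := by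
              exact_mod_cast Nat.sub_le _ _
            push_cast at this ⊢
            nlinarith
          refine (pow_le_pow_left₀ (by positivity) h6 _).trans ?_
          rw [mul_pow]
          exact mul_le_mul_of_nonneg_right (pow_le_pow_right₀ hδ1 hps) (by positivity)
      have hzB : z ^ B * x ^ ((δ + 1) * (b + 1)) = z ^ (B + b + 1) * (x / y) ^ (b + 1) := by
        have : z * (x / y) = x ^ (δ + 1) := by
          rw [hz, pow_succ]
          field_simp
        rw [pow_mul, ← this, mul_pow z (x / y), ← mul_assoc, ← pow_add, add_assoc]
      have hB1 : ((B : ℝ) + 1) ^ (κ - 1) ≤ (((B + b + 1 : ℕ) : ℝ) + 1) ^ (κ - 1) :=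
        pow_le_pow_left₀ (by positivity) (by
          push_cast
          linarith [Nat.cast_nonneg (α := ℝ) b]) _
      calc E * (((B : ℝ) + 1) ^ (κ - 1) * z ^ B) * inner B
          ≤ E * ((((B + b + 1 : ℕ) : ℝ) + 1) ^ (κ - 1) * z ^ B) *
            (((Q : ℝ) ^ c₀ * x ^ ((δ + 1) * (b + 1))) *
            (((δ : ℝ) + 1) ^ (s * δ) * (((b + 1 : ℕ) : ℝ) + 1) ^ p) *
              ((s * δ).factorial * 2 ^ (s * δ) * s.factorial)) := by
            refine mul_le_mul (mul_le_mul_of_nonneg_left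
              (mul_le_mul_of_nonneg_right hB1 (by positivity)) hE0.le)
              (hin.trans (mul_le_mul_of_nonneg_left ?_ (by positivity))) (hI0 B) (by positivity)
            exact hUle.trans (le_mul_of_one_le_right (by positivity) hs1)
        _ = E * R * (z ^ B * x ^ ((δ + 1) * (b + 1))) * (((B + b + 1 : ℕ) : ℝ) + 1) ^ (κ - 1) *
            (((b + 1 : ℕ) : ℝ) + 1) ^ p := by
            rw [hR]
            ring
        _ = _ := by
            rw [hzB]
            ring
    refine (Finset.sum_le_sum hterm).trans ?_
    rw [← Finset.mul_sum]
    refine mul_le_mul_of_nonneg_left ?_ (by positivity)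
    rw [← Finset.sum_image (s := (range M).filter (· < L)) (g := fun B => L - B)
      (f := fun b : ℕ => ((b : ℝ) + 1) ^ p * (x / y) ^ b)]
    · refine Finset.sum_le_sum_of_subset_of_nonneg (fun b hb => ?_) fun n _ _ => by positivity
      obtain ⟨B, -, rfl⟩ := Finset.mem_image.1 hb
      exact Finset.mem_range.2 (by omega)
    · intro a ha b hb h
      have ha := (Finset.mem_filter.1 (Finset.mem_coe.1 ha)).2
      have hb := (Finset.mem_filter.1 (Finset.mem_coe.1 hb)).2
      simp only at h
      omega
  have hhigh : ∑ B ∈ (range M).filter (¬ · < L),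
      E * (((B : ℝ) + 1) ^ (κ - 1) * ((Q : ℝ) ^ (B - L) * z ^ B)) * inner B ≤
      E * R * z ^ L * ((L : ℝ) + 1) ^ (κ - 1) * ((1 - w) ^ κ)⁻¹ := by
    have hin : ∀ B, inner B ≤ U := by
      intro B
      have := htail 0
      simp only [Nat.cast_zero, zero_add, one_pow, pow_zero, one_mul, Nat.zero_le,
        Finset.filter_true] at this
      exact (Finset.sum_le_sum_of_subset_of_nonneg (Finset.filter_subset _ _)
        fun A _ _ => by positivity).trans this
    have hQz : ∀ B, L ≤ B → (Q : ℝ) ^ (B - L) * z ^ B = x ^ L * w ^ B := by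
      intro B hB
      obtain ⟨b, rfl⟩ := Nat.exists_eq_add_of_le hB
      rw [Nat.add_sub_cancel_left, hzw, mul_pow, pow_add x, ← mul_assoc, ← mul_assoc,
        mul_comm ((Q : ℝ) ^ b), mul_assoc (x ^ L), ← mul_pow, hQx, one_pow, mul_one]
    have h7 := sum_pow_mul_geometric_tail_le (κ - 1) M L hw0.le hw1
    rw [Nat.sub_add_cancel hκ] at h7
    calc ∑ B ∈ (range M).filter (¬ · < L),
        E * (((B : ℝ) + 1) ^ (κ - 1) * ((Q : ℝ) ^ (B - L) * z ^ B)) * inner B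
        ≤ ∑ B ∈ (range M).filter (¬ · < L), E * U * x ^ L *
          (((B : ℝ) + 1) ^ (κ - 1) * w ^ B) := by
          refine Finset.sum_le_sum fun B hB => ?_
          rw [hQz B (not_lt.1 (Finset.mem_filter.1 hB).2)]
          calc E * (((B : ℝ) + 1) ^ (κ - 1) * (x ^ L * w ^ B)) * inner B
              ≤ E * (((B : ℝ) + 1) ^ (κ - 1) * (x ^ L * w ^ B)) * U :=
                mul_le_mul_of_nonneg_left (hin B) (by positivity)
            _ = _ := by ring
      _ ≤ E * U * x ^ L * (((L : ℝ) + 1) ^ (κ - 1) * w ^ L *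
          (((κ - 1).factorial : ℝ) / (1 - w) ^ κ)) := by
          rw [← Finset.mul_sum]
          refine mul_le_mul_of_nonneg_left ?_ (by positivity)
          simpa only [not_lt] using h7
      _ = E * (U * (κ - 1).factorial) * z ^ L * ((L : ℝ) + 1) ^ (κ - 1) * ((1 - w) ^ κ)⁻¹ := by
          rw [hzw, mul_pow]
          ring
      _ ≤ _ := by
          have h8 : U * (κ - 1).factorial ≤ R := by
            have h9 : ((κ - 1).factorial : ℝ) ≤ s.factorial := by
              exact_mod_cast Nat.factorial_le (by omega)
            have h10 : (1 : ℝ) ≤ (Q : ℝ) ^ c₀ * ((δ : ℝ) + 1) ^ (s * δ) :=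
              one_le_mul_of_one_le_of_one_le hQ1 (one_le_pow₀ hδ1)
            calc U * (κ - 1).factorial ≤ ((s * δ).factorial * 2 ^ (s * δ)) * s.factorial :=
                  mul_le_mul hUle h9 (by positivity) (by positivity)
              _ ≤ ((Q : ℝ) ^ c₀ * ((δ : ℝ) + 1) ^ (s * δ)) *
                  (((s * δ).factorial * 2 ^ (s * δ)) * s.factorial) :=
                  le_mul_of_one_le_left (by positivity) h10
              _ = R := by rw [hR]; ring
          have h11 : 0 ≤ ((1 - w) ^ κ)⁻¹ := inv_nonneg.2 (pow_nonneg (by linarith) _)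
          gcongr
  rw [← Finset.sum_filter_add_sum_filter_not (range M) (· < L)]
  refine (add_le_add hlow hhigh).trans (le_of_eq ?_)
  rw [dualConst]
  ring

section DualSum

variable {F : Type*} [Field F] [Fintype F] {s n m : ℕ}

lemma prod_decay_eq {δ : ℕ} {lam : ℝ} {G : ℕ} {v : Finset (Fin s)} {k : Fin s → Fin G → F}
    (hk : ∀ j ∉ v, k j = 0) :
    ∏ j, decay (Fintype.card F) δ lam (digitSupp (k j)) =
      ((Fintype.card F : ℝ)⁻¹) ^
          (∑ j ∈ v, ∑ i ∈ range δ, (top (digitSupp (k j)) i - top (digitSupp (k j)) δ)) *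
        (((Fintype.card F : ℝ)⁻¹) ^ δ * (Fintype.card F : ℝ) ^ (-lam)) ^
          (∑ j ∈ v, top (digitSupp (k j)) δ) := by
  have h0 : ∀ j ∉ v, digitSupp (k j) = ∅ := by
    intro j hj
    rw [← Finset.not_nonempty_iff_eq_empty, digitSupp_nonempty, not_not]
    exact hk j hj
  have h1 : ∏ j, decay (Fintype.card F) δ lam (digitSupp (k j)) =
      ∏ j ∈ v, decay (Fintype.card F) δ lam (digitSupp (k j)) := by
    refine (Finset.prod_subset (Finset.subset_univ v) fun j _ hj => ?_).symm
    rw [h0 j hj]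
    simp [decay]
  rw [h1, ← Finset.prod_pow_eq_pow_sum, ← Finset.prod_pow_eq_pow_sum, ← Finset.prod_mul_distrib]
  refine Finset.prod_congr rfl fun j _ => ?_
  have h2 : ∑ i ∈ range δ, top (digitSupp (k j)) i =
      ∑ i ∈ range δ, (top (digitSupp (k j)) i - top (digitSupp (k j)) δ) +
        δ * top (digitSupp (k j)) δ := by
    have : δ * top (digitSupp (k j)) δ = ∑ _i ∈ range δ, top (digitSupp (k j)) δ := by simp
    rw [this, ← Finset.sum_add_distrib]
    refine Finset.sum_congr rfl fun i hi => (Nat.sub_add_cancel ?_).symm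
    exact top_antitone _ (Finset.mem_range.1 hi).le
  rw [decay_eq, h2, ← inv_pow, pow_add, mul_pow, pow_mul, mul_assoc, ← neg_mul,
    Real.rpow_mul card_pos_real.le, Real.rpow_natCast]

lemma dual_sum_le (C : Fin s → Matrix (Fin n) (Fin m) F) {G L δ c₀ : ℕ} (hδ : 1 ≤ δ)
    (hL : ∀ k ∈ dualSet C G, L < ∑ j, lead (digitSupp (k j)))
    (hT : ∀ k ∈ dualSet C G,
      (δ + 1) * L ≤ ∑ j, ∑ i ∈ range (δ + 1), top (digitSupp (k j)) i + c₀)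
    {lam : ℝ} (hl0 : 0 < lam) {v : Finset (Fin s)} (hv : v.Nonempty)
    {X : Finset (Fin s → Fin G → F)} (hX : ∀ k ∈ X, k ∈ dualSet C G ∧ ∀ j ∉ v, k j = 0) :
    ∑ k ∈ X, ∏ j, decay (Fintype.card F) δ lam (digitSupp (k j)) ≤
      dualConst (Fintype.card F) s δ c₀ *
        (((Fintype.card F : ℝ)⁻¹) ^ δ * (Fintype.card F : ℝ) ^ (-lam)) ^ L *
        ((L : ℝ) + 1) ^ (v.card - 1) *
        (∑ b ∈ range (L + 1), ((b : ℝ) + 1) ^ (v.card * δ - 1) *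
            ((Fintype.card F : ℝ)⁻¹ / (Fintype.card F : ℝ) ^ (-lam)) ^ b +
          ((1 - ((Fintype.card F : ℝ)⁻¹) ^ (δ - 1) * (Fintype.card F : ℝ) ^ (-lam)) ^ v.card)⁻¹) := by
  classical
  have hQ : 2 ≤ Fintype.card F := Fintype.one_lt_card
  have hQ1 : (1 : ℝ) < Fintype.card F := by exact_mod_cast hQ
  set gA : (Fin s → Fin G → F) → ℕ := fun k =>
    ∑ j ∈ v, ∑ i ∈ range δ, (top (digitSupp (k j)) i - top (digitSupp (k j)) δ) with hgA
  set gB : (Fin s → Fin G → F) → ℕ := fun k => ∑ j ∈ v, top (digitSupp (k j)) δ with hgB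
  set M := X.sup (fun k => gA k + gB k) + 1 with hM
  have hκs : v.card ≤ s := by simpa using Finset.card_le_univ v
  refine le_trans ?_ (grade_sum_le hQ hδ hv.card_pos hκs
    (Real.rpow_pos_of_pos card_pos_real (-lam))
    (Real.rpow_lt_one_of_one_lt_of_neg hQ1 (neg_lt_zero.2 hl0)) M)
  rw [Finset.sum_congr rfl fun k hk => prod_decay_eq (δ := δ) (lam := lam) (hX k hk).2,
    Finset.sum_sigma']
  have hmaps : ∀ k ∈ X, (⟨gB k, gA k⟩ : (_ : ℕ) × ℕ) ∈ (range M).sigma fun B =>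
      (range M).filter fun A => (δ + 1) * L ≤ A + (δ + 1) * B + c₀ := by
    intro k hk
    have h1 : gA k + gB k ≤ X.sup (fun k => gA k + gB k) :=
      Finset.le_sup (f := fun k => gA k + gB k) hk
    simp only [Finset.mem_sigma, Finset.mem_filter, Finset.mem_range]
    refine ⟨by omega, by omega, (hT k (hX k hk).1).trans (le_of_eq ?_)⟩
    congr 1
    have h2 : ∑ j, ∑ i ∈ range (δ + 1), top (digitSupp (k j)) i =
        ∑ j ∈ v, ∑ i ∈ range (δ + 1), top (digitSupp (k j)) i := by
      refine (Finset.sum_subset (Finset.subset_univ v) fun j _ hj => ?_).symm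
      have : digitSupp (k j) = ∅ := by
        rw [← Finset.not_nonempty_iff_eq_empty, digitSupp_nonempty, not_not]
        exact (hX k hk).2 j hj
      simp [this]
    rw [h2, hgA, hgB]
    simp only
    rw [Finset.mul_sum, ← Finset.sum_add_distrib]
    refine Finset.sum_congr rfl fun j _ => ?_
    have h3 : (δ + 1) * top (digitSupp (k j)) δ =
        ∑ _i ∈ range (δ + 1), top (digitSupp (k j)) δ := by simp
    rw [h3, Finset.sum_range_succ _ δ, Finset.sum_range_succ _ δ, ← add_assoc,
      ← Finset.sum_add_distrib]
    congr 1
    refine Finset.sum_congr rfl fun i hi => (Nat.sub_add_cancel ?_).symm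
    exact top_antitone _ (Finset.mem_range.1 hi).le
  rw [← Finset.sum_fiberwise_of_maps_to hmaps]
  refine Finset.sum_le_sum fun x hx => ?_
  have hc := card_filter_grade_le C hδ hL hv x.2 x.1
    (X.filter fun k => (⟨gB k, gA k⟩ : (_ : ℕ) × ℕ) = x) fun k hk => by
      obtain ⟨h1, h2⟩ := Finset.mem_filter.1 hk
      exact ⟨(Finset.mem_filter.1 (hX k h1).1).2.2, (hX k h1).2,
        by rw [← h2], by rw [← h2]⟩
  rw [Finset.sum_congr rfl (g := fun _ => ((Fintype.card F : ℝ)⁻¹) ^ x.2 *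
    (((Fintype.card F : ℝ)⁻¹) ^ δ * (Fintype.card F : ℝ) ^ (-lam)) ^ x.1), Finset.sum_const,
    nsmul_eq_mul]
  · refine mul_le_mul_of_nonneg_right ?_ (by positivity)
    exact_mod_cast hc
  · intro k hk
    have := (Finset.mem_filter.1 hk).2
    subst this
    rfl

end DualSum

/-! ### The dual of digital and interlaced nets -/

lemma sum_top_le_mul_lead (S : Finset ℕ) (p : ℕ) : ∑ i ∈ range p, top S i ≤ p * lead S := by
  simpa using Finset.sum_le_card_nsmul (range p) (top S) (lead S) fun i _ =>
    top_antitone S (Nat.zero_le i)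

section NetDual

variable {F : Type*} [Field F] [Fintype F] {s n m : ℕ}

omit [Fintype F] in
lemma lt_sum_lead {G L δ : ℕ} {k : Fin s → Fin G → F}
    (h : (δ + 1) * L < ∑ j, ∑ i ∈ range (δ + 1), top (digitSupp (k j)) i) :
    L < ∑ j, lead (digitSupp (k j)) := by
  have h1 : ∑ j, ∑ i ∈ range (δ + 1), top (digitSupp (k j)) i ≤
      (δ + 1) * ∑ j, lead (digitSupp (k j)) := by
    rw [Finset.mul_sum]
    exact Finset.sum_le_sum fun j _ => sum_top_le_mul_lead _ _
  exact Nat.lt_of_mul_lt_mul_left (h.trans_le h1)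

lemma rowSum_eq_sum_top (C : Fin s → Matrix (Fin n) (Fin m) F) {G : ℕ} (k : Fin s → Fin G → F)
    (hn : ∀ j, ∀ l ∈ digitSupp (k j), l < n) :
    rowSum C k = ∑ x : (j : Fin s) × Fin (digitSupp (k j)).card,
      extDigits (k x.1) (top (digitSupp (k x.1)) x.2 - 1) •
        C x.1 ⟨top (digitSupp (k x.1)) x.2 - 1,
          hn x.1 _ (top_sub_one_mem (top_pos.2 x.2.2))⟩ := by
  rw [Fintype.sum_sigma, rowSum]
  refine Finset.sum_congr rfl fun j _ => ?_
  set g : ℕ → Fin m → F := fun l => if h : l < n then extDigits (k j) l • C j ⟨l, h⟩ else 0 with hg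
  have h1 : ∑ l : Fin n, extDigits (k j) l • C j l = ∑ l ∈ range n, g l := by
    rw [Finset.sum_range]
    exact Finset.sum_congr rfl fun l _ => by simp [hg]
  have h2 : ∑ l ∈ range n, g l = ∑ l ∈ digitSupp (k j), g l := by
    refine (Finset.sum_subset (fun l hl => Finset.mem_range.2 (hn j l hl)) fun l _ hl => ?_).symm
    rw [mem_digitSupp, not_not] at hl
    simp [hg, hl]
  rw [h1, h2, ← sum_top_card, Finset.sum_range]
  refine Finset.sum_congr rfl fun i _ => ?_
  have := hn j _ (top_sub_one_mem (top_pos.2 i.2))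
  simp only [hg]
  rw [dif_pos this]

lemma IsDigitalNet.lt_sum_top {t α : ℕ} {β : ℝ} {C : Fin s → Matrix (Fin n) (Fin m) F}
    (hC : IsDigitalNet t α β C) {G : ℕ} {k : Fin s → Fin G → F} (hk : k ≠ 0)
    (hr : rowSum C k = 0) (hn : ∀ j, ∀ l ∈ digitSupp (k j), l < n)
    (hm : ∀ j, (digitSupp (k j)).card ≤ m) :
    β * n - t < (∑ j, ∑ i ∈ range α, top (digitSupp (k j)) i : ℕ) := by
  by_contra hlt
  rw [not_lt] at hlt
  obtain ⟨-, -, -, -, -, -, hind⟩ := hC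
  have hmem : ∀ j (i : Fin (digitSupp (k j)).card),
      top (digitSupp (k j)) i - 1 ∈ digitSupp (k j) := fun j i => top_sub_one_mem (top_pos.2 i.2)
  have hli := hind (fun j => (digitSupp (k j)).card)
    (fun j i => ⟨top (digitSupp (k j)) i - 1, hn j _ (hmem j i)⟩) hm ?_ ?_
  · rw [rowSum_eq_sum_top C k hn] at hr
    have h0 := Fintype.linearIndependent_iff.1 hli _ hr
    obtain ⟨j, hj⟩ := Function.ne_iff.1 hk
    have hcard := Finset.card_pos.2 (digitSupp_nonempty.2 hj)
    exact mem_digitSupp.1 (hmem j ⟨0, hcard⟩) (h0 ⟨j, ⟨0, hcard⟩⟩)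
  · intro j a b hab
    have h1 := top_strictAnti (S := digitSupp (k j)) (Fin.lt_def.1 hab) (top_pos.2 a.2)
    have h2 := top_pos.2 b.2
    rw [Fin.lt_def]
    simp only
    omega
  · refine le_trans ?_ hlt
    refine Nat.cast_le.2 (Finset.sum_le_sum fun j _ => ?_)
    rw [← Finset.sum_range (n := (digitSupp (k j)).card)
      (fun l => if l < α then top (digitSupp (k j)) l - 1 + 1 else 0), ← Finset.sum_filter]
    have h1 : ∀ l ∈ (range (digitSupp (k j)).card).filter (· < α),
        top (digitSupp (k j)) l - 1 + 1 = top (digitSupp (k j)) l := by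
      intro l hl
      have := top_pos.2 (Finset.mem_range.1 (Finset.mem_filter.1 hl).1)
      omega
    rw [Finset.sum_congr rfl h1]
    exact Finset.sum_le_sum_of_subset fun l hl =>
      Finset.mem_range.2 (Finset.mem_filter.1 hl).2

lemma IsDigitalNet.dual_bounds {t δ : ℕ} {β : ℝ} {C : Fin s → Matrix (Fin n) (Fin m) F}
    (hC : IsDigitalNet t (δ + 1) β C) (hβ : β ≤ 1) {G : ℕ} {k : Fin s → Fin G → F}
    (hk : k ∈ dualSet C G) :
    ⌊(β * n - t) / ((δ : ℝ) + 1)⌋₊ < ∑ j, lead (digitSupp (k j)) ∧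
      (δ + 1) * ⌊(β * n - t) / ((δ : ℝ) + 1)⌋₊ ≤
        ∑ j, ∑ i ∈ range (δ + 1), top (digitSupp (k j)) i + (δ + 1) ^ 2 := by
  set L := ⌊(β * n - t) / ((δ : ℝ) + 1)⌋₊ with hL
  classical
  obtain ⟨hk0, hr⟩ := (Finset.mem_filter.1 hk).2
  have hδ0 : (0 : ℝ) < (δ : ℝ) + 1 := by positivity
  obtain ⟨hn1, hm1, -, hβ0, hβm, htn, -⟩ := id hC
  have hn0 : (0 : ℝ) < n := by exact_mod_cast hn1
  have hT0 : 0 ≤ β * n - t := sub_nonneg.2 htn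
  have hLT : ((δ : ℝ) + 1) * L ≤ β * n - t := by
    rw [mul_comm]
    exact (le_div_iff₀ hδ0).1 (Nat.floor_le (div_nonneg hT0 hδ0.le))
  have ht0 : (0 : ℝ) ≤ t := Nat.cast_nonneg t
  have hLn : (δ + 1) * L ≤ n := by
    have : ((δ : ℝ) + 1) * L ≤ n := by nlinarith
    exact_mod_cast this
  have hLm : L ≤ m := by
    rw [le_div_iff₀ hn0] at hβm
    push_cast at hβm
    have : ((δ : ℝ) + 1) * L ≤ ((δ : ℝ) + 1) * m := by linarith
    exact_mod_cast le_of_mul_le_mul_left this hδ0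
  have hle : ∀ j, lead (digitSupp (k j)) ≤ ∑ j, lead (digitSupp (k j)) := fun j =>
    Finset.single_le_sum (f := fun j => lead (digitSupp (k j))) (fun _ _ => Nat.zero_le _)
      (Finset.mem_univ j)
  have hle' : ∀ j, ∑ i ∈ range (δ + 1), top (digitSupp (k j)) i ≤
      ∑ j, ∑ i ∈ range (δ + 1), top (digitSupp (k j)) i := fun j =>
    Finset.single_le_sum (f := fun j => ∑ i ∈ range (δ + 1), top (digitSupp (k j)) i)
      (fun _ _ => Nat.zero_le _) (Finset.mem_univ j)
  by_cases hn : ∀ j, ∀ l ∈ digitSupp (k j), l < n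
  · by_cases hm : ∀ j, (digitSupp (k j)).card ≤ m
    · have h1 := hC.lt_sum_top hk0 hr hn hm
      have h2 : (δ + 1) * L < ∑ j, ∑ i ∈ range (δ + 1), top (digitSupp (k j)) i := by
        have := hLT.trans_lt h1
        exact_mod_cast this
      exact ⟨lt_sum_lead h2, by omega⟩
    · push Not at hm
      obtain ⟨j, hj⟩ := hm
      have h1 := card_le_top_add (digitSupp (k j))
      refine ⟨?_, ?_⟩
      · have := h1 0
        rw [top_zero, add_zero] at this
        have := hle j
        omega
      · refine le_trans ?_ (Nat.add_le_add_right (hle' j) _)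
        calc (δ + 1) * L = ∑ i ∈ range (δ + 1), L := by simp
          _ ≤ ∑ i ∈ range (δ + 1), (top (digitSupp (k j)) i + (δ + 1)) :=
            Finset.sum_le_sum fun i hi => by
              have := h1 i
              have := Finset.mem_range.1 hi
              omega
          _ = _ := by
            rw [Finset.sum_add_distrib]
            simp [sq]
  · push Not at hn
    obtain ⟨j, l, hl, hnl⟩ := hn
    have h1 := succ_le_lead hl
    have h2 := hle j
    have h3 := hle' j
    have h4 : lead (digitSupp (k j)) ≤ ∑ i ∈ range (δ + 1), top (digitSupp (k j)) i :=
      Finset.single_le_sum (f := top (digitSupp (k j))) (fun _ _ => Nat.zero_le _)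
        (Finset.mem_range.2 (Nat.succ_pos δ))
    refine ⟨?_, by omega⟩
    have : L ≤ (δ + 1) * L := Nat.le_mul_of_pos_left _ (Nat.succ_pos δ)
    omega

/-- The digits of the original net corresponding to digits of the interlaced net. -/
noncomputable def deinterlace {d G : ℕ} (m : ℕ) (k : Fin s → Fin G → F) :
    Fin (s * d) → Fin m → F :=
  fun x r => extDigits (k (finProdFinEquiv.symm x).1) ((finProdFinEquiv.symm x).2 + d * r)

omit [Fintype F] in
lemma rowSum_deinterlace {d G : ℕ} (C : Fin (s * d) → Matrix (Fin m) (Fin m) F)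
    (k : Fin s → Fin G → F) : rowSum C (deinterlace m k) = rowSum (interlace C) k := by
  rw [rowSum, rowSum, ← finProdFinEquiv.sum_comp, Fintype.sum_prod_type]
  refine Finset.sum_congr rfl fun j _ => ?_
  rw [Finset.sum_comm, ← finProdFinEquiv.sum_comp, Fintype.sum_prod_type]
  refine Finset.sum_congr rfl fun r _ => Finset.sum_congr rfl fun c _ => ?_
  simp [interlace, deinterlace, extDigits]

lemma mem_digitSupp_deinterlace {d G : ℕ} {k : Fin s → Fin G → F} {x : Fin (s * d)} {r : ℕ} :
    r ∈ digitSupp (deinterlace m k x) ↔ r < m ∧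
      (finProdFinEquiv.symm x).2 + d * r ∈ digitSupp (k (finProdFinEquiv.symm x).1) := by
  rw [mem_digitSupp, mem_digitSupp, extDigits]
  split_ifs with h
  · simp [deinterlace, h]
  · simp [h]

lemma mul_sum_lead_deinterlace_le {d G : ℕ} (k : Fin s → Fin G → F) (j : Fin s) :
    d * ∑ c : Fin d, lead (digitSupp (deinterlace m k (finProdFinEquiv (j, c)))) ≤
      ∑ i ∈ range d, top (digitSupp (k j)) i + d * d := by
  classical
  set S : Fin d → Finset ℕ := fun c => digitSupp (deinterlace m k (finProdFinEquiv (j, c))) with hS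
  set U : Finset (Fin d) := univ.filter fun c => (S c).Nonempty with hU
  set g : Fin d → ℕ := fun c => c + d * (lead (S c) - 1) with hg
  have hgi : Set.InjOn g U := by
    intro a _ b _ hab
    have h1 : g a % d = g b % d := by rw [hab]
    simp only [hg, Nat.add_mul_mod_self_left, Nat.mod_eq_of_lt (Fin.is_lt _)] at h1
    exact Fin.ext h1
  have hsub : U.image g ⊆ digitSupp (k j) := by
    intro l hl
    obtain ⟨c, hc, rfl⟩ := Finset.mem_image.1 hl
    have := (mem_digitSupp_deinterlace.1 (lead_sub_one_mem (Finset.mem_filter.1 hc).2)).2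
    simpa using this
  have hcard : (U.image g).card ≤ d :=
    Finset.card_image_le.trans ((Finset.card_le_univ U).trans (by simp))
  have h1 := sum_succ_le_sum_top hsub hcard
  rw [Finset.sum_image hgi] at h1
  have h2 : ∑ c ∈ U, (d * lead (S c)) ≤ ∑ c ∈ U, (g c + 1 + d) := by
    refine Finset.sum_le_sum fun c hc => ?_
    have := lead_pos.2 (Finset.mem_filter.1 hc).2
    obtain ⟨e, he⟩ : ∃ e, lead (S c) = e + 1 := ⟨lead (S c) - 1, by omega⟩
    simp only [hg, he, Nat.add_sub_cancel]
    rw [Nat.mul_succ]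
    omega
  have h3 : ∑ c, d * lead (S c) = ∑ c ∈ U, d * lead (S c) := by
    refine (Finset.sum_subset (Finset.subset_univ U) fun c _ hc => ?_).symm
    have : S c = ∅ := by simpa [hU] using hc
    simp [this]
  have h4 : ∑ c ∈ U, d ≤ d * d := by
    rw [Finset.sum_const, smul_eq_mul]
    exact Nat.mul_le_mul_right _ ((Finset.card_le_univ U).trans (by simp))
  rw [Finset.mul_sum, h3]
  rw [Finset.sum_add_distrib] at h2
  omega

lemma interlace_dual_lt {d δ t : ℕ} (hδd : δ < d) {C : Fin (s * d) → Matrix (Fin m) (Fin m) F}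
    (hC : IsDigitalNet t 1 1 C) {G : ℕ} {k : Fin s → Fin G → F}
    (hk : k ∈ dualSet (interlace C) G) :
    (δ + 1) * (m - t - s * d) < ∑ j, ∑ i ∈ range (δ + 1), top (digitSupp (k j)) i := by
  classical
  obtain ⟨hk0, hr⟩ := (Finset.mem_filter.1 hk).2
  obtain ⟨j₀, hj₀⟩ := Function.ne_iff.1 hk0
  have hle' : ∑ i ∈ range (δ + 1), top (digitSupp (k j₀)) i ≤
      ∑ j, ∑ i ∈ range (δ + 1), top (digitSupp (k j)) i :=
    Finset.single_le_sum (f := fun j => ∑ i ∈ range (δ + 1), top (digitSupp (k j)) i)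
      (fun _ _ => Nat.zero_le _) (Finset.mem_univ j₀)
  have hlead : lead (digitSupp (k j₀)) ≤ ∑ i ∈ range (δ + 1), top (digitSupp (k j₀)) i :=
    Finset.single_le_sum (f := top (digitSupp (k j₀))) (fun _ _ => Nat.zero_le _)
      (Finset.mem_range.2 (Nat.succ_pos δ))
  by_cases hz : deinterlace (d := d) m k = 0
  · obtain ⟨l, hl⟩ := digitSupp_nonempty.2 hj₀
    have hlm : m * d ≤ l := by
      by_contra hlt
      rw [not_le] at hlt
      have hmem : l / d ∈ digitSupp (deinterlace m k
          (finProdFinEquiv (j₀, ⟨l % d, Nat.mod_lt _ (by omega)⟩))) := by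
        rw [mem_digitSupp_deinterlace]
        refine ⟨Nat.div_lt_of_lt_mul (by rwa [mul_comm]), ?_⟩
        simpa [Nat.mod_add_div] using hl
      rw [hz] at hmem
      exact digitSupp_nonempty.1 ⟨_, hmem⟩ rfl
    have h1 := succ_le_lead hl
    have h2 : (δ + 1) * (m - t - s * d) ≤ m * d := by
      rw [mul_comm]
      exact Nat.mul_le_mul (by omega) hδd
    omega
  · have h1 := hC.lt_sum_top hz (by rw [rowSum_deinterlace, hr])
      (fun x l hl => (mem_digitSupp_deinterlace.1 hl).1) fun x => by
        have : digitSupp (deinterlace m k x) ⊆ range m := fun l hl =>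
          Finset.mem_range.2 (mem_digitSupp_deinterlace.1 hl).1
        simpa using Finset.card_le_card this
    have h2 : m - t < ∑ j, ∑ c : Fin d,
        lead (digitSupp (deinterlace m k (finProdFinEquiv (j, c)))) := by
      rw [← Fintype.sum_prod_type', finProdFinEquiv.sum_comp
        (fun x => lead (digitSupp (deinterlace m k x)))]
      simp only [Finset.sum_range_one, top_zero] at h1
      have h3 : (m : ℝ) < (∑ x, lead (digitSupp (deinterlace (d := d) m k x)) + t : ℕ) := by
        push_cast at h1 ⊢
        linarith
      have h4 := Nat.cast_lt.1 h3
      have h5 : 0 < ∑ x, lead (digitSupp (deinterlace (d := d) m k x)) := by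
        obtain ⟨x, hx⟩ := Function.ne_iff.1 hz
        exact (lead_pos.2 (digitSupp_nonempty.2 hx)).trans_le
          (Finset.single_le_sum (f := fun x => lead (digitSupp (deinterlace (d := d) m k x)))
            (fun _ _ => Nat.zero_le _) (Finset.mem_univ x))
      omega
    have h3 : d * (m - t) < ∑ j, ∑ i ∈ range d, top (digitSupp (k j)) i + s * (d * d) := by
      calc d * (m - t) < d * ∑ j, ∑ c : Fin d,
          lead (digitSupp (deinterlace m k (finProdFinEquiv (j, c)))) :=
            Nat.mul_lt_mul_of_pos_left h2 (by omega)
        _ ≤ ∑ j, (∑ i ∈ range d, top (digitSupp (k j)) i + d * d) := by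
            rw [Finset.mul_sum]
            exact Finset.sum_le_sum fun j _ => mul_sum_lead_deinterlace_le k j
        _ = _ := by
            rw [Finset.sum_add_distrib]
            simp
    have h4 : (δ + 1) * ∑ j, ∑ i ∈ range d, top (digitSupp (k j)) i ≤
        d * ∑ j, ∑ i ∈ range (δ + 1), top (digitSupp (k j)) i := by
      rw [Finset.mul_sum, Finset.mul_sum]
      exact Finset.sum_le_sum fun j _ =>
        mul_sum_range_le_of_antitone (top_antitone _) hδd
    have h5 : d * ((δ + 1) * (m - t)) <
        d * (∑ j, ∑ i ∈ range (δ + 1), top (digitSupp (k j)) i + (δ + 1) * (s * d)) := by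
      calc d * ((δ + 1) * (m - t)) = (δ + 1) * (d * (m - t)) := by ring
        _ < (δ + 1) * (∑ j, ∑ i ∈ range d, top (digitSupp (k j)) i + s * (d * d)) :=
          Nat.mul_lt_mul_of_pos_left h3 (Nat.succ_pos δ)
        _ ≤ _ := by
          rw [mul_add, mul_add]
          refine add_le_add h4 (le_of_eq (by ring))
    have h6 := Nat.lt_of_mul_lt_mul_left h5
    have h7 : (δ + 1) * (m - t - s * d) = (δ + 1) * (m - t) - (δ + 1) * (s * d) :=
      Nat.mul_sub _ _ _
    have h8 : 0 < lead (digitSupp (k j₀)) := lead_pos.2 (digitSupp_nonempty.2 hj₀)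
    omega

end NetDual

/-! ### The error bound for a general net -/

lemma mixedPartial_zero {s : ℕ} (f : (Fin s → ℝ) → ℝ) : mixedPartial (0 : Fin s → ℕ) f = f := by
  simp [mixedPartial]

/-- The factor depending on a coordinate set of size `κ` in the error bound. -/
noncomputable def dualBracket (Q δ : ℕ) (lam : ℝ) (L κ : ℕ) : ℝ :=
  ((L : ℝ) + 1) ^ (κ - 1) *
    (∑ b ∈ range (L + 1), ((b : ℝ) + 1) ^ (κ * δ - 1) * ((Q : ℝ)⁻¹ / (Q : ℝ) ^ (-lam)) ^ b +
      ((1 - ((Q : ℝ)⁻¹) ^ (δ - 1) * (Q : ℝ) ^ (-lam)) ^ κ)⁻¹)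

lemma one_sub_pow_mul_rpow_pos {Q : ℕ} (hQ : 2 ≤ Q) (δ : ℕ) {lam : ℝ} (hl : 0 < lam) :
    0 < 1 - ((Q : ℝ)⁻¹) ^ (δ - 1) * (Q : ℝ) ^ (-lam) := by
  have hQ1 : (1 : ℝ) < Q := by exact_mod_cast hQ
  have h1 : (Q : ℝ) ^ (-lam) < 1 := Real.rpow_lt_one_of_one_lt_of_neg hQ1 (neg_lt_zero.2 hl)
  have h2 : ((Q : ℝ)⁻¹) ^ (δ - 1) ≤ 1 := pow_le_one₀ (by positivity) (inv_le_one_of_one_le₀ hQ1.le)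
  have h3 : ((Q : ℝ)⁻¹) ^ (δ - 1) * (Q : ℝ) ^ (-lam) ≤ (Q : ℝ) ^ (-lam) :=
    mul_le_of_le_one_left (by positivity) h2
  linarith

lemma dualBracket_nonneg {Q : ℕ} (hQ : 2 ≤ Q) (δ : ℕ) {lam : ℝ} (hl : 0 < lam) (L κ : ℕ) :
    0 ≤ dualBracket Q δ lam L κ := by
  have := one_sub_pow_mul_rpow_pos hQ δ hl
  unfold dualBracket
  positivity

section Weights

variable {s δ : ℕ} {f : (Fin s → ℝ) → ℝ}

lemma toReal_hkVariation_le {lam p q r : ℝ} {γ : Finset (Fin s) → ℝ≥0} (hr : 1 ≤ r)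
    (h : smoothNorm δ lam p q r γ f ≠ ⊤) (τ : Fin s → Fin (δ + 1)) :
    (hkVariation lam p q (anchored δ (fun j => (τ j : ℕ)) f)).toReal ≤
      (1 + ∑ u, ((γ u : ℝ))⁻¹) * γ (posSet fun j => (τ j : ℕ)) *
        (smoothNorm δ lam p q r γ f).toReal := by
  have hr0 : 0 < r := by linarith
  have hV := hkVariation_ne_top hr h τ
  set V := hkVariation lam p q (anchored δ (fun j => (τ j : ℕ)) f) with hVdef
  set g := γ (posSet fun j => (τ j : ℕ)) with hg
  set N := smoothNorm δ lam p q r γ f with hN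
  have h1 : V ^ r / (g : ℝ≥0∞) ≤ N ^ r := by
    rw [hN, smoothNorm, ← ENNReal.rpow_mul, one_div_mul_cancel hr0.ne', ENNReal.rpow_one]
    exact Finset.single_le_sum (f := fun τ : Fin s → Fin (δ + 1) =>
      hkVariation lam p q (anchored δ (fun j => (τ j : ℕ)) f) ^ r /
      (γ (posSet fun j => (τ j : ℕ)) : ℝ≥0∞)) (fun _ _ => zero_le) (Finset.mem_univ τ)
  have h2 : V ^ r ≤ N ^ r * g :=
    (ENNReal.div_le_iff_le_mul (Or.inr (ENNReal.rpow_ne_top_of_nonneg hr0.le h))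
      (Or.inl ENNReal.coe_ne_top)).1 h1
  have h3 : V ≤ N * (g : ℝ≥0∞) ^ (1 / r) := by
    have := ENNReal.rpow_le_rpow h2 (one_div_nonneg.2 hr0.le)
    rwa [ENNReal.mul_rpow_of_nonneg _ _ (one_div_nonneg.2 hr0.le), ← ENNReal.rpow_mul,
      ← ENNReal.rpow_mul, mul_one_div_cancel hr0.ne', ENNReal.rpow_one, ENNReal.rpow_one] at this
  have h4 : V.toReal ≤ N.toReal * (g : ℝ) ^ (1 / r) := by
    have := ENNReal.toReal_mono (ENNReal.mul_ne_top h
      (ENNReal.rpow_ne_top_of_nonneg (one_div_nonneg.2 hr0.le) ENNReal.coe_ne_top)) h3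
    rwa [ENNReal.toReal_mul, ← ENNReal.toReal_rpow, ENNReal.coe_toReal] at this
  have h5 : (g : ℝ) ^ (1 / r) ≤ (1 + ∑ u, ((γ u : ℝ))⁻¹) * g := by
    have h6 : ((g : ℝ))⁻¹ ≤ ∑ u, ((γ u : ℝ))⁻¹ :=
      Finset.single_le_sum (f := fun u => ((γ u : ℝ))⁻¹)
        (fun u _ => inv_nonneg.2 (γ u).2) (Finset.mem_univ _)
    rcases eq_or_lt_of_le g.2 with h0 | h0
    · have h0' : (g : ℝ) = 0 := h0.symm
      rw [h0', Real.zero_rpow (by positivity), mul_zero]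
    · have h0' : (0 : ℝ) < g := h0
      have h7 : (g : ℝ) ^ (1 / r) ≤ g + 1 := by
        rcases le_or_gt 1 (g : ℝ) with h8 | h8
        · calc (g : ℝ) ^ (1 / r) ≤ (g : ℝ) ^ (1 : ℝ) :=
              Real.rpow_le_rpow_of_exponent_le h8 (by rw [div_le_one hr0]; exact hr)
            _ ≤ g + 1 := by rw [Real.rpow_one]; linarith
        · have := Real.rpow_le_one h0'.le h8.le (one_div_nonneg.2 hr0.le)
          linarith
      have h8 : (1 : ℝ) ≤ (∑ u, ((γ u : ℝ))⁻¹) * g := by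
        calc (1 : ℝ) = (g : ℝ)⁻¹ * g := (inv_mul_cancel₀ h0'.ne').symm
          _ ≤ _ := mul_le_mul_of_nonneg_right h6 h0'.le
      linarith
  calc V.toReal ≤ N.toReal * (g : ℝ) ^ (1 / r) := h4
    _ ≤ N.toReal * ((1 + ∑ u, ((γ u : ℝ))⁻¹) * g) :=
      mul_le_mul_of_nonneg_left h5 ENNReal.toReal_nonneg
    _ = _ := mul_comm _ _

end Weights

section ErrorBound

variable {F : Type*} [Field F] [Fintype F] {s n m δ : ℕ} {f : (Fin s → ℝ) → ℝ}

lemma integrable_of_smoothNorm {lam p q r : ℝ} {γ : Finset (Fin s) → ℝ≥0} (hδ : 1 ≤ δ)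
    (hr : 1 ≤ r) (hf : HasMixedPartials δ f) (h : smoothNorm δ lam p q r γ f ≠ ⊤) :
    Integrable f (cubeM (Fin s)) :=
  integrable_of_taylor hδ hf fun τ => integrable_of_hkVariation (hkVariation_ne_top hr h τ)

/-- The constant in the error bound. -/
noncomputable def errorConst (Q s δ c₀ : ℕ) (γ : Finset (Fin s) → ℝ≥0) : ℝ :=
  (δ + 1) ^ s * (2 ^ s * (4 * (Q : ℝ) ^ (δ + 1)) ^ s * dualConst Q s δ c₀ *
    (1 + ∑ u, ((γ u : ℝ))⁻¹))

lemma errorConst_pos {Q : ℕ} (hQ : 0 < Q) (s δ c₀ : ℕ) (γ : Finset (Fin s) → ℝ≥0) :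
    0 < errorConst Q s δ c₀ γ := by
  have := dualConst_pos hQ s δ c₀
  have h0 : (0 : ℝ) < Q := by exact_mod_cast hQ
  have h1 : (0 : ℝ) ≤ ∑ u, ((γ u : ℝ))⁻¹ := Finset.sum_nonneg fun u _ => inv_nonneg.2 (γ u).2
  unfold errorConst
  positivity

lemma sum_norm_coefTerm_le {ψ : AddChar F ℂ} (hψ : ψ.IsPrimitive) (φ : Fin (Fintype.card F) ≃ F)
    {lam p q r : ℝ} {γ : Finset (Fin s) → ℝ≥0} (hδ : 1 ≤ δ) (hl0 : 0 < lam) (hl1 : lam ≤ 1)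
    (hp : 1 ≤ p) (hq : 1 ≤ q) (hr : 1 ≤ r) (hf : HasMixedPartials δ f)
    (h : smoothNorm δ lam p q r γ f ≠ ⊤) (C : Fin s → Matrix (Fin n) (Fin m) F) {G L c₀ : ℕ}
    (hL : ∀ k ∈ dualSet C G, L < ∑ j, lead (digitSupp (k j)))
    (hT : ∀ k ∈ dualSet C G,
      (δ + 1) * L ≤ ∑ j, ∑ i ∈ range (δ + 1), top (digitSupp (k j)) i + c₀)
    (τ : Fin s → Fin (δ + 1)) :
    ∑ k ∈ dualSet C G, ‖coefTerm δ f (fun j => walshFn ψ φ (k j)) τ‖ ≤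
      2 ^ s * (4 * (Fintype.card F : ℝ) ^ (δ + 1)) ^ s * dualConst (Fintype.card F) s δ c₀ *
        (1 + ∑ u, ((γ u : ℝ))⁻¹) * ((smoothNorm δ lam p q r γ f).toReal *
        (((Fintype.card F : ℝ)⁻¹) ^ δ * (Fintype.card F : ℝ) ^ (-lam)) ^ L *
        ∑ u ∈ univ.filter (fun u : Finset (Fin s) => u.Nonempty),
          γ u * dualBracket (Fintype.card F) δ lam L u.card) := by
  classical
  have hQ : 2 ≤ Fintype.card F := Fintype.one_lt_card
  set v := posSet fun j => (τ j : ℕ) with hv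
  have hvmem : ∀ j, j ∉ v → τ j = 0 := by
    intro j hj
    simp only [hv, posSet, Finset.mem_filter, Finset.mem_univ, true_and, not_lt,
      Nat.le_zero] at hj
    exact Fin.ext hj
  have hg0 : ∀ u : Finset (Fin s), 0 ≤ (γ u : ℝ) * dualBracket (Fintype.card F) δ lam L u.card :=
    fun u => mul_nonneg (γ u).2 (dualBracket_nonneg hQ δ hl0 L _)
  have hdc := dualConst_pos (by omega : 0 < Fintype.card F) s δ c₀
  have hG0 : (0 : ℝ) ≤ ∑ u, ((γ u : ℝ))⁻¹ := Finset.sum_nonneg fun u _ => inv_nonneg.2 (γ u).2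
  have hN0 : 0 ≤ (smoothNorm δ lam p q r γ f).toReal := ENNReal.toReal_nonneg
  have hq0 := card_pos_real (F := F)
  have hvan : ∀ k ∈ dualSet C G, ¬ (∀ j ∉ v, k j = 0) →
      ‖coefTerm δ f (fun j => walshFn ψ φ (k j)) τ‖ = 0 := by
    intro k _ hk
    push Not at hk
    obtain ⟨j, hj, hkj⟩ := hk
    rw [norm_eq_zero]
    exact coefTerm_eq_zero (K := fun j => extDigits (k j)) (S := fun j => digitSupp (k j)) hψ
      (fun j l hl => mem_digitSupp.1 hl) hδ (hvmem j hj)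
      (digitSupp_nonempty.2 hkj)
  have hsub : ∑ k ∈ dualSet C G, ‖coefTerm δ f (fun j => walshFn ψ φ (k j)) τ‖ =
      ∑ k ∈ (dualSet C G).filter (fun k => ∀ j ∉ v, k j = 0),
        ‖coefTerm δ f (fun j => walshFn ψ φ (k j)) τ‖ := by
    rw [Finset.sum_filter]
    refine Finset.sum_congr rfl fun k hk => ?_
    split_ifs with h'
    · rfl
    · exact hvan k hk h'
  rw [hsub]
  rcases v.eq_empty_or_nonempty with hve | hvne
  · have hempty : (dualSet C G).filter (fun k => ∀ j ∉ v, k j = 0) = ∅ := by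
      refine Finset.filter_eq_empty_iff.2 fun k hk h0 => ?_
      refine (Finset.mem_filter.1 hk).2.1 (funext fun j => h0 j ?_)
      simp [hve]
    rw [hempty, Finset.sum_empty]
    have := Finset.sum_nonneg fun u
      (_ : u ∈ univ.filter (fun u : Finset (Fin s) => u.Nonempty)) => hg0 u
    positivity
  · set V := (hkVariation lam p q (anchored δ (fun j => (τ j : ℕ)) f)).toReal with hV
    have hV0 : 0 ≤ V := ENNReal.toReal_nonneg
    have h1 : ∀ k ∈ (dualSet C G).filter (fun k => ∀ j ∉ v, k j = 0),
        ‖coefTerm δ f (fun j => walshFn ψ φ (k j)) τ‖ ≤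
        2 ^ s * (4 * (Fintype.card F : ℝ) ^ (δ + 1)) ^ s * V *
          ∏ j, decay (Fintype.card F) δ lam (digitSupp (k j)) := by
      intro k _
      refine (norm_coefTerm_le (K := fun j => extDigits (k j)) (S := fun j => digitSupp (k j)) hψ
        (fun j l hl => mem_digitSupp.1 hl) hl0.le hl1 hp hq hf
        (hkVariation_ne_top hr h τ)).trans (le_of_eq ?_)
      rw [Finset.prod_mul_distrib, Finset.prod_const, Finset.card_univ, Fintype.card_fin]
      ring
    have h2 := dual_sum_le C hδ hL hT hl0 hvne
      (X := (dualSet C G).filter (fun k => ∀ j ∉ v, k j = 0)) fun k hk => Finset.mem_filter.1 hk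
    have h3 := toReal_hkVariation_le hr h τ
    rw [← hv, ← hV] at h3
    have h4 : (γ v : ℝ) * dualBracket (Fintype.card F) δ lam L v.card ≤
        ∑ u ∈ univ.filter (fun u : Finset (Fin s) => u.Nonempty),
          γ u * dualBracket (Fintype.card F) δ lam L u.card :=
      Finset.single_le_sum (f := fun u : Finset (Fin s) =>
        (γ u : ℝ) * dualBracket (Fintype.card F) δ lam L u.card) (fun u _ => hg0 u)
        (Finset.mem_filter.2 ⟨Finset.mem_univ v, hvne⟩)
    have hb0 := dualBracket_nonneg hQ δ hl0 L v.card
    refine (Finset.sum_le_sum h1).trans ?_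
    rw [← Finset.mul_sum]
    set z := ((Fintype.card F : ℝ)⁻¹) ^ δ * (Fintype.card F : ℝ) ^ (-lam) with hz
    have hz0 : 0 < z := by positivity
    set D := dualConst (Fintype.card F) s δ c₀
    set E := (2 : ℝ) ^ s * (4 * (Fintype.card F : ℝ) ^ (δ + 1)) ^ s with hE
    have hE0 : 0 < E := by positivity
    set N := (smoothNorm δ lam p q r γ f).toReal
    set Γ := 1 + ∑ u, ((γ u : ℝ))⁻¹ with hΓ
    have hΓ0 : 0 < Γ := by positivity
    calc E * V * ∑ k ∈ (dualSet C G).filter (fun k => ∀ j ∉ v, k j = 0),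
          ∏ j, decay (Fintype.card F) δ lam (digitSupp (k j))
        ≤ E * (Γ * γ v * N) * (D * z ^ L * dualBracket (Fintype.card F) δ lam L v.card) := by
          refine mul_le_mul (mul_le_mul_of_nonneg_left h3 hE0.le) (h2.trans (le_of_eq ?_))
            (Finset.sum_nonneg fun k _ => Finset.prod_nonneg fun j _ => decay_nonneg _ _ _ _) ?_
          · rw [dualBracket, mul_assoc _ (((L : ℝ) + 1) ^ (v.card - 1))]
          · have := (γ v).2
            positivity
      _ = E * D * Γ * (N * z ^ L * (γ v * dualBracket (Fintype.card F) δ lam L v.card)) := by ring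
      _ ≤ _ := by gcongr

/-- The integration error of a net whose dual has a large minimum weight. -/
lemma abs_integrationError_le_of_dual (φ : Fin (Fintype.card F) ≃ F)
    {lam p q r : ℝ} {γ : Finset (Fin s) → ℝ≥0} (hδ : 1 ≤ δ) (hl0 : 0 < lam) (hl1 : lam ≤ 1)
    (hp : 1 ≤ p) (hq : 1 ≤ q) (hr : 1 ≤ r) (hf : HasMixedPartials δ f)
    (h : smoothNorm δ lam p q r γ f ≠ ⊤) (C : Fin s → Matrix (Fin n) (Fin m) F) {L c₀ : ℕ}
    (hL : ∀ G, ∀ k ∈ dualSet C G, L < ∑ j, lead (digitSupp (k j)))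
    (hT : ∀ G, ∀ k ∈ dualSet C G,
      (δ + 1) * L ≤ ∑ j, ∑ i ∈ range (δ + 1), top (digitSupp (k j)) i + c₀) :
    |integrationError φ C f| ≤ errorConst (Fintype.card F) s δ c₀ γ *
      ((smoothNorm δ lam p q r γ f).toReal *
        (((Fintype.card F : ℝ)⁻¹) ^ δ * (Fintype.card F : ℝ) ^ (-lam)) ^ L *
        ∑ u ∈ univ.filter (fun u : Finset (Fin s) => u.Nonempty),
          γ u * dualBracket (Fintype.card F) δ lam L u.card) := by
  have hψ := AddChar.FiniteField.primitiveChar_to_Complex_isPrimitive F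
  set ψ := AddChar.FiniteField.primitiveChar_to_Complex F
  have hint := integrable_of_smoothNorm hδ hr hf h
  have hc : ContinuousOn f (cube (Fin s)) := by
    have := (hf 0 fun _ => Nat.zero_le _).1
    rwa [mixedPartial_zero] at this
  refine abs_integrationError_le hψ φ C hint hc fun G _ => ?_
  have h1 : ∀ k : Fin s → Fin G → F, ‖walshCoef ψ φ f k‖ ≤
      ∑ τ : Fin s → Fin (δ + 1), ‖coefTerm δ f (fun j => walshFn ψ φ (k j)) τ‖ := by
    intro k
    unfold walshCoef
    rw [integral_mul_prod_eq_sum (Φ := fun j => walshFn ψ φ (k j)) hδ hf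
      (fun τ => integrable_of_hkVariation (hkVariation_ne_top hr h τ))
      (fun j => locInt_walsh ψ φ _ _) fun j x => (norm_walsh ψ φ _ _ x).le]
    exact norm_sum_le _ _
  refine (Finset.sum_le_sum fun k _ => h1 k).trans ?_
  rw [Finset.sum_comm]
  refine (Finset.sum_le_sum fun τ _ => sum_norm_coefTerm_le hψ φ hδ hl0 hl1 hp hq hr hf h C
    (hL G) (hT G) τ).trans (le_of_eq ?_)
  rw [Finset.sum_const, nsmul_eq_mul, Finset.card_univ, Fintype.card_fun, Fintype.card_fin,
    Fintype.card_fin, errorConst]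
  push_cast
  ring

end ErrorBound

/-! ### The error bounds for digital and interlaced nets -/

lemma inv_pow_mul_rpow_pow {Q : ℕ} (hQ : 0 < Q) (δ L : ℕ) (lam : ℝ) :
    (((Q : ℝ)⁻¹) ^ δ * (Q : ℝ) ^ (-lam)) ^ L = (Q : ℝ) ^ (-(((δ : ℝ) + lam) * L)) := by
  have hQ0 : (0 : ℝ) < Q := by exact_mod_cast hQ
  rw [← Real.rpow_neg_one, ← Real.rpow_natCast _ δ, ← Real.rpow_mul hQ0.le, ← Real.rpow_add hQ0,
    ← Real.rpow_natCast _ L, ← Real.rpow_mul hQ0.le]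
  congr 1
  ring

/-- The part of the constants that comes from a geometric series. -/
noncomputable def geomConst (Q δ : ℕ) (lam : ℝ) (κ : ℕ) : ℝ :=
  ((1 - (Q : ℝ) ^ ((1 - ((δ : ℝ) + lam)) / ((δ : ℝ) + 1))) ^ (κ * (δ + 1)))⁻¹

lemma rpow_geom_lt_one {Q δ : ℕ} (hQ : 2 ≤ Q) (hδ : 1 ≤ δ) {lam : ℝ} (hl : 0 < lam) :
    (Q : ℝ) ^ ((1 - ((δ : ℝ) + lam)) / ((δ : ℝ) + 1)) < 1 := by
  have hQ1 : (1 : ℝ) < Q := by exact_mod_cast hQ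
  have hδ1 : (1 : ℝ) ≤ δ := by exact_mod_cast hδ
  exact Real.rpow_lt_one_of_one_lt_of_neg hQ1 (div_neg_of_neg_of_pos (by linarith) (by linarith))

lemma one_le_geomConst {Q δ : ℕ} (hQ : 2 ≤ Q) (hδ : 1 ≤ δ) {lam : ℝ} (hl : 0 < lam) (κ : ℕ) :
    1 ≤ geomConst Q δ lam κ := by
  have h1 := rpow_geom_lt_one hQ hδ hl
  have hQ0 : (0 : ℝ) < Q := by exact_mod_cast (by omega : 0 < Q)
  have h2 := Real.rpow_pos_of_pos hQ0 ((1 - ((δ : ℝ) + lam)) / ((δ : ℝ) + 1))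
  refine (one_le_inv₀ (pow_pos (by linarith) _)).2 (pow_le_one₀ (by linarith) (by linarith))

lemma dualBracket_le {Q δ κ L : ℕ} (hQ : 2 ≤ Q) (hδ : 1 ≤ δ) (hκ : 1 ≤ κ) {lam R : ℝ}
    (hl0 : 0 < lam) (hl1 : lam ≤ 1) (hR : (L : ℝ) + 1 ≤ R) :
    dualBracket Q δ lam L κ ≤ 2 * R ^ (κ * (δ + 1) - 1) * geomConst Q δ lam κ := by
  have hQ1 : (1 : ℝ) < Q := by exact_mod_cast hQ
  have hQ0 : (0 : ℝ) < Q := by linarith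
  have hL0 : (0 : ℝ) ≤ L := Nat.cast_nonneg L
  have hR1 : 1 ≤ R := by linarith
  have hZ1 := one_le_geomConst hQ hδ hl0 κ
  have hκδ : 1 ≤ κ * δ := Nat.mul_pos hκ hδ
  have h1 : ∑ b ∈ range (L + 1), ((b : ℝ) + 1) ^ (κ * δ - 1) * ((Q : ℝ)⁻¹ / (Q : ℝ) ^ (-lam)) ^ b ≤
      R ^ (κ * δ) := by
    have hρ : (Q : ℝ)⁻¹ / (Q : ℝ) ^ (-lam) ≤ 1 := by
      rw [div_le_one (Real.rpow_pos_of_pos hQ0 _), ← Real.rpow_neg_one]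
      exact Real.rpow_le_rpow_of_exponent_le hQ1.le (by linarith)
    calc _ ≤ ∑ b ∈ range (L + 1), R ^ (κ * δ - 1) := by
          refine Finset.sum_le_sum fun b hb => ?_
          have hb' : (b : ℝ) ≤ L := by exact_mod_cast Nat.lt_succ_iff.1 (Finset.mem_range.1 hb)
          calc _ ≤ ((b : ℝ) + 1) ^ (κ * δ - 1) * 1 :=
                mul_le_mul_of_nonneg_left (pow_le_one₀ (by positivity) hρ) (by positivity)
            _ ≤ R ^ (κ * δ - 1) := by
                rw [mul_one]
                exact pow_le_pow_left₀ (by positivity) (by linarith) _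
      _ = ((L : ℝ) + 1) * R ^ (κ * δ - 1) := by simp
      _ ≤ R * R ^ (κ * δ - 1) := mul_le_mul_of_nonneg_right hR (by positivity)
      _ = R ^ (κ * δ) := by rw [← pow_succ', Nat.sub_add_cancel hκδ]
  have h2 : ((1 - ((Q : ℝ)⁻¹) ^ (δ - 1) * (Q : ℝ) ^ (-lam)) ^ κ)⁻¹ ≤ geomConst Q δ lam κ := by
    have hlt := rpow_geom_lt_one hQ hδ hl0
    have hpos := Real.rpow_pos_of_pos hQ0 ((1 - ((δ : ℝ) + lam)) / ((δ : ℝ) + 1))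
    have hδ1 : (1 : ℝ) ≤ δ := by exact_mod_cast hδ
    refine inv_anti₀ (pow_pos (by linarith) _) ?_
    refine (pow_le_pow_of_le_one (by linarith) (by linarith)
      (Nat.le_mul_of_pos_right κ (Nat.succ_pos δ))).trans (pow_le_pow_left₀ (by linarith) ?_ _)
    refine sub_le_sub_left ?_ 1
    rw [← Real.rpow_neg_one, ← Real.rpow_natCast _ (δ - 1), ← Real.rpow_mul hQ0.le,
      ← Real.rpow_add hQ0]
    refine Real.rpow_le_rpow_of_exponent_le hQ1.le ?_
    rw [Nat.cast_sub hδ, le_div_iff₀ (by linarith)]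
    push_cast
    nlinarith
  have h3 : 1 ≤ R ^ (κ * δ) := one_le_pow₀ hR1
  have he : κ * (δ + 1) - 1 = (κ - 1) + κ * δ := by
    rw [Nat.mul_succ]
    omega
  calc dualBracket Q δ lam L κ
      ≤ R ^ (κ - 1) * (R ^ (κ * δ) * geomConst Q δ lam κ + R ^ (κ * δ) * geomConst Q δ lam κ) := by
        unfold dualBracket
        refine mul_le_mul (pow_le_pow_left₀ (by positivity) hR _) (add_le_add ?_ ?_) ?_
          (by positivity)
        · exact h1.trans (le_mul_of_one_le_right (by positivity) hZ1)
        · exact h2.trans (le_mul_of_one_le_left (by linarith) h3)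
        · have := one_sub_pow_mul_rpow_pos hQ δ hl0
          positivity
    _ = _ := by
        rw [he, pow_add]
        ring

lemma geomConst_le_constFrac {Q δ κ : ℕ} (hQ : 2 ≤ Q) (hδ : 1 ≤ δ) {lam : ℝ}
    (hl0 : 0 < lam) (hl1 : lam < 1) :
    geomConst Q δ lam κ ≤ constFrac κ Q ((δ : ℝ) + lam) := by
  have hQ1 : (1 : ℝ) < Q := by exact_mod_cast hQ
  have hfl : ⌊(δ : ℝ) + lam⌋₊ = δ := by
    rw [Nat.floor_eq_iff (by positivity)]
    constructor <;> linarith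
  have hce : ⌈(δ : ℝ) + lam⌉₊ = δ + 1 := by
    rw [Nat.ceil_eq_iff (Nat.succ_ne_zero δ)]
    push_cast
    constructor
    · simp [hl0]
    · linarith
  have hlt : (Q : ℝ) ^ lam < Q := by
    simpa using Real.rpow_lt_rpow_of_exponent_lt hQ1 hl1
  have hZ1 := one_le_geomConst hQ hδ hl0 κ
  have hQp : (1 : ℝ) ≤ (Q : ℝ) ^ (κ * (δ + 1)) := one_le_pow₀ hQ1.le
  rw [constFrac, hfl, hce, add_sub_cancel_left]
  push_cast
  change _ ≤ _ * (((Q : ℝ) - (Q : ℝ) ^ lam)⁻¹ + geomConst Q δ lam κ)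
  have h1 : 0 ≤ ((Q : ℝ) - (Q : ℝ) ^ lam)⁻¹ := inv_nonneg.2 (by linarith)
  nlinarith

lemma geomConst_le_constInt {Q δ κ : ℕ} (hQ : 2 ≤ Q) (hδ : 1 ≤ δ) :
    geomConst Q δ 1 κ ≤ constInt κ Q (δ + 1) := by
  have hQ1 : (1 : ℝ) < Q := by exact_mod_cast hQ
  have hZ1 := one_le_geomConst hQ hδ one_pos κ
  have hQp : (1 : ℝ) ≤ (Q : ℝ) ^ (κ * (δ + 1)) := one_le_pow₀ hQ1.le
  have he : 1 / ((δ + 1 : ℕ) : ℝ) - 1 = (1 - ((δ : ℝ) + 1)) / ((δ : ℝ) + 1) := by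
    push_cast
    rw [sub_div, div_self (by positivity)]
  rw [constInt, he]
  change _ ≤ _ * ((Q : ℝ)⁻¹ + geomConst Q δ 1 κ)
  have h1 : (0 : ℝ) ≤ (Q : ℝ)⁻¹ := by positivity
  nlinarith

section NetErrors

variable {F : Type*} [Field F] [Fintype F] {s n m δ : ℕ} {f : (Fin s → ℝ) → ℝ}

lemma abs_integrationError_digitalNet_le (φ : Fin (Fintype.card F) ≃ F)
    {lam p q r : ℝ} {γ : Finset (Fin s) → ℝ≥0} (hδ : 1 ≤ δ) (hl0 : 0 < lam) (hl1 : lam ≤ 1)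
    (hp : 1 ≤ p) (hq : 1 ≤ q) (hr : 1 ≤ r) (hf : HasMixedPartials δ f)
    (h : smoothNorm δ lam p q r γ f ≠ ⊤) {C : Fin s → Matrix (Fin n) (Fin m) F} {t : ℕ} {β : ℝ}
    (hβ : β ≤ 1) (hC : IsDigitalNet t (δ + 1) β C) {W : ℕ → ℝ}
    (hW : ∀ κ, 1 ≤ κ → (β * n - t + δ + 1) ^ (κ * (δ + 1) - 1) * geomConst (Fintype.card F) δ lam κ ≤
      W κ) :
    |integrationError φ C f| ≤
      (Fintype.card F : ℝ) ^ (-(((δ : ℝ) + lam) * (⌊(β * n - t) / ((δ : ℝ) + 1)⌋₊ : ℝ))) *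
        (2 * errorConst (Fintype.card F) s δ ((δ + 1) ^ 2) γ) *
        (smoothNorm δ lam p q r γ f).toReal *
        ∑ u ∈ univ.filter (fun u : Finset (Fin s) => u.Nonempty), (γ u : ℝ) * W u.card := by
  have hQ : 2 ≤ Fintype.card F := Fintype.one_lt_card
  have h1 := abs_integrationError_le_of_dual φ hδ hl0 hl1 hp hq hr hf h C
    (fun G k hk => (hC.dual_bounds hβ hk).1) (fun G k hk => (hC.dual_bounds hβ hk).2)
  rw [inv_pow_mul_rpow_pow (by omega)] at h1
  set L := ⌊(β * n - t) / ((δ : ℝ) + 1)⌋₊ with hL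
  have hT0 : 0 ≤ β * n - t := sub_nonneg.2 hC.2.2.2.2.2.1
  have hLT : (L : ℝ) ≤ β * n - t :=
    (Nat.floor_le (by positivity)).trans (div_le_self hT0 (by simp))
  have hE := errorConst_pos (by omega : 0 < Fintype.card F) s δ ((δ + 1) ^ 2) γ
  have h2 : ∑ u ∈ univ.filter (fun u : Finset (Fin s) => u.Nonempty),
      (γ u : ℝ) * dualBracket (Fintype.card F) δ lam L u.card ≤
      2 * ∑ u ∈ univ.filter (fun u : Finset (Fin s) => u.Nonempty), (γ u : ℝ) * W u.card := by
    rw [Finset.mul_sum]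
    refine Finset.sum_le_sum fun u hu => ?_
    have hκ := (Finset.mem_filter.1 hu).2.card_pos
    have h3 := dualBracket_le hQ hδ hκ hl0 hl1
      (by linarith [Nat.cast_nonneg (α := ℝ) δ] : (L : ℝ) + 1 ≤ β * n - t + δ + 1)
    calc (γ u : ℝ) * dualBracket (Fintype.card F) δ lam L u.card
        ≤ (γ u : ℝ) * (2 * W u.card) := by
          refine mul_le_mul_of_nonneg_left (h3.trans ?_) (γ u).2
          rw [mul_assoc]
          exact mul_le_mul_of_nonneg_left (hW _ hκ) (by norm_num)
      _ = _ := by ring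
  refine h1.trans ?_
  calc _ ≤ errorConst (Fintype.card F) s δ ((δ + 1) ^ 2) γ *
      ((smoothNorm δ lam p q r γ f).toReal * (Fintype.card F : ℝ) ^ (-(((δ : ℝ) + lam) * L)) *
        (2 * ∑ u ∈ univ.filter (fun u : Finset (Fin s) => u.Nonempty), (γ u : ℝ) * W u.card)) := by
        gcongr
    _ = _ := by ring

lemma exists_dualBracket_le_rpow {Q δ s κ : ℕ} (hQ : 2 ≤ Q) (hδ : 1 ≤ δ) (hκ : 1 ≤ κ)
    (hκs : κ ≤ s) {lam : ℝ} (hl0 : 0 < lam) (hl1 : lam ≤ 1) :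
    ∃ B : ℝ, 0 ≤ B ∧ ∀ L m : ℕ, L + 1 ≤ m →
      dualBracket Q δ lam L κ ≤ B * (m : ℝ) ^ ((s : ℝ) * ((δ : ℝ) + lam)) := by
  have hQ1 : (1 : ℝ) < Q := by exact_mod_cast hQ
  have hQ0 : (0 : ℝ) < Q := by linarith
  have hδ1 : (1 : ℝ) ≤ δ := by exact_mod_cast hδ
  rcases hl1.lt_or_eq with hlt | rfl
  · set ρ := (Q : ℝ)⁻¹ / (Q : ℝ) ^ (-lam) with hρ
    have hρ0 : 0 ≤ ρ := by positivity
    have hρ1 : ρ < 1 := by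
      rw [hρ, div_lt_one (Real.rpow_pos_of_pos hQ0 _), ← Real.rpow_neg_one]
      exact Real.rpow_lt_rpow_of_exponent_lt hQ1 (by linarith)
    have hw := one_sub_pow_mul_rpow_pos hQ δ hl0
    refine ⟨((κ * δ - 1).factorial : ℝ) / (1 - ρ) ^ (κ * δ - 1 + 1) +
      ((1 - ((Q : ℝ)⁻¹) ^ (δ - 1) * (Q : ℝ) ^ (-lam)) ^ κ)⁻¹, ?_, fun L m hLm => ?_⟩
    · have : 0 < 1 - ρ := by linarith
      positivity
    · have hm1 : (1 : ℝ) ≤ m := by exact_mod_cast (by omega : 1 ≤ m)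
      have hLm' : (L : ℝ) + 1 ≤ m := by exact_mod_cast hLm
      have h1 : ((L : ℝ) + 1) ^ (κ - 1) ≤ (m : ℝ) ^ ((s : ℝ) * ((δ : ℝ) + lam)) := by
        refine (pow_le_pow_left₀ (by positivity) hLm' _).trans ?_
        rw [← Real.rpow_natCast]
        refine Real.rpow_le_rpow_of_exponent_le hm1 ?_
        have h2 : ((κ - 1 : ℕ) : ℝ) ≤ s := by exact_mod_cast (by omega : κ - 1 ≤ s)
        nlinarith [Nat.cast_nonneg (α := ℝ) s]
      rw [dualBracket, mul_comm]
      refine mul_le_mul ?_ h1 (by positivity) ?_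
      · exact add_le_add_left (sum_pow_mul_geometric_le _ _ hρ0 hρ1) _
      · have : 0 < 1 - ρ := by linarith
        positivity
  · have hZ1 := one_le_geomConst hQ hδ one_pos κ
    refine ⟨2 * geomConst Q δ 1 κ, by linarith, fun L m hLm => ?_⟩
    have hm1 : (1 : ℝ) ≤ m := by exact_mod_cast (by omega : 1 ≤ m)
    have h1 := dualBracket_le (R := m) hQ hδ hκ one_pos le_rfl
      (by exact_mod_cast hLm : (L : ℝ) + 1 ≤ m)
    have h2 : (m : ℝ) ^ (κ * (δ + 1) - 1) ≤ (m : ℝ) ^ ((s : ℝ) * ((δ : ℝ) + 1)) := by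
      rw [← Real.rpow_natCast]
      refine Real.rpow_le_rpow_of_exponent_le hm1 ?_
      have : κ * (δ + 1) ≤ s * (δ + 1) := Nat.mul_le_mul_right _ hκs
      exact_mod_cast (by omega : κ * (δ + 1) - 1 ≤ s * (δ + 1))
    calc _ ≤ 2 * (m : ℝ) ^ (κ * (δ + 1) - 1) * geomConst Q δ 1 κ := h1
      _ = 2 * geomConst Q δ 1 κ * (m : ℝ) ^ (κ * (δ + 1) - 1) := by ring
      _ ≤ _ := mul_le_mul_of_nonneg_left h2 (by linarith)

lemma exists_abs_integrationError_interlace_le (F : Type*) [Field F] [Fintype F] (hs : 1 ≤ s)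
    (hδ : 1 ≤ δ) (γ : Finset (Fin s) → ℝ≥0) {lam : ℝ} {d t' : ℕ} (hl0 : 0 < lam) (hl1 : lam ≤ 1)
    (hd : (δ : ℝ) + lam ≤ d) :
    ∃ K : ℝ, 0 < K ∧ ∀ p q r : ℝ, 1 ≤ p → 1 ≤ q → 1 ≤ r →
      ∀ f : (Fin s → ℝ) → ℝ, HasMixedPartials δ f → smoothNorm δ lam p q r γ f ≠ ⊤ →
      ∀ (φ : Fin (Fintype.card F) ≃ F) (m : ℕ) (C : Fin (s * d) → Matrix (Fin m) (Fin m) F),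
        IsDigitalNet t' 1 1 C →
        |integrationError φ (interlace C) f| ≤ K * (smoothNorm δ lam p q r γ f).toReal *
          ((Fintype.card F : ℝ) ^ m) ^ (-((δ : ℝ) + lam)) *
          Real.log ((Fintype.card F : ℝ) ^ m) ^ ((s : ℝ) * ((δ : ℝ) + lam)) := by
  have hQ : 2 ≤ Fintype.card F := Fintype.one_lt_card
  have hQ1 : (1 : ℝ) < Fintype.card F := by exact_mod_cast hQ
  have hQ0 : (0 : ℝ) < Fintype.card F := by linarith
  have hδd : δ < d := by
    have : (δ : ℝ) < d := by linarith
    exact_mod_cast this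
  have hB : ∀ κ, ∃ B : ℝ, 0 ≤ B ∧ (1 ≤ κ → κ ≤ s → ∀ L m : ℕ, L + 1 ≤ m →
      dualBracket (Fintype.card F) δ lam L κ ≤ B * (m : ℝ) ^ ((s : ℝ) * ((δ : ℝ) + lam))) := by
    intro κ
    by_cases hκ : 1 ≤ κ ∧ κ ≤ s
    · obtain ⟨B, hB0, hB⟩ := exists_dualBracket_le_rpow hQ hδ hκ.1 hκ.2 hl0 hl1
      exact ⟨B, hB0, fun _ _ => hB⟩
    · exact ⟨0, le_rfl, fun h1 h2 => absurd ⟨h1, h2⟩ hκ⟩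
  choose B hB0 hB using hB
  set S := ∑ u : Finset (Fin s), (γ u : ℝ) * B u.card with hS
  have hS0 : 0 ≤ S := Finset.sum_nonneg fun u _ => mul_nonneg (γ u).2 (hB0 _)
  have hlog : 0 < Real.log (Fintype.card F) := Real.log_pos hQ1
  have hE := errorConst_pos (by omega : 0 < Fintype.card F) s δ 0 γ
  set A : ℝ := (Fintype.card F : ℝ) ^ (((δ : ℝ) + lam) * (t' + s * d : ℕ)) with hA
  have hA0 : 0 < A := Real.rpow_pos_of_pos hQ0 _
  set Λ : ℝ := Real.log (Fintype.card F) ^ ((s : ℝ) * ((δ : ℝ) + lam)) with hΛ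
  have hΛ0 : 0 < Λ := Real.rpow_pos_of_pos hlog _
  refine ⟨errorConst (Fintype.card F) s δ 0 γ * A * (S + 1) / Λ, by positivity, ?_⟩
  intro p q r hp hq hr f hf h φ m C hC
  have hm1 : 1 ≤ m := hC.2.1
  set L := m - t' - s * d with hL
  have hsd : 1 ≤ s * d := Nat.mul_pos hs (by omega)
  have hdual : ∀ G, ∀ k ∈ dualSet (interlace C) G,
      (δ + 1) * L < ∑ j, ∑ i ∈ range (δ + 1), top (digitSupp (k j)) i :=
    fun G k hk => interlace_dual_lt hδd hC hk
  have h1 := abs_integrationError_le_of_dual φ hδ hl0 hl1 hp hq hr hf h (interlace C) (c₀ := 0)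
    (fun G k hk => lt_sum_lead (hdual G k hk)) (fun G k hk => (hdual G k hk).le)
  rw [inv_pow_mul_rpow_pow (by omega)] at h1
  have h2 : ∑ u ∈ univ.filter (fun u : Finset (Fin s) => u.Nonempty),
      (γ u : ℝ) * dualBracket (Fintype.card F) δ lam L u.card ≤
      (S + 1) * (m : ℝ) ^ ((s : ℝ) * ((δ : ℝ) + lam)) := by
    have hm0 : 0 ≤ (m : ℝ) ^ ((s : ℝ) * ((δ : ℝ) + lam)) := by positivity
    calc _ ≤ ∑ u ∈ univ.filter (fun u : Finset (Fin s) => u.Nonempty),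
          (γ u : ℝ) * B u.card * (m : ℝ) ^ ((s : ℝ) * ((δ : ℝ) + lam)) := by
          refine Finset.sum_le_sum fun u hu => ?_
          rw [mul_assoc]
          refine mul_le_mul_of_nonneg_left ?_ (γ u).2
          exact hB u.card (Finset.mem_filter.1 hu).2.card_pos (by simpa using Finset.card_le_univ u)
            L m (by omega)
      _ ≤ ∑ u, (γ u : ℝ) * B u.card * (m : ℝ) ^ ((s : ℝ) * ((δ : ℝ) + lam)) :=
          Finset.sum_le_sum_of_subset_of_nonneg (Finset.filter_subset _ _) fun u _ _ =>
            mul_nonneg (mul_nonneg (γ u).2 (hB0 _)) hm0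
      _ = S * (m : ℝ) ^ ((s : ℝ) * ((δ : ℝ) + lam)) := by rw [hS, Finset.sum_mul]
      _ ≤ _ := mul_le_mul_of_nonneg_right (by linarith) hm0
  have h3 : (Fintype.card F : ℝ) ^ (-(((δ : ℝ) + lam) * L)) ≤
      A * ((Fintype.card F : ℝ) ^ m) ^ (-((δ : ℝ) + lam)) := by
    rw [hA, ← Real.rpow_natCast _ m, ← Real.rpow_mul hQ0.le, ← Real.rpow_add hQ0]
    refine Real.rpow_le_rpow_of_exponent_le hQ1.le ?_
    have h4 : (m : ℝ) ≤ L + (t' + s * d : ℕ) := by exact_mod_cast (by omega : m ≤ L + (t' + s * d))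
    have h5 : 0 < (δ : ℝ) + lam := by positivity
    nlinarith
  have h4 : Real.log ((Fintype.card F : ℝ) ^ m) ^ ((s : ℝ) * ((δ : ℝ) + lam)) =
      (m : ℝ) ^ ((s : ℝ) * ((δ : ℝ) + lam)) * Λ := by
    rw [Real.log_pow, Real.mul_rpow (Nat.cast_nonneg _) hlog.le]
  have hN0 : 0 ≤ (smoothNorm δ lam p q r γ f).toReal := ENNReal.toReal_nonneg
  have h5 : 0 ≤ ∑ u ∈ univ.filter (fun u : Finset (Fin s) => u.Nonempty),
      (γ u : ℝ) * dualBracket (Fintype.card F) δ lam L u.card :=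
    Finset.sum_nonneg fun u _ => mul_nonneg (γ u).2 (dualBracket_nonneg hQ δ hl0 _ _)
  rw [h4]
  calc _ ≤ _ := h1
    _ ≤ errorConst (Fintype.card F) s δ 0 γ * ((smoothNorm δ lam p q r γ f).toReal *
        (A * ((Fintype.card F : ℝ) ^ m) ^ (-((δ : ℝ) + lam))) *
        ((S + 1) * (m : ℝ) ^ ((s : ℝ) * ((δ : ℝ) + lam)))) := by gcongr
    _ = _ := by field_simp

end NetErrors

/-! ### Existence of digital nets -/

section Existence

open Polynomial

variable {F : Type*} [Field F]

/-- The product of the first polynomials of a pairwise coprime sequence. -/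
noncomputable def coprimeProd (F : Type*) [Field F] : ℕ → F[X]
  | 0 => X
  | n + 1 => coprimeProd F n * (coprimeProd F n + 1)

/-- A sequence of pairwise coprime monic polynomials. -/
noncomputable def coprimePoly (F : Type*) [Field F] (n : ℕ) : F[X] := coprimeProd F n + 1

lemma coprimeProd_monic (n : ℕ) :
    (coprimeProd F n).Monic ∧ 0 < (coprimeProd F n).degree ∧ (coprimePoly F n).Monic := by
  have key : ∀ n, (coprimeProd F n).Monic → 0 < (coprimeProd F n).degree →
      (coprimePoly F n).Monic := fun n h1 h2 => h1.add_of_left (by rwa [degree_one])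
  have h : ∀ n, (coprimeProd F n).Monic ∧ 0 < (coprimeProd F n).degree := by
    intro n
    induction n with
    | zero => exact ⟨monic_X, by simp [coprimeProd]⟩
    | succ n ih =>
      have h1 := key n ih.1 ih.2
      refine ⟨ih.1.mul h1, ?_⟩
      rw [coprimeProd, degree_mul]
      refine add_pos_of_pos_of_nonneg ih.2 (zero_le_degree_iff.2 h1.ne_zero)
  exact ⟨(h n).1, (h n).2, key n (h n).1 (h n).2⟩

lemma coprimePoly_natDegree_pos (n : ℕ) : 0 < (coprimePoly F n).natDegree := by
  obtain ⟨-, h, -⟩ := coprimeProd_monic (F := F) n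
  rw [natDegree_pos_iff_degree_pos, coprimePoly, degree_add_eq_left_of_degree_lt]
  · exact h
  · rwa [degree_one]

lemma coprimePoly_dvd {i n : ℕ} (h : i < n) : coprimePoly F i ∣ coprimeProd F n := by
  induction n with
  | zero => omega
  | succ n ih =>
    rw [coprimeProd]
    rcases (Nat.lt_succ_iff.1 h).lt_or_eq with h' | rfl
    · exact (ih h').mul_right _
    · exact Dvd.intro_left _ rfl

lemma isCoprime_coprimePoly {i n : ℕ} (h : i ≠ n) :
    IsCoprime (coprimePoly F i) (coprimePoly F n) := by
  have key : ∀ {i n : ℕ}, i < n → IsCoprime (coprimePoly F i) (coprimePoly F n) := by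
    intro i n h
    obtain ⟨c, hc⟩ := coprimePoly_dvd (F := F) h
    refine ⟨-c, 1, ?_⟩
    rw [coprimePoly, coprimePoly] at *
    rw [hc]
    ring
  rcases lt_or_gt_of_ne h with h' | h'
  · exact key h'
  · exact (key h').symm

lemma pow_dvd_of_coeff_modByMonic {P f : F[X]} (hP : P.Monic) {e : ℕ} (he : P.natDegree = e)
    {c : ℕ} (h : ∀ r < e * c, (f %ₘ P ^ (r / e + 1)).coeff r = 0) : P ^ c ∣ f := by
  induction c with
  | zero => simp
  | succ c ih =>
    have hc := ih fun r hr => h r (hr.trans_le (Nat.mul_le_mul_left e (Nat.le_succ c)))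
    have hmon : (P ^ (c + 1)).Monic := hP.pow _
    rw [← modByMonic_eq_zero_iff_dvd hmon]
    refine eq_zero_of_dvd_of_degree_lt (p := P ^ c) ?_ ?_
    · rw [modByMonic_eq_sub_mul_div]
      exact dvd_sub hc ((pow_dvd_pow P (Nat.le_succ c)).mul_right _)
    · rw [degree_eq_natDegree (hP.pow c).ne_zero, hP.natDegree_pow, he, degree_lt_iff_coeff_zero]
      intro r hr
      rcases lt_or_ge r (e * (c + 1)) with hr' | hr'
      · have hrc : r / e = c :=
          Nat.div_eq_of_lt_le hr (by rwa [mul_comm])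
        have := h r hr'
        rwa [hrc] at this
      · refine coeff_eq_zero_of_degree_lt ((degree_modByMonic_lt f hmon).trans_le ?_)
        rw [degree_eq_natDegree hmon.ne_zero, hP.natDegree_pow, he]
        exact_mod_cast (by rwa [mul_comm])

/-- The generating matrices of a digital net built from pairwise coprime polynomials. -/
noncomputable def polyMatrix (F : Type*) [Field F] (k m : ℕ) :
    Fin k → Matrix (Fin m) (Fin m) F :=
  fun j r b => (X ^ (b : ℕ) %ₘ coprimePoly F j ^ ((r : ℕ) / (coprimePoly F j).natDegree + 1)).coeff r

lemma sum_coeff_mul_polyMatrix {k m : ℕ} (j : Fin k) (r : Fin m) {f : F[X]}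
    (hf : f.degree < m) : ∑ b : Fin m, f.coeff b * polyMatrix F k m j r b =
      (f %ₘ coprimePoly F j ^ ((r : ℕ) / (coprimePoly F j).natDegree + 1)).coeff r := by
  have hsum : f = ∑ b : Fin m, f.coeff b • X ^ (b : ℕ) := by
    ext i
    simp only [finsetSum_coeff, coeff_smul, coeff_X_pow, smul_eq_mul, mul_ite, mul_one, mul_zero]
    rw [Finset.sum_fin_eq_sum_range]
    by_cases hi : i < m
    · rw [Finset.sum_eq_single i]
      · simp [hi]
      · intro b _ hb
        split_ifs <;> simp_all
      · intro h
        exact absurd (Finset.mem_range.2 hi) h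
    · rw [coeff_eq_zero_of_degree_lt (hf.trans_le (by exact_mod_cast not_lt.1 hi))]
      refine (Finset.sum_eq_zero fun b hb => ?_).symm
      have := Finset.mem_range.1 hb
      rw [dif_pos this, if_neg (by omega)]
  conv_rhs => rw [hsum]
  change _ = (modByMonicHom _ _).coeff r
  rw [map_sum, finsetSum_coeff]
  refine Finset.sum_congr rfl fun b _ => ?_
  rw [map_smul, coeff_smul, smul_eq_mul]
  rfl

/-- Polynomials of bounded degree with prescribed digits with respect to coprime polynomials. -/
lemma exists_poly_coeff_modByMonic {k : ℕ} (c : Fin k → ℕ)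
    (y : ((j : Fin k) × Fin ((coprimePoly F j).natDegree * c j)) → F) :
    ∃ f : F[X], f.degree < (∑ j : Fin k, (coprimePoly F j).natDegree * c j : ℕ) ∧
      ∀ x, (f %ₘ coprimePoly F x.1 ^ ((x.2 : ℕ) / (coprimePoly F x.1).natDegree + 1)).coeff x.2 =
        y x := by
  set M := ∑ j : Fin k, (coprimePoly F j).natDegree * c j with hM
  let Ψ : degreeLT F M →ₗ[F] (((j : Fin k) × Fin ((coprimePoly F j).natDegree * c j)) → F) :=
    LinearMap.pi fun x => (lcoeff F (x.2 : ℕ)) ∘ₗ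
      (modByMonicHom (coprimePoly F x.1 ^ ((x.2 : ℕ) / (coprimePoly F x.1).natDegree + 1))) ∘ₗ
      (degreeLT F M).subtype
  have hinj : Function.Injective Ψ := by
    rw [← LinearMap.ker_eq_bot, LinearMap.ker_eq_bot']
    intro f hf
    have hdvd : ∀ j : Fin k, coprimePoly F j ^ c j ∣ (f : F[X]) := fun j =>
      pow_dvd_of_coeff_modByMonic (coprimeProd_monic j).2.2 rfl
        fun r hr => congrFun hf ⟨j, ⟨r, hr⟩⟩
    have hprod : ∏ j : Fin k, coprimePoly F j ^ c j ∣ (f : F[X]) :=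
      Finset.prod_dvd_of_coprime (fun i _ j _ hij =>
        (isCoprime_coprimePoly fun h => hij (Fin.ext h)).pow) fun j _ => hdvd j
    refine Subtype.ext (eq_zero_of_dvd_of_degree_lt hprod ?_)
    have hmon : ∀ j ∈ (univ : Finset (Fin k)), (coprimePoly F j ^ c j).Monic := fun j _ =>
      (coprimeProd_monic (j : ℕ)).2.2.pow _
    rw [degree_eq_natDegree (monic_prod_of_monic _ _ hmon).ne_zero,
      natDegree_prod_of_monic _ _ hmon]
    have : ∑ j : Fin k, (coprimePoly F j ^ c j).natDegree = M :=
      Finset.sum_congr rfl fun j _ => by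
        rw [(coprimeProd_monic (j : ℕ)).2.2.natDegree_pow, mul_comm]
    rw [this]
    exact mem_degreeLT.1 f.2
  have hrank : Module.finrank F (degreeLT F M) =
      Module.finrank F (((j : Fin k) × Fin ((coprimePoly F j).natDegree * c j)) → F) := by
    rw [(degreeLTEquiv F M).finrank_eq, Module.finrank_fintype_fun_eq_card,
      Module.finrank_fintype_fun_eq_card, Fintype.card_sigma]
    simp [hM]
  have : FiniteDimensional F (degreeLT F M) := (degreeLTEquiv F M).symm.finiteDimensional
  obtain ⟨f, hf⟩ := (LinearMap.injective_iff_surjective_of_finrank_eq_finrank hrank).1 hinj y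
  exact ⟨f, mem_degreeLT.1 f.2, fun x => congrFun hf x⟩

theorem isDigitalNet_polyMatrix [Fintype F] {k m : ℕ} (hm : 1 ≤ m)
    (hmk : ∑ j : Fin k, ((coprimePoly F j).natDegree - 1) ≤ m) :
    IsDigitalNet (∑ j : Fin k, ((coprimePoly F j).natDegree - 1)) 1 1 (polyMatrix F k m) := by
  classical
  have hm0 : (0 : ℝ) < m := by exact_mod_cast hm
  refine ⟨hm, hm, le_rfl, one_pos, ?_, ?_, fun ν i hν hi hsum => ?_⟩
  · rw [Nat.cast_one, one_mul, div_self hm0.ne']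
  · rw [one_mul]
    exact_mod_cast hmk
  set R : Fin k → ℕ := fun j => if h : 0 < ν j then (i j ⟨0, h⟩ : ℕ) + 1 else 0 with hR
  have hRsum : ∀ j, ∑ l : Fin (ν j), (if (l : ℕ) < 1 then ((i j l : ℕ) + 1) else 0) = R j := by
    intro j
    by_cases h : 0 < ν j
    · rw [Finset.sum_eq_single (⟨0, h⟩ : Fin (ν j))]
      · simp [hR, h]
      · intro b _ hb
        rw [if_neg]
        intro hb'
        exact hb (Fin.ext (by simpa using hb'))
      · simp
    · have : IsEmpty (Fin (ν j)) := by
        rw [not_lt, Nat.le_zero] at h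
        rw [h]
        infer_instance
      simp [hR, h]
  simp only [hRsum, one_mul] at hsum
  have hsum' : ∑ j, R j + ∑ j : Fin k, ((coprimePoly F j).natDegree - 1) ≤ m := by
    have : ((∑ j, R j + ∑ j : Fin k, ((coprimePoly F j).natDegree - 1) : ℕ) : ℝ) ≤ m := by
      rw [Nat.cast_add]
      linarith
    exact_mod_cast this
  have hlt : ∀ j l, (i j l : ℕ) < R j := by
    intro j l
    have h0 : 0 < ν j := l.pos
    have : (i j l : ℕ) ≤ i j ⟨0, h0⟩ := (hi j).antitone (Fin.le_def.2 (Nat.zero_le _))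
    simp only [hR, h0, dif_pos]
    omega
  set e : Fin k → ℕ := fun j => (coprimePoly F j).natDegree with he
  have he0 : ∀ j, 0 < e j := fun j => coprimePoly_natDegree_pos j
  set c : Fin k → ℕ := fun j => (R j + (e j - 1)) / e j with hc
  have hRc : ∀ j, R j ≤ e j * c j := by
    intro j
    have h1 := Nat.div_add_mod (R j + (e j - 1)) (e j)
    have h2 := Nat.mod_lt (R j + (e j - 1)) (he0 j)
    simp only [hc]
    omega
  have hcR : ∑ j, e j * c j ≤ m := by
    refine le_trans ?_ hsum'
    rw [← Finset.sum_add_distrib]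
    exact Finset.sum_le_sum fun j _ => Nat.mul_div_le _ _
  rw [Fintype.linearIndependent_iff]
  intro a ha x₀
  obtain ⟨f, hfdeg, hf⟩ := exists_poly_coeff_modByMonic (F := F) c
    (fun x => if x = ⟨x₀.1, ⟨i x₀.1 x₀.2, (hlt _ _).trans_le (hRc _)⟩⟩ then 1 else 0)
  have hfm : f.degree < m := hfdeg.trans_le (by exact_mod_cast hcR)
  have h1 : ∀ x : (j : Fin k) × Fin (ν j),
      ∑ b : Fin m, f.coeff b * polyMatrix F k m x.1 (i x.1 x.2) b = if x = x₀ then 1 else 0 := by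
    rintro ⟨j, l⟩
    rw [sum_coeff_mul_polyMatrix j (i j l) hfm]
    rw [hf ⟨j, ⟨i j l, (hlt j l).trans_le (hRc j)⟩⟩]
    refine if_congr ?_ rfl rfl
    obtain ⟨j₀, l₀⟩ := x₀
    constructor
    · intro h
      obtain ⟨rfl, h2⟩ := Sigma.mk.inj h
      have h3 := Fin.mk.inj (eq_of_heq h2)
      rw [(hi j).injective (Fin.ext h3)]
    · rintro h
      obtain ⟨rfl, h2⟩ := Sigma.mk.inj h
      rw [eq_of_heq h2]
  have h2 : ∑ b : Fin m, f.coeff b *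
      (∑ x : (j : Fin k) × Fin (ν j), a x • polyMatrix F k m x.1 (i x.1 x.2)) b = 0 := by
    rw [ha]
    simp
  have h3 : ∑ b : Fin m, f.coeff b *
      (∑ x : (j : Fin k) × Fin (ν j), a x • polyMatrix F k m x.1 (i x.1 x.2)) b =
      ∑ x : (j : Fin k) × Fin (ν j), a x *
        ∑ b : Fin m, f.coeff b * polyMatrix F k m x.1 (i x.1 x.2) b := by
    simp only [Finset.sum_apply, Finset.mul_sum]
    rw [Finset.sum_comm]
    refine Finset.sum_congr rfl fun x _ => Finset.sum_congr rfl fun b _ => ?_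
    rw [Pi.smul_apply, smul_eq_mul]
    ring
  rw [h3] at h2
  simpa [h1] using h2

end Existence

end HigherOrderQMC

theorem mainTheorem3 {F : Type*} [Field F] [Fintype F] (s : ℕ) (hs : 1 ≤ s)
    (δ : ℕ) (hδ : 1 ≤ δ) (γ : Finset (Fin s) → ℝ≥0) :
    -- the two error bounds, with one constant depending only on `δ`, `s`, `F` and `γ`
    (∃ K : ℝ, 0 < K ∧
      ∀ lam p q r : ℝ, 0 < lam → lam ≤ 1 → 1 ≤ p → 1 ≤ q → 1 ≤ r →
      ∀ f : (Fin s → ℝ) → ℝ, HasMixedPartials δ f → smoothNorm δ lam p q r γ f ≠ ⊤ →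
        IntegrableOn f (cube (Fin s)) ∧
        ∀ (φ : Fin (Fintype.card F) ≃ F) (n m t : ℕ) (β : ℝ)
          (C : Fin s → Matrix (Fin n) (Fin m) F),
          β ≤ 1 → IsDigitalNet t (δ + 1) β C →
          (lam < 1 →
            |integrationError φ C f| ≤
              (Fintype.card F : ℝ) ^
                  (-(((δ : ℝ) + lam) * (⌊(β * n - t) / ((δ : ℝ) + 1)⌋₊ : ℝ))) *
                K * (smoothNorm δ lam p q r γ f).toReal *
                ∑ u ∈ Finset.univ.filter (fun u : Finset (Fin s) => u.Nonempty),
                  (γ u : ℝ) * constFrac u.card (Fintype.card F) ((δ : ℝ) + lam) *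
                    (β * n - t + δ + 1) ^ (u.card * (δ + 1) - 1)) ∧
          (lam = 1 →
            |integrationError φ C f| ≤
              (Fintype.card F : ℝ) ^ (-(β * n - t)) *
                K * (smoothNorm δ lam p q r γ f).toReal *
                ∑ u ∈ Finset.univ.filter (fun u : Finset (Fin s) => u.Nonempty),
                  (γ u : ℝ) * constInt u.card (Fintype.card F) (δ + 1) *
                    (β * n - t + δ + 1) ^ (u.card * (δ + 1)))) ∧
    -- the rate for the interlaced construction, with `N = |F| ^ m` points
    (∀ (lam : ℝ) (d t' : ℕ), 0 < lam → lam ≤ 1 → (δ : ℝ) + lam ≤ d →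
      ∃ K : ℝ, 0 < K ∧
        ∀ p q r : ℝ, 1 ≤ p → 1 ≤ q → 1 ≤ r →
        ∀ f : (Fin s → ℝ) → ℝ, HasMixedPartials δ f → smoothNorm δ lam p q r γ f ≠ ⊤ →
        ∀ (φ : Fin (Fintype.card F) ≃ F) (m : ℕ)
          (C : Fin (s * d) → Matrix (Fin m) (Fin m) F),
          IsDigitalNet t' 1 1 C →
          |integrationError φ (interlace C) f| ≤
            K * (smoothNorm δ lam p q r γ f).toReal *
              ((Fintype.card F : ℝ) ^ m) ^ (-((δ : ℝ) + lam)) *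
              Real.log ((Fintype.card F : ℝ) ^ m) ^ ((s : ℝ) * ((δ : ℝ) + lam))) ∧
    -- the nets that the construction starts from exist with `t'` independent of `m`
    (∀ d : ℕ, 1 ≤ d → ∃ t' : ℕ, ∀ m : ℕ, 1 ≤ m → t' ≤ m →
      ∃ C : Fin (s * d) → Matrix (Fin m) (Fin m) F, IsDigitalNet t' 1 1 C) := by
  have hQ : 2 ≤ Fintype.card F := Fintype.one_lt_card
  have hQ1 : (1 : ℝ) < Fintype.card F := by exact_mod_cast hQ
  have hQ0 : (0 : ℝ) < Fintype.card F := by linarith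
  have hE := errorConst_pos (by omega : 0 < Fintype.card F) s δ ((δ + 1) ^ 2) γ
  refine ⟨⟨(Fintype.card F : ℝ) ^ (δ + 1) *
    (2 * errorConst (Fintype.card F) s δ ((δ + 1) ^ 2) γ), by positivity, ?_⟩, ?_, ?_⟩
  · intro lam p q r hl0 hl1 hp hq hr f hf h
    have hN0 : 0 ≤ (smoothNorm δ lam p q r γ f).toReal := ENNReal.toReal_nonneg
    refine ⟨by
      rw [IntegrableOn, restrict_cube]
      exact integrable_of_smoothNorm hδ hr hf h, ?_⟩
    intro φ n m t β C hβ hC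
    have hT0 : 0 ≤ β * n - t := sub_nonneg.2 hC.2.2.2.2.2.1
    have hR1 : 1 ≤ β * n - t + δ + 1 := by linarith [Nat.cast_nonneg (α := ℝ) δ]
    refine ⟨fun hlt => ?_, ?_⟩
    · have h1 := abs_integrationError_digitalNet_le φ hδ hl0 hl1 hp hq hr hf h hβ hC
        (W := fun κ => constFrac κ (Fintype.card F) ((δ : ℝ) + lam) *
          (β * n - t + δ + 1) ^ (κ * (δ + 1) - 1)) fun κ _ => by
            rw [mul_comm]
            exact mul_le_mul_of_nonneg_right (geomConst_le_constFrac hQ hδ hl0 hlt)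
              (by positivity)
      simp only [← mul_assoc] at h1 ⊢
      refine h1.trans ?_
      have hS : 0 ≤ ∑ u ∈ univ.filter (fun u : Finset (Fin s) => u.Nonempty),
          (γ u : ℝ) * constFrac u.card (Fintype.card F) ((δ : ℝ) + lam) *
            (β * n - t + δ + 1) ^ (u.card * (δ + 1) - 1) := by
        refine Finset.sum_nonneg fun u _ => ?_
        have h2 := geomConst_le_constFrac (κ := u.card) hQ hδ hl0 hlt
        have h3 := one_le_geomConst hQ hδ hl0 u.card
        have h4 : 0 ≤ constFrac u.card (Fintype.card F) ((δ : ℝ) + lam) := by linarith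
        have := (γ u).2
        positivity
      refine mul_le_mul_of_nonneg_right (mul_le_mul_of_nonneg_right ?_ hN0) hS
      refine mul_le_mul_of_nonneg_right (mul_le_mul_of_nonneg_right ?_ (by norm_num)) hE.le
      exact le_mul_of_one_le_right (by positivity) (one_le_pow₀ hQ1.le)
    · rintro rfl
      have h1 := abs_integrationError_digitalNet_le φ hδ hl0 hl1 hp hq hr hf h hβ hC
        (W := fun κ => constInt κ (Fintype.card F) (δ + 1) *
          (β * n - t + δ + 1) ^ (κ * (δ + 1))) fun κ _ => by
            have h2 := geomConst_le_constInt (κ := κ) hQ hδ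
            have h3 := one_le_geomConst hQ hδ one_pos κ
            rw [mul_comm]
            exact mul_le_mul h2 (pow_le_pow_right₀ hR1 (Nat.sub_le _ _)) (by positivity)
              (by linarith)
      simp only [← mul_assoc] at h1 ⊢
      refine h1.trans ?_
      have hS : 0 ≤ ∑ u ∈ univ.filter (fun u : Finset (Fin s) => u.Nonempty),
          (γ u : ℝ) * constInt u.card (Fintype.card F) (δ + 1) *
            (β * n - t + δ + 1) ^ (u.card * (δ + 1)) := by
        refine Finset.sum_nonneg fun u _ => ?_
        have h2 := geomConst_le_constInt (κ := u.card) hQ hδ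
        have h3 := one_le_geomConst hQ hδ one_pos u.card
        have h4 : 0 ≤ constInt u.card (Fintype.card F) (δ + 1) := by linarith
        have := (γ u).2
        positivity
      refine mul_le_mul_of_nonneg_right (mul_le_mul_of_nonneg_right ?_ hN0) hS
      refine mul_le_mul_of_nonneg_right (mul_le_mul_of_nonneg_right ?_ (by norm_num)) hE.le
      rw [← Real.rpow_natCast _ (δ + 1), ← Real.rpow_add hQ0]
      refine Real.rpow_le_rpow_of_exponent_le hQ1.le ?_
      have hδ0 : (0 : ℝ) < (δ : ℝ) + 1 := by positivity
      have h2 := Nat.lt_floor_add_one ((β * n - t) / ((δ : ℝ) + 1))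
      rw [div_lt_iff₀ hδ0] at h2
      push_cast
      linarith
  · intro lam d t' hl0 hl1 hd
    exact exists_abs_integrationError_interlace_le F hs hδ γ hl0 hl1 hd
  · intro d _
    exact ⟨∑ j : Fin (s * d), ((coprimePoly F j).natDegree - 1), fun m hm hmt =>
      ⟨polyMatrix F (s * d) m, isDigitalNet_polyMatrix hm hmt⟩⟩
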